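/- Let $\mathbb{S}^1=\mathbb{R}/\mathbb{Z}$ with Lebesgue measure $m$ and rotations $R_\beta(x)=x+\beta$. Let $\mathcal H$ be the group of orientation-preserving homeomorphisms of $\mathbb{S}^1$ and $\mathcal H^\infty$ the group of orientation-preserving $C^\infty$ diffeomorphisms. Put $d_k(f,g)=\max\{\|f-g\|_k,\|f^{-1}-g^{-1}\|_k\}$, where $\|f-g\|_k=\max_{0\le i\le k}\max_x|D^i(f-g)(x)|$, and let $\mathcal H^\infty$ carry the metric $d_\infty=\sum_{k\ge1}\frac{d_k}{2^k(1+d_k)}$; convergence in $\mathrm{Diff}^\infty$ means convergence in every $d_k$. Fix a $C^\infty$ function $\psi:\mathbb{R}\to[0,1]$ with $\psi=0$ on $(-\infty,0]$, $\psi=1$ on $[1,\infty)$ and $\psi$ strictly increasing on $[0,1]$. For $0<t<1/10$ let $\hat h_t:[0,1]\to[0,1]$ be the increasing $C^\infty$ diffeomorphism \[ \hat h_t(x)=\begin{cases} x, & 0\le x\le t,\\ (1-\psi(\tfrac{x-t}{t}))\,x+\psi(\tfrac{x-t}{t})\,(t(x-\tfrac14)+3t), & t\le x\le 2t,\\ t(x-\tfrac14)+3t,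 & 2t\le x\le u_1,\\ (1-\psi(\tfrac{x-u_1}{t^2}))(t(x-\tfrac14)+3t)+\psi(\tfrac{x-u_1}{t^2})(t^{-1}(x-\tfrac12)+\tfrac12), & u_1\le x\le u_2,\\ t^{-1}(x-\tfrac12)+\tfrac12, & u_2\le x\le u_3,\\ (1-\psi(\tfrac{x-u_3}{t^2}))(t^{-1}(x-\tfrac12)+\tfrac12)+\psi(\tfrac{x-u_3}{t^2})(t(x-\tfrac34)+1-3t), & u_3\le x\le u_4,\\ t(x-\tfrac34)+1-3t, & u_4\le x\le 1-2t,\\ (1-\psi(\tfrac{x-1+2t}{t}))(t(x-\tfrac34)+1-3t)+\psi(\tfrac{x-1+2t}{t})\,x, & 1-2t\le x\le 1-t,\\ x, & 1-t\le x\le 1, \end{cases} \] with $u_1=\frac{1-t+8t^2}2$, $u_2=\frac{1-t+10t^2}2$, $u_3=\frac{1+t-10t^2}2$, $u_4=\frac{1+t-8t^2}2$. Given rational numbers $\alpha_n=p_n/q_n$ ($n\ge1$, $p_n\in\mathbb Z$, $q_n\in\mathbb N$), put $t_n=q_n^{1-2n}$ and, when $t_n<1/10$, let $\breve h_n\in\mathcal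 H^\infty$ be given by $\breve h_n(x)=2^{-(n+1)}\hat h_{t_n}(2^{n+1}x)$ for $x\in[0,2^{-(n+1)}]$ and $\breve h_n(x)=x$ for $x\in[2^{-(n+1)},1]$. Let $\overline h_{q_n}$ be the lift of $\breve h_n$ through the covering $x\mapsto q_nx$ of $\mathbb{S}^1$ that has a fixed point. For $a\in\{0,1\}^{\mathbb N}$, where $\mathbb N=\{1,2,\dots\}$, let $\overline h_{a,n}=\overline h_{q_n}$ if $a_n=0$ and $\overline h_{a,n}=\overline h_{q_n}^{-1}$ if $a_n=1$; put $\overline H_{a,0}=\mathrm{id}$ and $\overline H_{a,n}=\overline H_{a,n-1}\circ\overline h_{a,n}$. **Claim.** Let $\alpha$ be a Liouville number. There are rational numbers $\alpha_n=p_n/q_n\to\alpha$ with $t_n<1/10$ and $q_{n+1}\ge q_n^{2n}$ for all $n\ge1$ such that the following holds. 1. For every $a\in\{0,1\}^{\mathbb N}$, $\overline H_{a,n}$ converges in $d_0$ to some $\overline H_a\in\mathcal H$ with $\overline H_a(0)=0$, and both $\overline H_{a,n}\circ R_{\alpha_{n+1}}\circ\overline H_{a,n}^{-1}$ and $\overline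 H_{a,n}\circ R_{\alpha}\circ\overline H_{a,n}^{-1}$ converge in $\mathrm{Diff}^\infty$ to $\overline T_a=\overline H_a\circ R_\alpha\circ\overline H_a^{-1}\in\mathcal H^\infty$. 2. For every $a$, the conjugacy $\overline H_a$ is absolutely continuous: the unique $\overline T_a$-invariant Borel probability measure is equivalent to $m$, and $\overline H_a$ maps $m$-null sets to $m$-null sets. 3. Every $\overline T_a$ has rotation number $\alpha$ mod $1$; the map $a\mapsto\overline T_a$ from $\{0,1\}^{\mathbb N}$ to $\mathcal H^\infty$ is continuous and one-to-one; if $a_n=b_n$ for all sufficiently large $n$, then $\overline T_a$ and $\overline T_b$ are conjugate by an element of $\mathcal H^\infty$; if $a_n\ne b_n$ for infinitely many $n$, then there is no $g\in\mathcal H$ that is Hölder continuous with some exponent in $(0,1)$ and satisfies $\overline T_a=g\circ\overline T_b\circ g^{-1}$. -/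

import Mathlib

open Set Filter Topology MeasureTheory
open scoped ContDiff NNReal

noncomputable section

namespace CircleConj

/-- The circle `ℝ / ℤ`. -/
abbrev S1 : Type := UnitAddCircle

/-- `F : ℝ → ℝ` (increasing, with `F (x + 1) = F x + 1`) is a lift of the circle map `f`. -/
def IsLift (F : CircleDeg1Lift) (f : S1 → S1) : Prop :=
  Continuous F ∧ ∀ x : ℝ, ((F x : ℝ) : S1) = f (x : S1)

lemma IsLift.mul {F G : CircleDeg1Lift} {f g : S1 → S1} (hF : IsLift F f) (hG : IsLift G g) :
    IsLift (F * G) (f ∘ g) :=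
  ⟨by rw [CircleDeg1Lift.coe_mul]; exact hF.1.comp hG.1,
   fun x => by
    rw [CircleDeg1Lift.mul_apply, hF.2, hG.2, Function.comp_apply]⟩

lemma isLift_one : IsLift 1 (fun x => x) :=
  ⟨by rw [CircleDeg1Lift.coe_one]; exact continuous_id, fun x => by simp⟩

/-- The translation by `β`, as a lift of the rotation by `β`. -/
def translation (β : ℝ) : CircleDeg1Lift :=
  ⟨⟨fun x => x + β, fun _ _ h => add_le_add_left h β⟩, fun x => by
    change x + 1 + β = x + β + 1
    ring⟩

/-- The group of orientation-preserving homeomorphisms of the circle. The group operation is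
composition. -/
def HomeoPlus : Subgroup (S1 ≃ₜ S1) where
  carrier := {f | (∃ F : CircleDeg1Lift, IsLift F f) ∧ ∃ G : CircleDeg1Lift, IsLift G f.symm}
  mul_mem' := by
    rintro f g ⟨⟨F, hF⟩, F', hF'⟩ ⟨⟨G, hG⟩, G', hG'⟩
    exact ⟨⟨F * G, hF.mul hG⟩, ⟨G' * F', hG'.mul hF'⟩⟩
  one_mem' := ⟨⟨1, isLift_one⟩, ⟨1, isLift_one⟩⟩
  inv_mem' := by
    rintro f ⟨hF, hG⟩
    exact ⟨hG, hF⟩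

/-- The group of orientation-preserving `C^∞` diffeomorphisms of the circle. -/
def DiffPlus : Subgroup (S1 ≃ₜ S1) where
  carrier := {f | (∃ F : CircleDeg1Lift, IsLift F f ∧ ContDiff ℝ ∞ F) ∧
    ∃ G : CircleDeg1Lift, IsLift G f.symm ∧ ContDiff ℝ ∞ G}
  mul_mem' := by
    rintro f g ⟨⟨F, hF, cF⟩, F', hF', cF'⟩ ⟨⟨G, hG, cG⟩, G', hG', cG'⟩
    refine ⟨⟨F * G, hF.mul hG, ?_⟩, ⟨G' * F', hG'.mul hF', ?_⟩⟩
    · rw [CircleDeg1Lift.coe_mul]; exact cF.comp cG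
    · rw [CircleDeg1Lift.coe_mul]; exact cG'.comp cF'
  one_mem' := by
    have h : ContDiff ℝ ∞ (1 : CircleDeg1Lift) := by
      rw [CircleDeg1Lift.coe_one]; exact contDiff_id
    exact ⟨⟨1, isLift_one, h⟩, ⟨1, isLift_one, h⟩⟩
  inv_mem' := by
    rintro f ⟨hF, hG⟩
    exact ⟨hG, hF⟩

/-- The rotation `x ↦ x + β mod 1`. -/
def rot (β : ℝ) : DiffPlus :=
  ⟨Homeomorph.addRight (β : S1), by
    have key : ∀ γ : ℝ, ContDiff ℝ ∞ (translation γ) := fun γ => by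
      change ContDiff ℝ ∞ (fun x : ℝ => x + γ)
      fun_prop
    refine ⟨⟨translation β, ⟨(key β).continuous, fun x => ?_⟩, key β⟩,
      ⟨translation (-β), ⟨(key (-β)).continuous, fun x => ?_⟩, key (-β)⟩⟩
    · change ((x + β : ℝ) : S1) = (x : S1) + (β : S1)
      simp
    · change ((x + -β : ℝ) : S1) = (x : S1) + -(β : S1)
      simp⟩

/-- The circle homeomorphism `f` has rotation number `ρ` (an element of the circle): the class
modulo `1` of the translation number `lim (F^n x - x) / n` of a lift `F` of `f`. -/
def HasRotationNumber (f : S1 ≃ₜ S1) (ρ : S1) : Prop :=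
  ∃ F : CircleDeg1Lift, IsLift F f ∧ ((F.translationNumber : ℝ) : S1) = ρ

/-! ### The metrics `d_0`, `d_k`, `d_∞` -/

/-- The uniform distance of two circle maps. -/
def supDist (f g : S1 → S1) : ℝ := ⨆ x : S1, dist (f x) (g x)

/-- The metric `d_0` on homeomorphisms. -/
def d0 (f g : S1 ≃ₜ S1) : ℝ := max (supDist f g) (supDist f.symm g.symm)

/-- A lift of a diffeomorphism; its derivatives of order at least one do not depend on the
choice. -/
def someLift (f : DiffPlus) : CircleDeg1Lift := Classical.choose f.2.1

/-- `max_x |D^i (f - g) (x)|`. -/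
def derivDist : ℕ → DiffPlus → DiffPlus → ℝ
  | 0, f, g => supDist f.1 g.1
  | i + 1, f, g =>
      ⨆ x : ℝ, |iteratedDeriv (i + 1) (someLift f) x - iteratedDeriv (i + 1) (someLift g) x|

/-- `‖f - g‖_k`. -/
def normDist (k : ℕ) (f g : DiffPlus) : ℝ := ⨆ i : Fin (k + 1), derivDist i f g

/-- The metric `d_k`. -/
def dk (k : ℕ) (f g : DiffPlus) : ℝ := max (normDist k f g) (normDist k f⁻¹ g⁻¹)

/-- The metric `d_∞ = ∑_{k ≥ 1} d_k / (2^k (1 + d_k))`. -/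
def dInf (f g : DiffPlus) : ℝ :=
  ∑' k : ℕ, dk (k + 1) f g / (2 ^ (k + 1) * (1 + dk (k + 1) f g))

/-- Convergence in the `Diff^∞` topology. -/
def ConvergesDiff (T : ℕ → DiffPlus) (S : DiffPlus) : Prop :=
  ∀ k : ℕ, Tendsto (fun n => dk k (T n) S) atTop (𝓝 0)

/-! ### Conjugacy -/

/-- Conjugacy by an orientation-preserving `C^∞` diffeomorphism. -/
def SmoothConj (S T : DiffPlus) : Prop := ∃ g : DiffPlus, S = g * T * g⁻¹

/-- `S = g ∘ T ∘ g⁻¹` for an orientation-preserving homeomorphism `g` that is Hölder continuous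
with some exponent in `(0, 1)`. -/
def HolderConj (S T : DiffPlus) : Prop :=
  ∃ g ∈ HomeoPlus, (∃ C r : ℝ≥0, 0 < r ∧ r < 1 ∧ HolderWith C r g) ∧
    (S : S1 ≃ₜ S1) = g * (T : S1 ≃ₜ S1) * g⁻¹

/-- The homeomorphism `H`, conjugating a rotation to `T`, is an absolutely continuous conjugacy:
the unique `T`-invariant Borel probability measure exists and is equivalent to Lebesgue measure,
and `H` maps Lebesgue null sets to Lebesgue null sets. -/
def AbsContConj (H : S1 ≃ₜ S1) (T : DiffPlus) : Prop :=
  (∃ μ : Measure S1, (IsProbabilityMeasure μ ∧ μ.map T.1 = μ) ∧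
    (∀ ν : Measure S1, IsProbabilityMeasure ν → ν.map T.1 = ν → ν = μ) ∧
    μ ≪ volume ∧ volume ≪ μ) ∧
  ∀ N : Set S1, volume N = 0 → volume (H '' N) = 0

/-! ### The conjugation maps -/

/-- A smooth step function: `0` on `(-∞, 0]`, `1` on `[1, ∞)`, strictly increasing on `[0, 1]`. -/
structure IsStep (ψ : ℝ → ℝ) : Prop where
  smooth : ContDiff ℝ ∞ ψ
  zero : ∀ x ≤ 0, ψ x = 0
  one : ∀ x, 1 ≤ x → ψ x = 1
  strictMono : StrictMonoOn ψ (Icc 0 1)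

/-- The map `ĥ_t` of `[0, 1]`. -/
def hHat (ψ : ℝ → ℝ) (t x : ℝ) : ℝ :=
  if x ≤ t then x
  else if x ≤ 2 * t then
    (1 - ψ (t⁻¹ * (x - t))) * x + ψ (t⁻¹ * (x - t)) * (t * (x - 1 / 4) + 3 * t)
  else if x ≤ (1 - t + 8 * t ^ 2) / 2 then t * (x - 1 / 4) + 3 * t
  else if x ≤ (1 - t + 10 * t ^ 2) / 2 then
    (1 - ψ ((t ^ 2)⁻¹ * (x - (1 - t + 8 * t ^ 2) / 2))) * (t * (x - 1 / 4) + 3 * t)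
      + ψ ((t ^ 2)⁻¹ * (x - (1 - t + 8 * t ^ 2) / 2)) * (t⁻¹ * (x - 1 / 2) + 1 / 2)
  else if x ≤ (1 + t - 10 * t ^ 2) / 2 then t⁻¹ * (x - 1 / 2) + 1 / 2
  else if x ≤ (1 + t - 8 * t ^ 2) / 2 then
    (1 - ψ ((t ^ 2)⁻¹ * (x - (1 + t - 10 * t ^ 2) / 2))) * (t⁻¹ * (x - 1 / 2) + 1 / 2)
      + ψ ((t ^ 2)⁻¹ * (x - (1 + t - 10 * t ^ 2) / 2)) * (t * (x - 3 / 4) + 1 - 3 * t)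
  else if x ≤ 1 - 2 * t then t * (x - 3 / 4) + 1 - 3 * t
  else if x ≤ 1 - t then
    (1 - ψ (t⁻¹ * (x - 1 + 2 * t))) * (t * (x - 3 / 4) + 1 - 3 * t)
      + ψ (t⁻¹ * (x - 1 + 2 * t)) * x
  else x

/-- The map of `[0, 1]` that is a copy of `ĥ_t` on `[0, 2^{-(n+1)}]` and the identity elsewhere. -/
def hBreve (ψ : ℝ → ℝ) (n : ℕ) (t x : ℝ) : ℝ :=
  if x ≤ 1 / 2 ^ (n + 1) then (1 / 2 ^ (n + 1)) * hHat ψ t (2 ^ (n + 1) * x) else x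

/-- The parameter `t_n = q_n^{1 - 2n}`. -/
def tParam (n q : ℕ) : ℝ := (q : ℝ) ^ (1 - 2 * (n : ℤ))

/-- The lift to `ℝ` of `h̄_{q_n}`, that is, of the lift of the circle map `hBreve` through the
`q`-fold covering `x ↦ q x` of the circle that has fixed points. -/
def hBarLift (ψ : ℝ → ℝ) (n q : ℕ) (x : ℝ) : ℝ :=
  (⌊(q : ℝ) * x⌋ + hBreve ψ n (tParam n q) (Int.fract ((q : ℝ) * x))) / q

/-- `h̄_{a,n}`: the map `h n` if `a_n = 0`, its inverse if `a_n = 1`. -/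
def hSeq (h : ℕ+ → DiffPlus) (a : ℕ+ → Bool) (n : ℕ+) : DiffPlus :=
  if a n then (h n)⁻¹ else h n

/-- `H̄_{a,0} = id` and `H̄_{a,n} = H̄_{a,n-1} ∘ h̄_{a,n}`. -/
def HSeq (h : ℕ+ → DiffPlus) (a : ℕ+ → Bool) : ℕ → DiffPlus
  | 0 => 1
  | n + 1 => HSeq h a n * hSeq h a n.succPNat

/-- `H̄_{a,n} ∘ R_β ∘ H̄_{a,n}⁻¹`. -/
def conjRot (h : ℕ+ → DiffPlus) (a : ℕ+ → Bool) (n : ℕ) (β : ℝ) : DiffPlus :=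
  HSeq h a n * rot β * (HSeq h a n)⁻¹

end CircleConj

end

/-! Convergence. A map lifted through `x ↦ q x` commutes with every rotation by a multiple of `1 /
q` (`hL_mul_trL`), so the new factor cancels from the conjugate of `R_{p_n/q_n}`
(`Scheme.conjL_L_succ`). Passing from `H_{n-1} R_α H_{n-1}⁻¹` to `H_n R_α H_n⁻¹` therefore costs
only two replacements of `α` by `p_n / q_n`. As `t_n⁻¹` is a power of `q_n`, all derivatives of
`h_n` and of its inverse are bounded by powers of `q_n` (`polyGrowth_hL`, `polyGrowth_hL_inv`). A
Liouville number has rational approximations better than any such power, so the cost can be made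
smaller than `2^{-n}` in `C^n`. Up to step `n` only finitely many conjugations occur, whatever the
code `a`, so a single sequence of rationals serves all codes (`exists_goodStep`, `exists_scheme`).

Absolute continuity. The `n`-th factor is the identity off a set of measure `2^{-(n+1)}`. For large
`q_n` this set is so evenly spread that the earlier conjugations at most about double its measure.
These measures are summable, so `H_a` agrees with a smooth diffeomorphism off a set that is small
together with its image, and null sets are preserved in both directions (`Scheme.volume_image_H`,
`Scheme.volume_preimage_H`).

Rigidity. A homeomorphism commuting with `R_α` is a rotation, so every conjugacy from `T_b` to `T_a`
has the form `H_a R_β H_b⁻¹`. At a step where the codes differ it contains `h τ h` or `h⁻¹ τ h⁻¹`,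
where `τ` is almost a translation. The two distortions do not cancel: after rescaling, some interval
of length at most `4 t_n` acquires length at least `1/10` (`IsModel.exists_expand`). Since `t_n =
q_n^{1-2n}` and the earlier conjugations cost only fixed powers of `q_n`, every Hölder estimate
fails (`Scheme.exists_expand`). For injectivity, `T_a = T_b` forces `H_a = H_b`, and at the first
differing digit `h ∘ h` would have to be almost the identity. -/

noncomputable section

namespace CircleConj

/-! ### Families of smooth functions with polynomially bounded derivatives -/

section PolyGrowth

variable {ι : Type*} {s : ι → ℝ} {X : Set ℝ} {F G : ι → ℝ → ℝ} {k : ℕ}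

/-- A family of smooth functions bounded on `X` by a polynomial in the scale `s`. -/
structure PolyBd (s : ι → ℝ) (X : Set ℝ) (F : ι → ℝ → ℝ) : Prop where
  smooth : ∀ j, ContDiff ℝ ∞ (F j)
  bound : ∃ C : ℝ, 0 ≤ C ∧ ∃ N : ℕ, ∀ j, ∀ x ∈ X, |F j x| ≤ C * s j ^ N

/-- A family of smooth functions whose derivatives of order at most `k` are bounded on `X` by a
polynomial in the scale `s`. -/
def PolyGrowth (s : ι → ℝ) (X : Set ℝ) : ℕ → (ι → ℝ → ℝ) → Prop
  | 0, F => PolyBd s X F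
  | k + 1, F => PolyBd s X F ∧ PolyGrowth s X k (fun j => deriv (F j))

lemma PolyGrowth.bd (h : PolyGrowth s X k F) : PolyBd s X F := by
  cases k with
  | zero => exact h
  | succ k => exact h.1

lemma PolyGrowth.pred (h : PolyGrowth s X (k + 1) F) : PolyGrowth s X k F := by
  induction k generalizing F with
  | zero => exact h.1
  | succ k ih => exact ⟨h.1, ih h.2⟩

lemma PolyGrowth.mono {l : ℕ} (h : PolyGrowth s X k F) (hl : l ≤ k) : PolyGrowth s X l F := by
  induction hl with
  | refl => exact h
  | step _ ih => exact ih h.pred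

lemma PolyGrowth.iteratedDeriv (h : PolyGrowth s X k F) {i : ℕ} (hi : i ≤ k) :
    ∃ C : ℝ, 0 ≤ C ∧ ∃ N : ℕ, ∀ j, ∀ x ∈ X, |iteratedDeriv i (F j) x| ≤ C * s j ^ N := by
  induction i generalizing F k with
  | zero => simpa using h.bd.bound
  | succ i ih =>
    obtain ⟨k, rfl⟩ : ∃ l, k = l + 1 := ⟨k - 1, by omega⟩
    simpa [iteratedDeriv_succ'] using ih h.2 (by omega)

lemma contDiff_deriv {f : ℝ → ℝ} (hf : ContDiff ℝ ∞ f) : ContDiff ℝ ∞ (deriv f) :=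
  (contDiff_infty_iff_deriv.1 hf).2

lemma polyGrowth_of_iteratedDeriv (hF : ∀ j, ContDiff ℝ ∞ (F j))
    (h : ∀ i ≤ k, ∃ C : ℝ, 0 ≤ C ∧ ∃ N : ℕ, ∀ j, ∀ x ∈ X,
      |iteratedDeriv i (F j) x| ≤ C * s j ^ N) : PolyGrowth s X k F := by
  induction k generalizing F with
  | zero => exact ⟨hF, by simpa using h 0 le_rfl⟩
  | succ k ih =>
    refine ⟨⟨hF, by simpa using h 0 (by omega)⟩, ih (fun j => contDiff_deriv (hF j)) ?_⟩
    intro i hi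
    simpa [iteratedDeriv_succ'] using h (i + 1) (by omega)

lemma PolyGrowth.congr (h : PolyGrowth s X k F) (hFG : ∀ j, G j = F j) : PolyGrowth s X k G := by
  have : G = F := funext hFG
  rwa [this]

lemma polyGrowth_const (c : ι → ℝ)
    (hc : ∃ C : ℝ, 0 ≤ C ∧ ∃ N : ℕ, ∀ j, |c j| ≤ C * s j ^ N) :
    PolyGrowth s X k (fun j _ => c j) := by
  refine polyGrowth_of_iteratedDeriv (fun j => contDiff_const) fun i _ => ?_
  obtain ⟨C, hC, N, h⟩ := hc
  rcases Nat.eq_zero_or_pos i with rfl | hi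
  · exact ⟨C, hC, N, fun j x _ => by simpa using h j⟩
  · exact ⟨0, le_rfl, 0, fun j x _ => by simp [iteratedDeriv_const, hi.ne']⟩

lemma PolyBd.add (hs : ∀ j, 1 ≤ s j) (hF : PolyBd s X F) (hG : PolyBd s X G) :
    PolyBd s X (fun j x => F j x + G j x) := by
  refine ⟨fun j => (hF.smooth j).add (hG.smooth j), ?_⟩
  obtain ⟨C, hC, N, h⟩ := hF.bound
  obtain ⟨D, hD, M, h'⟩ := hG.bound
  refine ⟨C + D, add_nonneg hC hD, max N M, fun j x hx => ?_⟩
  have h1 : s j ^ N ≤ s j ^ max N M := pow_le_pow_right₀ (hs j) (le_max_left _ _)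
  have h2 : s j ^ M ≤ s j ^ max N M := pow_le_pow_right₀ (hs j) (le_max_right _ _)
  calc |F j x + G j x| ≤ |F j x| + |G j x| := abs_add_le _ _
    _ ≤ C * s j ^ N + D * s j ^ M := add_le_add (h j x hx) (h' j x hx)
    _ ≤ C * s j ^ max N M + D * s j ^ max N M := by gcongr
    _ = _ := by ring

lemma PolyBd.mul (hs : ∀ j, 1 ≤ s j) (hF : PolyBd s X F) (hG : PolyBd s X G) :
    PolyBd s X (fun j x => F j x * G j x) := by
  refine ⟨fun j => (hF.smooth j).mul (hG.smooth j), ?_⟩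
  obtain ⟨C, hC, N, h⟩ := hF.bound
  obtain ⟨D, hD, M, h'⟩ := hG.bound
  refine ⟨C * D, mul_nonneg hC hD, N + M, fun j x hx => ?_⟩
  have h0 : 0 ≤ s j := zero_le_one.trans (hs j)
  rw [abs_mul, pow_add]
  calc |F j x| * |G j x| ≤ (C * s j ^ N) * (D * s j ^ M) :=
        mul_le_mul (h j x hx) (h' j x hx) (abs_nonneg _) (by positivity)
    _ = _ := by ring

lemma differentiable_of_smooth {f : ℝ → ℝ} (hf : ContDiff ℝ ∞ f) : Differentiable ℝ f :=
  hf.differentiable (by simp)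

lemma PolyGrowth.add (hs : ∀ j, 1 ≤ s j) (hF : PolyGrowth s X k F) (hG : PolyGrowth s X k G) :
    PolyGrowth s X k (fun j x => F j x + G j x) := by
  induction k generalizing F G with
  | zero => exact PolyBd.add hs hF hG
  | succ k ih =>
    refine ⟨hF.1.add hs hG.1, (ih hF.2 hG.2).congr fun j => funext fun x => ?_⟩
    exact deriv_fun_add (differentiable_of_smooth (hF.1.smooth j) x)
      (differentiable_of_smooth (hG.1.smooth j) x)

lemma PolyGrowth.mul (hs : ∀ j, 1 ≤ s j) (hF : PolyGrowth s X k F) (hG : PolyGrowth s X k G) :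
    PolyGrowth s X k (fun j x => F j x * G j x) := by
  induction k generalizing F G with
  | zero => exact PolyBd.mul hs hF hG
  | succ k ih =>
    refine ⟨hF.1.mul hs hG.1,
      ((ih hF.2 hG.pred).add hs (ih hF.pred hG.2)).congr fun j => funext fun x => ?_⟩
    exact deriv_fun_mul (differentiable_of_smooth (hF.1.smooth j) x)
      (differentiable_of_smooth (hG.1.smooth j) x)

lemma PolyGrowth.neg (hs : ∀ j, 1 ≤ s j) (hF : PolyGrowth s X k F) :
    PolyGrowth s X k (fun j x => -F j x) := by
  have h : PolyGrowth s X k (fun (_ : ι) (_ : ℝ) => (-1 : ℝ)) :=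
    polyGrowth_const (fun _ => (-1 : ℝ)) ⟨1, zero_le_one, 0, by simp⟩
  exact (h.mul hs hF).congr fun j => funext fun x => by ring

lemma PolyGrowth.sub (hs : ∀ j, 1 ≤ s j) (hF : PolyGrowth s X k F) (hG : PolyGrowth s X k G) :
    PolyGrowth s X k (fun j x => F j x - G j x) :=
  (hF.add hs (hG.neg hs)).congr fun j => funext fun x => by ring

/-- Composition: derivatives of the inner family of order between one and `k` are enough. -/
lemma PolyGrowth.comp (hs : ∀ j, 1 ≤ s j) {Y : Set ℝ} (hF : PolyGrowth s Y k F)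
    (hG : ∀ j, ContDiff ℝ ∞ (G j)) (hGX : ∀ j, MapsTo (G j) X Y)
    (hG' : ∀ l < k, PolyGrowth s X l (fun j => deriv (G j))) :
    PolyGrowth s X k (fun j x => F j (G j x)) := by
  have bd : ∀ F : ι → ℝ → ℝ, PolyBd s Y F → PolyBd s X (fun j x => F j (G j x)) := by
    intro F hF
    obtain ⟨C, hC, N, h⟩ := hF.bound
    exact ⟨fun j => (hF.smooth j).comp (hG j), C, hC, N, fun j x hx => h j _ (hGX j hx)⟩
  induction k generalizing F with
  | zero => exact bd F hF
  | succ k ih =>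
    refine ⟨bd F hF.1, ((ih hF.2 fun l hl => hG' l (by omega)).mul hs
      (hG' k (by omega))).congr fun j => funext fun x => ?_⟩
    exact deriv_comp x (differentiable_of_smooth (hF.1.smooth j) _)
      (differentiable_of_smooth (hG j) x)

lemma PolyGrowth.inv (hs : ∀ j, 1 ≤ s j) (hF : PolyGrowth s X k F) (hpos : ∀ j x, 0 < F j x)
    (hlow : ∃ C : ℝ, 0 ≤ C ∧ ∃ N : ℕ, ∀ j, ∀ x ∈ X, (F j x)⁻¹ ≤ C * s j ^ N) :
    PolyGrowth s X k (fun j x => (F j x)⁻¹) := by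
  have bd : PolyBd s X (fun j x => (F j x)⁻¹) := by
    obtain ⟨C, hC, N, h⟩ := hlow
    refine ⟨fun j => (hF.bd.smooth j).inv fun x => (hpos j x).ne', C, hC, N, fun j x hx => ?_⟩
    rw [abs_of_pos (inv_pos.2 (hpos j x))]
    exact h j x hx
  induction k with
  | zero => exact bd
  | succ k ih =>
    have h1 := ih hF.pred
    refine ⟨bd, ((hF.2.neg hs).mul hs (h1.mul hs h1)).congr fun j => funext fun x => ?_⟩
    have := deriv_fun_inv'' (differentiable_of_smooth (hF.bd.smooth j) x) (hpos j x).ne'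
    rw [this]
    field_simp

/-- The inverse functions of a family with polynomially bounded derivatives. -/
lemma PolyGrowth.deriv_symm (hs : ∀ j, 1 ≤ s j) (hF : ∀ j, ContDiff ℝ ∞ (F j))
    (hF' : ∀ l, PolyGrowth s univ l (fun j => deriv (F j)))
    (hpos : ∀ j x, 0 < deriv (F j) x)
    (hlow : ∃ C : ℝ, 0 ≤ C ∧ ∃ N : ℕ, ∀ j, ∀ x ∈ univ, (deriv (F j) x)⁻¹ ≤ C * s j ^ N)
    (hG : ∀ j, ContDiff ℝ ∞ (G j)) (hFG : ∀ j x, F j (G j x) = x) (k : ℕ) :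
    PolyGrowth s univ k (fun j => deriv (G j)) := by
  induction k using Nat.strong_induction_on with
  | _ k ih =>
    -- Since `G' = (1 / F') ∘ G`, order `k` of `G'` involves only lower orders of `G'`. This is why
    -- `PolyGrowth.comp` asks for the inner derivative at levels `l < k` only.
    refine (((hF' k).inv hs hpos hlow).comp hs hG (fun _ => mapsTo_univ _ _) ih).congr
      fun j => funext fun x => ?_
    have h1 : HasDerivAt (fun x => F j (G j x)) (deriv (F j) (G j x) * deriv (G j) x) x :=
      (differentiable_of_smooth (hF j) _).hasDerivAt.comp x
        (differentiable_of_smooth (hG j) x).hasDerivAt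
    have h2 : (fun x => F j (G j x)) = id := funext fun x => hFG j x
    rw [h2] at h1
    have h3 := h1.unique (hasDerivAt_id x)
    have := (hpos j (G j x)).ne'
    field_simp
    linarith

lemma PolyGrowth.deriv_comp (hs : ∀ j, 1 ≤ s j) (hF : ∀ j, ContDiff ℝ ∞ (F j))
    (hF' : PolyGrowth s univ k (fun j => deriv (F j))) (hG : ∀ j, ContDiff ℝ ∞ (G j))
    (hG' : PolyGrowth s X k (fun j => deriv (G j))) :
    PolyGrowth s X k (fun j => deriv (fun x => F j (G j x))) :=
  ((hF'.comp hs hG (fun _ => mapsTo_univ _ _) fun _ hl => hG'.mono hl.le).mul hs hG').congr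
    fun j => funext fun x => _root_.deriv_comp x (differentiable_of_smooth (hF j) _)
      (differentiable_of_smooth (hG j) x)

/-- Difference quotients along translations. -/
lemma PolyGrowth.translation_quotient {β γ : ι → ℝ} (hF : ∀ j, ContDiff ℝ ∞ (F j))
    (hF' : PolyGrowth s univ k (fun j => deriv (F j))) :
    PolyGrowth s univ k (fun j x => (β j - γ j)⁻¹ * (F j (x + β j) - F j (x + γ j))) := by
  have bd : ∀ F : ι → ℝ → ℝ, (∀ j, ContDiff ℝ ∞ (F j)) →
      PolyBd s univ (fun j => deriv (F j)) →
      PolyBd s univ (fun j x => (β j - γ j)⁻¹ * (F j (x + β j) - F j (x + γ j))) := by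
    intro F hF hF'
    obtain ⟨C, hC, N, h⟩ := hF'.bound
    refine ⟨fun j => ?_, C, hC, N, fun j x _ => ?_⟩
    · have := hF j
      fun_prop
    have h1 := convex_univ.norm_image_sub_le_of_norm_deriv_le (𝕜 := ℝ) (f := F j)
      (fun y _ => (differentiable_of_smooth (hF j)) y) (fun y _ => h j y (mem_univ y))
      (mem_univ (x + γ j)) (mem_univ (x + β j))
    rw [Real.norm_eq_abs, Real.norm_eq_abs, add_sub_add_left_eq_sub] at h1
    rw [abs_mul, abs_inv]
    -- For equal angles the quotient is `0`, by the convention `0⁻¹ = 0`.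
    rcases eq_or_ne (β j) (γ j) with h0 | h0
    · rw [h0, sub_self, abs_zero, inv_zero, zero_mul]
      exact (abs_nonneg _).trans (h j 0 (mem_univ _))
    · have h2 : 0 < |β j - γ j| := abs_pos.2 (sub_ne_zero.2 h0)
      rw [inv_mul_le_iff₀ h2, mul_comm]
      exact h1
  induction k generalizing F with
  | zero => exact bd F hF hF'
  | succ k ih =>
    refine ⟨bd F hF hF'.1, (ih (fun j => contDiff_deriv (hF j)) hF'.2).congr
      fun j => funext fun x => ?_⟩
    have h1 : ∀ c : ℝ, HasDerivAt (fun x => F j (x + c)) (deriv (F j) (x + c)) x := fun c =>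
      (differentiable_of_smooth (hF j) (x + c)).hasDerivAt.comp_add_const x c
    exact (((h1 (β j)).sub (h1 (γ j))).const_mul _).deriv

end PolyGrowth

/-! ### The step function -/

section Step

variable {ψ : ℝ → ℝ}

/-- `ψ` is unchanged by first clamping its argument to `[0, 1]`, where it is increasing. -/
lemma IsStep.monotone (hψ : IsStep ψ) : Monotone ψ := by
  have key : ∀ x, ψ x = ψ (max 0 (min 1 x)) := by
    intro x
    rcases le_total x 0 with h | h
    · rw [hψ.zero x h, max_eq_left ((min_le_right _ _).trans h), hψ.zero 0 le_rfl]
    · rcases le_total 1 x with h1 | h1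
      · rw [hψ.one x h1, min_eq_left h1, max_eq_right zero_le_one, hψ.one 1 le_rfl]
      · rw [min_eq_right h1, max_eq_right h]
  intro x y hxy
  rw [key x, key y]
  exact hψ.strictMono.monotoneOn ⟨le_max_left _ _, max_le zero_le_one (min_le_left _ _)⟩
    ⟨le_max_left _ _, max_le zero_le_one (min_le_left _ _)⟩
    (max_le_max le_rfl (min_le_min le_rfl hxy))

lemma IsStep.nonneg (hψ : IsStep ψ) (x : ℝ) : 0 ≤ ψ x := by
  rw [← hψ.zero (min x 0) (min_le_right _ _)]
  exact hψ.monotone (min_le_left _ _)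

lemma IsStep.le_one (hψ : IsStep ψ) (x : ℝ) : ψ x ≤ 1 := by
  rw [← hψ.one (max x 1) (le_max_right _ _)]
  exact hψ.monotone (le_max_left _ _)

lemma IsStep.deriv_nonneg (hψ : IsStep ψ) (x : ℝ) : 0 ≤ deriv ψ x :=
  hψ.monotone.deriv_nonneg

lemma IsStep.deriv_eq_zero_of_nonpos (hψ : IsStep ψ) {x : ℝ} (hx : x ≤ 0) : deriv ψ x = 0 :=
  IsLocalMin.deriv_eq_zero (Eventually.of_forall fun y => by
    rw [hψ.zero x hx]; exact hψ.nonneg y)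

lemma IsStep.deriv_eq_zero_of_one_le (hψ : IsStep ψ) {x : ℝ} (hx : 1 ≤ x) : deriv ψ x = 0 :=
  IsLocalMax.deriv_eq_zero (Eventually.of_forall fun y => by
    rw [hψ.one x hx]; exact hψ.le_one y)

lemma hasCompactSupport_iteratedDeriv {f : ℝ → ℝ} (hf : HasCompactSupport f) (i : ℕ) :
    HasCompactSupport (iteratedDeriv i f) := by
  induction i with
  | zero => simpa using hf
  | succ i ih => rw [iteratedDeriv_succ]; exact ih.deriv

lemma IsStep.iteratedDeriv_bounded (hψ : IsStep ψ) (i : ℕ) :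
    ∃ C : ℝ, 0 ≤ C ∧ ∀ x, |iteratedDeriv i ψ x| ≤ C := by
  rcases i with - | i
  · exact ⟨1, zero_le_one, fun x => by
      rw [iteratedDeriv_zero, abs_of_nonneg (hψ.nonneg x)]; exact hψ.le_one x⟩
  · have h1 : HasCompactSupport (deriv ψ) :=
      HasCompactSupport.intro (isCompact_Icc (a := (0 : ℝ)) (b := 1)) fun x hx => by
        rw [mem_Icc, not_and_or, not_le, not_le] at hx
        exact hx.elim (fun h => hψ.deriv_eq_zero_of_nonpos h.le)
          (fun h => hψ.deriv_eq_zero_of_one_le h.le)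
    obtain ⟨C, hC⟩ := (hasCompactSupport_iteratedDeriv h1 i).exists_bound_of_continuous
      ((contDiff_deriv hψ.smooth).continuous_iteratedDeriv i (by exact_mod_cast le_top))
    exact ⟨C, (norm_nonneg _).trans (hC 0), fun x => by
      rw [iteratedDeriv_succ']; exact hC x⟩

lemma IsStep.polyGrowth (hψ : IsStep ψ) {ι : Type*} (s : ι → ℝ) (X : Set ℝ) (k : ℕ) :
    PolyGrowth s X k (fun _ => ψ) :=
  polyGrowth_of_iteratedDeriv (fun _ => hψ.smooth) fun i _ => by
    obtain ⟨C, hC, h⟩ := hψ.iteratedDeriv_bounded i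
    exact ⟨C, hC, 0, fun j x _ => by simpa using h x⟩

end Step

/-! ### A global formula for `hHat` -/

/-- The map `hHat`, written without case distinctions. -/
def hSm (ψ : ℝ → ℝ) (t x : ℝ) : ℝ :=
  x + ψ (t⁻¹ * (x - t)) * (t * (x - 1 / 4) + 3 * t - x)
    + ψ ((t ^ 2)⁻¹ * (x - (1 - t + 8 * t ^ 2) / 2))
      * ((t⁻¹ * (x - 1 / 2) + 1 / 2) - (t * (x - 1 / 4) + 3 * t))
    + ψ ((t ^ 2)⁻¹ * (x - (1 + t - 10 * t ^ 2) / 2))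
      * ((t * (x - 3 / 4) + 1 - 3 * t) - (t⁻¹ * (x - 1 / 2) + 1 / 2))
    + ψ (t⁻¹ * (x - 1 + 2 * t)) * (x - (t * (x - 3 / 4) + 1 - 3 * t))

section HSm

variable {ψ : ℝ → ℝ} {t : ℝ}

lemma IsStep.zero_mul (hψ : IsStep ψ) {c y : ℝ} (hc : 0 < c) (hy : y ≤ 0) : ψ (c⁻¹ * y) = 0 :=
  hψ.zero _ (mul_nonpos_of_nonneg_of_nonpos (inv_pos.2 hc).le hy)

lemma IsStep.one_mul (hψ : IsStep ψ) {c y : ℝ} (hc : 0 < c) (hy : c ≤ y) : ψ (c⁻¹ * y) = 1 :=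
  hψ.one _ (by rw [inv_mul_eq_div]; exact (one_le_div hc).2 hy)

/-- The transition intervals are disjoint because `10 t² < t`. At a given point the transitions
already passed have `ψ = 1` and telescope to the current affine branch, and those still ahead have
`ψ = 0`. -/
lemma hHat_eq (hψ : IsStep ψ) (ht : 0 < t) (ht' : t < 1 / 10) (x : ℝ) :
    hHat ψ t x = hSm ψ t x := by
  have ht2 : 0 < t ^ 2 := by positivity
  have hsq : t ^ 2 < t / 10 := by nlinarith
  unfold hHat hSm
  split_ifs with h1 h2 h3 h4 h5 h6 h7 h8
  · rw [hψ.zero_mul ht (by linarith), hψ.zero_mul ht2 (by linarith),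
      hψ.zero_mul ht2 (by linarith), hψ.zero_mul ht (by linarith)]; ring
  · rw [hψ.zero_mul ht2 (y := x - (1 - t + 8 * t ^ 2) / 2) (by linarith),
      hψ.zero_mul ht2 (by linarith), hψ.zero_mul ht (y := x - 1 + 2 * t) (by linarith)]; ring
  · rw [hψ.one_mul ht (y := x - t) (by linarith), hψ.zero_mul ht2 (by linarith),
      hψ.zero_mul ht2 (by linarith), hψ.zero_mul ht (by linarith)]; ring
  · rw [hψ.one_mul ht (y := x - t) (by linarith),
      hψ.zero_mul ht2 (y := x - (1 + t - 10 * t ^ 2) / 2) (by linarith),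
      hψ.zero_mul ht (by linarith)]; ring
  · rw [hψ.one_mul ht (y := x - t) (by linarith),
      hψ.one_mul ht2 (y := x - (1 - t + 8 * t ^ 2) / 2) (by linarith),
      hψ.zero_mul ht2 (by linarith), hψ.zero_mul ht (by linarith)]; ring
  · rw [hψ.one_mul ht (y := x - t) (by linarith),
      hψ.one_mul ht2 (y := x - (1 - t + 8 * t ^ 2) / 2) (by linarith),
      hψ.zero_mul ht (y := x - 1 + 2 * t) (by linarith)]; ring
  · rw [hψ.one_mul ht (y := x - t) (by linarith),
      hψ.one_mul ht2 (y := x - (1 - t + 8 * t ^ 2) / 2) (by linarith),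
      hψ.one_mul ht2 (by linarith), hψ.zero_mul ht (by linarith)]; ring
  · rw [hψ.one_mul ht (y := x - t) (by linarith),
      hψ.one_mul ht2 (y := x - (1 - t + 8 * t ^ 2) / 2) (by linarith),
      hψ.one_mul ht2 (by linarith)]; ring
  · rw [hψ.one_mul ht (y := x - t) (by linarith),
      hψ.one_mul ht2 (y := x - (1 - t + 8 * t ^ 2) / 2) (by linarith),
      hψ.one_mul ht2 (by linarith), hψ.one_mul ht (by linarith)]; ring

lemma hSm_of_le (hψ : IsStep ψ) (ht : 0 < t) (ht' : t < 1 / 10) {x : ℝ} (hx : x ≤ t) :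
    hSm ψ t x = x := by
  rw [← hHat_eq hψ ht ht', hHat, if_pos hx]

lemma hSm_of_ge (hψ : IsStep ψ) (ht : 0 < t) (ht' : t < 1 / 10) {x : ℝ} (hx : 1 - t ≤ x) :
    hSm ψ t x = x := by
  have ht2 : 0 < t ^ 2 := by positivity
  have hsq : t ^ 2 < t / 10 := by nlinarith
  rw [hSm, hψ.one_mul ht (y := x - t) (by linarith),
      hψ.one_mul ht2 (y := x - (1 - t + 8 * t ^ 2) / 2) (by linarith),
      hψ.one_mul ht2 (by linarith), hψ.one_mul ht (by linarith)]; ring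

lemma hSm_left (hψ : IsStep ψ) (ht : 0 < t) (ht' : t < 1 / 10) {x : ℝ} (hx : 2 * t ≤ x)
    (hx' : x ≤ (1 - t + 8 * t ^ 2) / 2) : hSm ψ t x = t * (x - 1 / 4) + 3 * t := by
  have ht2 : 0 < t ^ 2 := by positivity
  have hsq : t ^ 2 < t / 10 := by nlinarith
  rw [hSm, hψ.one_mul ht (y := x - t) (by linarith), hψ.zero_mul ht2 (by linarith),
    hψ.zero_mul ht2 (by linarith), hψ.zero_mul ht (by linarith)]; ring

lemma hSm_middle (hψ : IsStep ψ) (ht : 0 < t) (ht' : t < 1 / 10) {x : ℝ}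
    (hx : (1 - t + 10 * t ^ 2) / 2 ≤ x) (hx' : x ≤ (1 + t - 10 * t ^ 2) / 2) :
    hSm ψ t x = t⁻¹ * (x - 1 / 2) + 1 / 2 := by
  have ht2 : 0 < t ^ 2 := by positivity
  have hsq : t ^ 2 < t / 10 := by nlinarith
  rw [hSm, hψ.one_mul ht (y := x - t) (by linarith),
    hψ.one_mul ht2 (y := x - (1 - t + 8 * t ^ 2) / 2) (by linarith),
    hψ.zero_mul ht2 (by linarith), hψ.zero_mul ht (by linarith)]; ring

lemma hSm_right (hψ : IsStep ψ) (ht : 0 < t) (ht' : t < 1 / 10) {x : ℝ}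
    (hx : (1 + t - 8 * t ^ 2) / 2 ≤ x) (hx' : x ≤ 1 - 2 * t) :
    hSm ψ t x = t * (x - 3 / 4) + 1 - 3 * t := by
  have ht2 : 0 < t ^ 2 := by positivity
  have hsq : t ^ 2 < t / 10 := by nlinarith
  rw [hSm, hψ.one_mul ht (y := x - t) (by linarith),
    hψ.one_mul ht2 (y := x - (1 - t + 8 * t ^ 2) / 2) (by linarith),
    hψ.one_mul ht2 (by linarith), hψ.zero_mul ht (by linarith)]; ring

lemma contDiff_hSm (hψ : IsStep ψ) : ContDiff ℝ ∞ (hSm ψ t) := by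
  have := hψ.smooth
  unfold hSm
  fun_prop

lemma IsStep.hasDerivAt_comp (hψ : IsStep ψ) (c x : ℝ) {g : ℝ → ℝ} (hg : HasDerivAt g 1 x) :
    HasDerivAt (fun x => ψ (c⁻¹ * g x)) (deriv ψ (c⁻¹ * g x) * (c⁻¹ * 1)) x :=
  HasDerivAt.comp x (differentiable_of_smooth hψ.smooth _).hasDerivAt (hg.const_mul _)

lemma deriv_hSm (hψ : IsStep ψ) (x : ℝ) : deriv (hSm ψ t) x =
    1 + (deriv ψ (t⁻¹ * (x - t)) * (t⁻¹ * 1) * (t * (x - 1 / 4) + 3 * t - x)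
      + ψ (t⁻¹ * (x - t)) * (t - 1))
    + (deriv ψ ((t ^ 2)⁻¹ * (x - (1 - t + 8 * t ^ 2) / 2)) * ((t ^ 2)⁻¹ * 1)
        * ((t⁻¹ * (x - 1 / 2) + 1 / 2) - (t * (x - 1 / 4) + 3 * t))
      + ψ ((t ^ 2)⁻¹ * (x - (1 - t + 8 * t ^ 2) / 2)) * (t⁻¹ - t))
    + (deriv ψ ((t ^ 2)⁻¹ * (x - (1 + t - 10 * t ^ 2) / 2)) * ((t ^ 2)⁻¹ * 1)
        * ((t * (x - 3 / 4) + 1 - 3 * t) - (t⁻¹ * (x - 1 / 2) + 1 / 2))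
      + ψ ((t ^ 2)⁻¹ * (x - (1 + t - 10 * t ^ 2) / 2)) * (t - t⁻¹))
    + (deriv ψ (t⁻¹ * (x - 1 + 2 * t)) * (t⁻¹ * 1) * (x - (t * (x - 3 / 4) + 1 - 3 * t))
      + ψ (t⁻¹ * (x - 1 + 2 * t)) * (1 - t)) := by
  have hid := hasDerivAt_id' x
  have l1 : HasDerivAt (fun x : ℝ => t * (x - 1 / 4) + 3 * t) t x := by
    have := ((hid.sub_const (1 / 4)).const_mul t).add_const (3 * t)
    rwa [mul_one] at this
  have l2 : HasDerivAt (fun x : ℝ => t⁻¹ * (x - 1 / 2) + 1 / 2) t⁻¹ x := by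
    have := ((hid.sub_const (1 / 2)).const_mul t⁻¹).add_const (1 / 2)
    rwa [mul_one] at this
  have l3 : HasDerivAt (fun x : ℝ => t * (x - 3 / 4) + 1 - 3 * t) t x := by
    have := (((hid.sub_const (3 / 4)).const_mul t).add_const 1).sub_const (3 * t)
    rwa [mul_one] at this
  exact ((((hid.add ((hψ.hasDerivAt_comp t x (hid.sub_const t)).mul (l1.sub hid))).add
    ((hψ.hasDerivAt_comp (t ^ 2) x (hid.sub_const _)).mul (l2.sub l1))).add
    ((hψ.hasDerivAt_comp (t ^ 2) x (hid.sub_const _)).mul (l3.sub l2))).add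
    ((hψ.hasDerivAt_comp t x ((hid.sub_const 1).add_const (2 * t))).mul (hid.sub l3))).deriv

lemma IsStep.deriv_mul_nonneg (hψ : IsStep ψ) {c y z : ℝ} (hc : 0 < c)
    (hz : 0 ≤ y → y ≤ c → 0 ≤ z) : 0 ≤ deriv ψ (c⁻¹ * y) * (c⁻¹ * 1) * z := by
  rcases le_total y 0 with h | h
  · rw [hψ.deriv_eq_zero_of_nonpos (mul_nonpos_of_nonneg_of_nonpos (inv_pos.2 hc).le h)]; simp
  · rcases le_total c y with h1 | h1
    · rw [hψ.deriv_eq_zero_of_one_le (by rw [inv_mul_eq_div]; exact (one_le_div hc).2 h1)]; simp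
    · exact mul_nonneg (mul_nonneg (hψ.deriv_nonneg _) (by positivity)) (hz h h1)

/-- The terms with `ψ'` are nonnegative, because on each transition interval the two branches are
ordered in the increasing direction. Writing `ψ₁, …, ψ₄` for the four step values, the rest is `1 -
(1 - t) ψ₁ + (t⁻¹ - t)(ψ₂ - ψ₃) + (1 - t) ψ₄`, where `ψ₃ ≤ ψ₂`. -/
lemma le_deriv_hSm (hψ : IsStep ψ) (ht : 0 < t) (ht' : t < 1 / 10) (x : ℝ) :
    t ≤ deriv (hSm ψ t) x := by
  have ht2 : 0 < t ^ 2 := by positivity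
  have hsq : t ^ 2 < t / 10 := by nlinarith
  have hti : t⁻¹ * t = 1 := inv_mul_cancel₀ ht.ne'
  have hti' : t < t⁻¹ := by
    rw [lt_inv_comm₀ ht ht]; rw [lt_inv_comm₀ ht ht]
    exact lt_of_lt_of_le (by linarith : t < 1) ((one_le_inv₀ ht).2 (by linarith))
  have hip : 0 < t⁻¹ := inv_pos.2 ht
  have k1 := hψ.deriv_mul_nonneg (y := x - t) (z := t * (x - 1 / 4) + 3 * t - x) ht
    fun h1 h2 => by nlinarith
  have k2 := hψ.deriv_mul_nonneg (y := x - (1 - t + 8 * t ^ 2) / 2)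
    (z := (t⁻¹ * (x - 1 / 2) + 1 / 2) - (t * (x - 1 / 4) + 3 * t)) ht2 fun h1 h2 => by
      -- On this transition the steep branch is at least `4 t`, while the flat one stays below `3 t
      -- + t / 4`.
      have e : t⁻¹ * (x - 1 / 2) ≥ t⁻¹ * (-t / 2 + 4 * t ^ 2) :=
        mul_le_mul_of_nonneg_left (by linarith) hip.le
      have e' : t⁻¹ * (-t / 2 + 4 * t ^ 2) = - 1 / 2 + 4 * t := by field_simp
      nlinarith
  have k3 := hψ.deriv_mul_nonneg (y := x - (1 + t - 10 * t ^ 2) / 2)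
    (z := (t * (x - 3 / 4) + 1 - 3 * t) - (t⁻¹ * (x - 1 / 2) + 1 / 2)) ht2 fun h1 h2 => by
      have e : t⁻¹ * (x - 1 / 2) ≤ t⁻¹ * (t / 2 - 4 * t ^ 2) :=
        mul_le_mul_of_nonneg_left (by linarith) hip.le
      have e' : t⁻¹ * (t / 2 - 4 * t ^ 2) = 1 / 2 - 4 * t := by field_simp
      nlinarith
  have k4 := hψ.deriv_mul_nonneg (y := x - 1 + 2 * t)
    (z := x - (t * (x - 3 / 4) + 1 - 3 * t)) ht fun h1 h2 => by nlinarith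
  have m : ψ ((t ^ 2)⁻¹ * (x - (1 + t - 10 * t ^ 2) / 2)) ≤
      ψ ((t ^ 2)⁻¹ * (x - (1 - t + 8 * t ^ 2) / 2)) := hψ.monotone (by gcongr; linarith)
  have m1 := hψ.le_one (t⁻¹ * (x - t))
  have m2 := hψ.nonneg (t⁻¹ * (x - 1 + 2 * t))
  rw [deriv_hSm hψ]
  nlinarith [mul_nonneg (sub_nonneg.2 m) (sub_nonneg.2 hti'.le),
    mul_nonneg (sub_nonneg.2 m1) (by linarith : (0 : ℝ) ≤ 1 - t),
    mul_nonneg m2 (by linarith : (0 : ℝ) ≤ 1 - t)]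

end HSm

/-! ### Growth of the derivatives of `hSm` -/

section HSmGrowth

variable {ι : Type*} {s : ι → ℝ} {X : Set ℝ} {k : ℕ}

lemma PolyGrowth.univ_of_Icc {F : ι → ℝ → ℝ} {a b : ℝ} (h : PolyGrowth s (Icc a b) k F)
    (hs : ∀ j, 1 ≤ s j) (hF : ∀ j, ∀ x ∉ Icc a b, F j x = 0) : PolyGrowth s univ k F := by
  have bd : ∀ F : ι → ℝ → ℝ, PolyBd s (Icc a b) F → (∀ j, ∀ x ∉ Icc a b, F j x = 0) →
      PolyBd s univ F := by
    intro F h hF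
    obtain ⟨C, hC, N, hb⟩ := h.bound
    refine ⟨h.smooth, C, hC, N, fun j x _ => ?_⟩
    by_cases hx : x ∈ Icc a b
    · exact hb j x hx
    · have := hs j
      rw [hF j x hx, abs_zero]
      positivity
  induction k generalizing F with
  | zero => exact bd F h hF
  | succ k ih =>
    refine ⟨bd F h.1 hF, ih h.2 fun j x hx => ?_⟩
    have : F j =ᶠ[𝓝 x] fun _ => 0 :=
      mem_of_superset (isClosed_Icc.isOpen_compl.mem_nhds hx) fun y hy => hF j y hy
    rw [this.deriv_eq, deriv_const]

lemma polyGrowth_id : PolyGrowth s (Icc 0 1) k (fun _ x => x) := by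
  have h0 : PolyBd s (Icc 0 1) (fun _ x => x) := by
    refine ⟨fun _ => contDiff_id, 1, zero_le_one, 0, fun j x hx => ?_⟩
    rw [abs_of_nonneg hx.1]; simpa using hx.2
  cases k with
  | zero => exact h0
  | succ k =>
    exact ⟨h0, (polyGrowth_const (fun _ => 1) ⟨1, zero_le_one, 0, by simp⟩).congr
      fun j => funext fun x => by simp⟩

lemma IsStep.polyGrowth_affine {ψ : ℝ → ℝ} (hψ : IsStep ψ) (hs : ∀ j, 1 ≤ s j) (c d : ι → ℝ)
    (hc : ∃ C : ℝ, 0 ≤ C ∧ ∃ N : ℕ, ∀ j, |c j| ≤ C * s j ^ N) :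
    PolyGrowth s X k (fun j x => ψ (c j * (x - d j))) :=
  (hψ.polyGrowth s univ k).comp hs (G := fun j x => c j * (x - d j)) (fun j => by fun_prop)
    (fun _ => mapsTo_univ _ _) fun l _ => (polyGrowth_const c hc).congr fun j => funext fun x => by
      have := (((hasDerivAt_id' x).sub_const (d j)).const_mul (c j)).deriv
      rwa [mul_one] at this

/-- All coefficients are polynomial in `t` and `t⁻¹`, but the affine branches are bounded only on
bounded sets. The estimate is thus made on `[0, 1]` for `hSm - x`, which vanishes elsewhere; one
extra order is kept to pay for the final differentiation. -/
lemma polyGrowth_deriv_hSm {ψ : ℝ → ℝ} (hψ : IsStep ψ) (hs : ∀ j, 1 ≤ s j) (t : ι → ℝ)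
    (ht : ∀ j, 0 < t j) (ht' : ∀ j, t j < 1 / 10)
    (hts : ∃ N : ℕ, ∀ j, (t j)⁻¹ ≤ s j ^ N) :
    PolyGrowth s univ k (fun j => deriv (hSm ψ (t j))) := by
  obtain ⟨N, hN⟩ := hts
  have c1 : ∃ C : ℝ, 0 ≤ C ∧ ∃ N : ℕ, ∀ j, |(t j)⁻¹| ≤ C * s j ^ N :=
    ⟨1, zero_le_one, N, fun j => by
      rw [abs_of_pos (inv_pos.2 (ht j)), _root_.one_mul]; exact hN j⟩
  have c2 : ∃ C : ℝ, 0 ≤ C ∧ ∃ N : ℕ, ∀ j, |(t j ^ 2)⁻¹| ≤ C * s j ^ N :=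
    ⟨1, zero_le_one, N * 2, fun j => by
      have h := inv_pos.2 (ht j)
      rw [← inv_pow, abs_of_pos (by positivity), _root_.one_mul, pow_mul]
      exact pow_le_pow_left₀ h.le (hN j) 2⟩
  have c3 : ∃ C : ℝ, 0 ≤ C ∧ ∃ N : ℕ, ∀ j, |t j| ≤ C * s j ^ N :=
    ⟨1, zero_le_one, 0, fun j => by
      rw [abs_of_pos (ht j)]; simpa using (ht' j).le.trans (by norm_num)⟩
  have cc : ∀ c : ℝ, PolyGrowth s (Icc 0 1) (k + 1) (fun _ _ => c) := fun c =>
    polyGrowth_const (fun _ => c) ⟨|c|, abs_nonneg c, 0, by simp⟩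
  have T := polyGrowth_const (X := Icc 0 1) (k := k + 1) t c3
  have T' := polyGrowth_const (X := Icc 0 1) (k := k + 1) (fun j => (t j)⁻¹) c1
  have I := polyGrowth_id (s := s) (k := k + 1)
  have l1 := (T.mul hs (I.sub hs (cc (1 / 4)))).add hs ((cc 3).mul hs T)
  have l2 := (T'.mul hs (I.sub hs (cc (1 / 2)))).add hs (cc (1 / 2))
  have l3 := ((T.mul hs (I.sub hs (cc (3 / 4)))).add hs (cc 1)).sub hs ((cc 3).mul hs T)
  have A := hψ.polyGrowth_affine (X := Icc 0 1) (k := k + 1) hs (fun j => (t j)⁻¹) t c1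
  have B := hψ.polyGrowth_affine (X := Icc 0 1) (k := k + 1) hs (fun j => (t j ^ 2)⁻¹)
    (fun j => (1 - t j + 8 * t j ^ 2) / 2) c2
  have C := hψ.polyGrowth_affine (X := Icc 0 1) (k := k + 1) hs (fun j => (t j ^ 2)⁻¹)
    (fun j => (1 + t j - 10 * t j ^ 2) / 2) c2
  have D := hψ.polyGrowth_affine (X := Icc 0 1) (k := k + 1) hs (fun j => (t j)⁻¹)
    (fun j => 1 - 2 * t j) c1
  have key := ((((A.mul hs (l1.sub hs I)).add hs (B.mul hs (l2.sub hs l1))).add hs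
    (C.mul hs (l3.sub hs l2))).add hs (D.mul hs (I.sub hs l3)))
  have key2 : PolyGrowth s (Icc 0 1) (k + 1) (fun j x => hSm ψ (t j) x - x) :=
    key.congr fun j => funext fun x => by
      unfold hSm
      rw [show x - 1 + 2 * t j = x - (1 - 2 * t j) by ring]
      ring
  have key3 := (key2.univ_of_Icc hs fun j x hx => by
    have := ht j
    rw [mem_Icc, not_and_or, not_le, not_le] at hx
    rcases hx with hx | hx
    · rw [hSm_of_le hψ (ht j) (ht' j) (by linarith), sub_self]
    · rw [hSm_of_ge hψ (ht j) (ht' j) (by linarith), sub_self]).2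
  have one : PolyGrowth s univ k (fun _ _ => 1) :=
    polyGrowth_const (fun _ => 1) ⟨1, zero_le_one, 0, by simp⟩
  refine (key3.add hs one).congr fun j => funext fun x => ?_
  rw [deriv_fun_sub (differentiable_of_smooth (contDiff_hSm hψ) x) differentiableAt_fun_id]
  simp

end HSmGrowth

/-! ### Lifts as order automorphisms of the line -/

/-- The increasing bijections of `ℝ` that commute with `x ↦ x + 1`. -/
def CLift : Subgroup (ℝ ≃o ℝ) where
  carrier := {f | ∀ x, f (x + 1) = f x + 1}
  mul_mem' := fun {f g} hf hg x => by
    change f (g (x + 1)) = f (g x) + 1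
    rw [hg, hf]
  one_mem' := fun _ => rfl
  inv_mem' := fun {f} hf x => by
    apply f.injective
    rw [hf, RelIso.apply_inv_self, RelIso.apply_inv_self]

/-- The smooth increasing diffeomorphisms of `ℝ` that commute with `x ↦ x + 1`. -/
def SLift : Subgroup (ℝ ≃o ℝ) where
  carrier := {f | f ∈ CLift ∧ ContDiff ℝ ∞ f ∧ ContDiff ℝ ∞ (f⁻¹ : ℝ ≃o ℝ)}
  mul_mem' := fun {f g} hf hg => ⟨CLift.mul_mem hf.1 hg.1, hf.2.1.comp hg.2.1, by
    rw [mul_inv_rev]; exact hg.2.2.comp hf.2.2⟩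
  one_mem' := ⟨CLift.one_mem, contDiff_id, by rw [inv_one]; exact contDiff_id⟩
  inv_mem' := fun {f} hf => ⟨CLift.inv_mem hf.1, hf.2.2, by rw [inv_inv]; exact hf.2.1⟩

lemma periodic_coe {f : ℝ ≃o ℝ} (hf : f ∈ CLift) :
    Function.Periodic (fun x => ((f x : ℝ) : S1)) 1 := fun x => by
  change ((f (x + 1) : ℝ) : S1) = _
  rw [hf x]
  exact AddCircle.coe_add_period 1 _

/-- The circle map with a given lift. -/
def circleFun (f : CLift) : S1 → S1 := (periodic_coe f.2).lift

@[simp] lemma circleFun_coe (f : CLift) (x : ℝ) : circleFun f (x : S1) = ((f.1 x : ℝ) : S1) :=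
  (periodic_coe f.2).lift_coe x

lemma continuous_circleFun (f : CLift) : Continuous (circleFun f) := by
  have h : Topology.IsQuotientMap ((↑) : ℝ → S1) := QuotientAddGroup.isQuotientMap_mk _
  rw [h.continuous_iff]
  have : circleFun f ∘ ((↑) : ℝ → S1) = fun x => ((f.1 x : ℝ) : S1) :=
    funext fun x => circleFun_coe f x
  rw [this]
  exact (AddCircle.continuous_mk' 1).comp f.1.continuous

lemma s1_ind {P : S1 → Prop} (h : ∀ x : ℝ, P (x : S1)) (z : S1) : P z :=
  QuotientAddGroup.induction_on z h

/-- The circle homeomorphism with a given lift. -/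
def toHomeo : CLift →* (S1 ≃ₜ S1) where
  toFun f :=
    { toFun := circleFun f
      invFun := circleFun f⁻¹
      left_inv := s1_ind fun x => by simp
      right_inv := s1_ind fun x => by simp
      continuous_toFun := continuous_circleFun f
      continuous_invFun := continuous_circleFun f⁻¹ }
  map_one' := Homeomorph.ext (s1_ind fun x => circleFun_coe 1 x)
  map_mul' f g := Homeomorph.ext (s1_ind fun x => by
    change circleFun (f * g) x = circleFun f (circleFun g x)
    simp)

@[simp] lemma toHomeo_coe (f : CLift) (x : ℝ) : toHomeo f (x : S1) = ((f.1 x : ℝ) : S1) :=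
  circleFun_coe f x

/-- A lift as an element of `CircleDeg1Lift`. -/
def deg1 (f : CLift) : CircleDeg1Lift := ⟨⟨f.1, f.1.monotone⟩, f.2⟩

@[simp] lemma deg1_apply (f : CLift) (x : ℝ) : deg1 f x = f.1 x := rfl

lemma isLift_deg1 (f : CLift) : IsLift (deg1 f) (toHomeo f) :=
  ⟨f.1.continuous, fun x => (toHomeo_coe f x).symm⟩

lemma isLift_deg1_symm (f : CLift) : IsLift (deg1 f⁻¹) (toHomeo f).symm :=
  isLift_deg1 f⁻¹

lemma toHomeo_mem (f : CLift) : toHomeo f ∈ HomeoPlus :=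
  ⟨⟨_, isLift_deg1 f⟩, ⟨_, isLift_deg1_symm f⟩⟩

/-- Forgetting smoothness of a lift. -/
def SLift.toC : SLift →* CLift where
  toFun f := ⟨f.1, f.2.1⟩
  map_one' := rfl
  map_mul' _ _ := rfl

@[simp] lemma SLift.toC_coe (f : SLift) : ((SLift.toC f : CLift) : ℝ ≃o ℝ) = f.1 := rfl

/-- The circle diffeomorphism with a given lift. -/
def toDiff : SLift →* DiffPlus where
  toFun f := ⟨toHomeo (SLift.toC f), ⟨_, isLift_deg1 _, f.2.2.1⟩,
    ⟨_, isLift_deg1_symm _, f.2.2.2⟩⟩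
  map_one' := Subtype.ext (map_one (toHomeo.comp SLift.toC))
  map_mul' f g := Subtype.ext (map_mul (toHomeo.comp SLift.toC) f g)

@[simp] lemma toDiff_coe (f : SLift) : (toDiff f).1 = toHomeo (SLift.toC f) := rfl

/-- Translations. -/
def trL (β : ℝ) : SLift := ⟨OrderIso.addRight β, fun x => by
    change x + 1 + β = x + β + 1
    ring, by
    change ContDiff ℝ ∞ (fun x => x + β)
    fun_prop, by
    change ContDiff ℝ ∞ (fun x => x - β)
    fun_prop⟩

@[simp] lemma trL_apply (β x : ℝ) : (trL β).1 x = x + β := rfl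

@[simp] lemma trL_inv (β : ℝ) : (trL β)⁻¹ = trL (-β) := by
  apply Subtype.ext
  apply RelIso.ext
  intro x
  exact (sub_eq_add_neg x β)

lemma toDiff_trL (β : ℝ) : toDiff (trL β) = rot β :=
  Subtype.ext (Homeomorph.ext (s1_ind fun x => by
    rw [toDiff_coe, toHomeo_coe, SLift.toC_coe, trL_apply, AddCircle.coe_add]
    rfl))

lemma CLift.map_add_int {f : ℝ ≃o ℝ} (hf : f ∈ CLift) (x : ℝ) (m : ℤ) : f (x + m) = f x + m :=
  (deg1 ⟨f, hf⟩).map_add_int x m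

lemma exists_sLift {F : ℝ → ℝ} (hF : ContDiff ℝ ∞ F) (h1 : ∀ x, F (x + 1) = F x + 1)
    (hpos : ∀ x, 0 < deriv F x) : ∃ f : SLift, ⇑f.1 = F := by
  have hmono : StrictMono F := strictMono_of_deriv_pos hpos
  let D : CircleDeg1Lift := ⟨⟨F, hmono.monotone⟩, h1⟩
  have hsurj : Function.Surjective F :=
    hF.continuous.surjective D.tendsto_atTop D.tendsto_atBot
  let f := hmono.orderIsoOfSurjective F hsurj
  have hf : ⇑f = F := rfl
  refine ⟨⟨f, h1, hF, ?_⟩, rfl⟩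
  have hd : ∀ x, HasDerivAt f.toHomeomorph (deriv F x) x := fun x =>
    (differentiable_of_smooth hF x).hasDerivAt
  exact f.toHomeomorph.contDiff_symm_deriv (fun x => (hpos x).ne') hd hF

/-! ### The lifts of the conjugation maps -/

section HBar

variable {ψ : ℝ → ℝ} {n q : ℕ}

lemma tParam_eq (hn : 0 < n) : tParam n q = ((q : ℝ) ^ (2 * n - 1))⁻¹ := by
  rw [tParam, ← zpow_natCast, ← zpow_neg]
  congr 1
  push_cast [Nat.cast_sub (by omega : 1 ≤ 2 * n)]
  ring

lemma tParam_pos (hn : 0 < n) (hq : 10 < q) : 0 < tParam n q := by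
  have : (0 : ℝ) < q := by exact_mod_cast (by omega : 0 < q)
  rw [tParam_eq hn]
  positivity

lemma tParam_lt (hn : 0 < n) (hq : 10 < q) : tParam n q < 1 / 10 := by
  have h : (10 : ℝ) < q := by exact_mod_cast hq
  rw [tParam_eq hn, one_div]
  apply inv_strictAnti₀ (by norm_num)
  calc (10 : ℝ) < q := h
    _ ≤ (q : ℝ) ^ (2 * n - 1) := le_self_pow₀ (by linarith) (by omega)

/-- The local form of `hBarLift` at `0`. -/
def hLoc (ψ : ℝ → ℝ) (n q : ℕ) (x : ℝ) : ℝ :=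
  ((2 : ℝ) ^ (n + 1) * q)⁻¹ * hSm ψ (tParam n q) ((2 : ℝ) ^ (n + 1) * q * x)

/-- The local formula reaches left of `k / q` because both sides are the identity there: `hSm` on
negative arguments, `hBreve` on the right half of the preceding cell. The overlap of neighbouring
cells makes the formula valid on open sets, which gives smoothness across the multiples of `1 / q`.
-/
lemma hBarLift_eq (hψ : IsStep ψ) (hn : 0 < n) (hq : 10 < q) (x : ℝ) (k : ℤ)
    (h1 : -(1 / 2) < q * x - k) (h2 : q * x - k < 1) :
    hBarLift ψ n q x = k / q + hLoc ψ n q (x - k / q) := by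
  have hq0 : (0 : ℝ) < q := by exact_mod_cast (by omega : 0 < q)
  have ht := tParam_pos hn hq
  have ht' := tParam_lt hn hq
  have h2n : (0 : ℝ) < 2 ^ (n + 1) := by positivity
  have hle : (1 : ℝ) / 2 ^ (n + 1) ≤ 1 / 2 := by
    rw [pow_succ]
    gcongr
    have : (1 : ℝ) ≤ 2 ^ n := one_le_pow₀ (by norm_num)
    linarith
  have hz : (2 : ℝ) ^ (n + 1) * q * (x - k / q) = 2 ^ (n + 1) * (q * x - k) := by
    field_simp
  rw [hLoc, hz, hBarLift]
  rcases le_or_gt 0 ((q : ℝ) * x - k) with h0 | h0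
  · have hfl : ⌊(q : ℝ) * x⌋ = k := Int.floor_eq_iff.2 ⟨by linarith, by linarith⟩
    rw [Int.fract, hfl, hBreve]
    split_ifs with h
    · rw [hHat_eq hψ ht ht']
      field_simp
    · rw [hSm_of_ge hψ ht ht' (x := 2 ^ (n + 1) * (q * x - k))]
      · field_simp
      · rw [not_le, div_lt_iff₀ h2n] at h
        linarith
  · have hfl : ⌊(q : ℝ) * x⌋ = k - 1 :=
      Int.floor_eq_iff.2 ⟨by push_cast; linarith, by push_cast; linarith⟩
    rw [Int.fract, hfl, hBreve, if_neg (by push_cast; linarith), hSm_of_le hψ ht ht']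
    · push_cast
      field_simp
      ring
    · exact (mul_nonpos_of_nonneg_of_nonpos h2n.le h0.le).trans ht.le

lemma hBarLift_eventuallyEq (hψ : IsStep ψ) (hn : 0 < n) (hq : 10 < q) (x : ℝ) :
    hBarLift ψ n q =ᶠ[𝓝 x] fun y => ⌊(q : ℝ) * x⌋ / q + hLoc ψ n q (y - ⌊(q : ℝ) * x⌋ / q) := by
  have hc : Continuous fun y : ℝ => (q : ℝ) * y - ⌊(q : ℝ) * x⌋ := by fun_prop
  have h1 := (isOpen_lt continuous_const hc).mem_nhds
    (show -(1 / 2) < (q : ℝ) * x - ⌊(q : ℝ) * x⌋ by linarith [Int.floor_le ((q : ℝ) * x)])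
  have h2 := (isOpen_lt hc continuous_const).mem_nhds
    (show (q : ℝ) * x - ⌊(q : ℝ) * x⌋ < 1 by linarith [Int.lt_floor_add_one ((q : ℝ) * x)])
  filter_upwards [h1, h2] with y hy1 hy2 using hBarLift_eq hψ hn hq y _ hy1 hy2

lemma contDiff_hLoc (hψ : IsStep ψ) : ContDiff ℝ ∞ (hLoc ψ n q) := by
  have := contDiff_hSm (t := tParam n q) hψ
  unfold hLoc
  fun_prop

lemma contDiff_hBarLift (hψ : IsStep ψ) (hn : 0 < n) (hq : 10 < q) :
    ContDiff ℝ ∞ (hBarLift ψ n q) := by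
  rw [contDiff_iff_contDiffAt]
  intro x
  refine ContDiffAt.congr_of_eventuallyEq ?_ (hBarLift_eventuallyEq hψ hn hq x)
  have := contDiff_hLoc (n := n) (q := q) hψ
  exact ContDiff.contDiffAt (by fun_prop)

lemma deriv_hLoc (hψ : IsStep ψ) (hq : 10 < q) (x : ℝ) :
    deriv (hLoc ψ n q) x = deriv (hSm ψ (tParam n q)) ((2 : ℝ) ^ (n + 1) * q * x) := by
  have hq0 : (0 : ℝ) < q := by exact_mod_cast (by omega : 0 < q)
  have h1 : HasDerivAt (fun x : ℝ => (2 : ℝ) ^ (n + 1) * q * x) (2 ^ (n + 1) * q) x := by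
    simpa using (hasDerivAt_id' x).const_mul ((2 : ℝ) ^ (n + 1) * q)
  have h2 := ((differentiable_of_smooth (contDiff_hSm (t := tParam n q) hψ) _).hasDerivAt.comp x h1).const_mul
    ((2 : ℝ) ^ (n + 1) * q)⁻¹
  refine h2.deriv.trans ?_
  field_simp

/-- Every derivative is read off from the single profile `hLoc`, so bounds for the profile are
uniform over all cells. -/
lemma iteratedDeriv_hBarLift (hψ : IsStep ψ) (hn : 0 < n) (hq : 10 < q) (i : ℕ) (x : ℝ) :
    iteratedDeriv i (deriv (hBarLift ψ n q)) x =
      iteratedDeriv i (deriv (hLoc ψ n q)) (x - ⌊(q : ℝ) * x⌋ / q) := by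
  rw [← iteratedDeriv_succ', ← iteratedDeriv_succ',
    (hBarLift_eventuallyEq hψ hn hq x).iteratedDeriv_eq,
    iteratedDeriv_const_add (by omega), iteratedDeriv_comp_sub_const]

lemma le_deriv_hBarLift (hψ : IsStep ψ) (hn : 0 < n) (hq : 10 < q) (x : ℝ) :
    tParam n q ≤ deriv (hBarLift ψ n q) x := by
  have := iteratedDeriv_hBarLift hψ hn hq 0 x
  simp only [iteratedDeriv_zero] at this
  rw [this, deriv_hLoc hψ hq]
  exact le_deriv_hSm hψ (tParam_pos hn hq) (tParam_lt hn hq) _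

lemma hBarLift_add_div (hq : 10 < q) (x : ℝ) (m : ℤ) :
    hBarLift ψ n q (x + m / q) = hBarLift ψ n q x + m / q := by
  have hq0 : (0 : ℝ) < q := by exact_mod_cast (by omega : 0 < q)
  have : (q : ℝ) * (x + m / q) = q * x + m := by field_simp
  rw [hBarLift, hBarLift, this, Int.floor_add_intCast, Int.fract_add_intCast]
  push_cast
  field_simp
  ring

/-- `hBarLift` as a lift (and the identity for inadmissible parameters). -/
def hL (ψ : ℝ → ℝ) (n q : ℕ) : SLift :=
  open Classical in if h : ∃ f : SLift, ⇑f.1 = hBarLift ψ n q then h.choose else 1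

lemma hL_coe (hψ : IsStep ψ) (hn : 0 < n) (hq : 10 < q) : ⇑(hL ψ n q).1 = hBarLift ψ n q := by
  have hq0 : (0 : ℝ) < q := by exact_mod_cast (by omega : 0 < q)
  have h : ∃ f : SLift, ⇑f.1 = hBarLift ψ n q := by
    refine exists_sLift (contDiff_hBarLift hψ hn hq) (fun x => ?_)
      fun x => (tParam_pos hn hq).trans_le (le_deriv_hBarLift hψ hn hq x)
    have := hBarLift_add_div (ψ := ψ) (n := n) hq x q
    simpa [div_self hq0.ne'] using this
  rw [hL, dif_pos h]
  exact h.choose_spec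

lemma hL_apply (hψ : IsStep ψ) (hn : 0 < n) (hq : 10 < q) (x : ℝ) (k : ℤ)
    (h1 : -(1 / 2) < q * x - k) (h2 : q * x - k < 1) :
    (hL ψ n q).1 x = k / q + hLoc ψ n q (x - k / q) := by
  rw [hL_coe hψ hn hq, hBarLift_eq hψ hn hq x k h1 h2]

lemma hL_add_div (hψ : IsStep ψ) (hn : 0 < n) (hq : 10 < q) (x : ℝ) (m : ℤ) :
    (hL ψ n q).1 (x + m / q) = (hL ψ n q).1 x + m / q := by
  rw [hL_coe hψ hn hq, hBarLift_add_div hq]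

/-- The translations by multiples of `1 / q` are the deck transformations of the covering. This
commutation drives the whole convergence argument. -/
lemma hL_mul_trL (hψ : IsStep ψ) (hn : 0 < n) (hq : 10 < q) (m : ℤ) :
    hL ψ n q * trL (m / q) = trL (m / q) * hL ψ n q :=
  Subtype.ext (RelIso.ext fun x => hL_add_div hψ hn hq x m)

lemma hL_div (hψ : IsStep ψ) (hn : 0 < n) (hq : 10 < q) (m : ℤ) :
    (hL ψ n q).1 (m / q) = m / q := by
  have hq0 : (0 : ℝ) < q := by exact_mod_cast (by omega : 0 < q)
  have e : (q : ℝ) * (m / q) - m = 0 := by field_simp; ring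
  rw [hL_apply hψ hn hq _ m (by rw [e]; norm_num) (by rw [e]; norm_num), sub_self, hLoc, mul_zero,
    hSm_of_le hψ (tParam_pos hn hq) (tParam_lt hn hq) (tParam_pos hn hq).le, mul_zero, add_zero]

lemma hL_of_fract (hψ : IsStep ψ) (hn : 0 < n) (hq : 10 < q) {x : ℝ}
    (hx : 1 / 2 ^ (n + 1) ≤ Int.fract ((q : ℝ) * x)) : (hL ψ n q).1 x = x := by
  have hq0 : (0 : ℝ) < q := by exact_mod_cast (by omega : 0 < q)
  have h2n : (0 : ℝ) < 2 ^ (n + 1) := by positivity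
  have h1 := Int.fract_lt_one ((q : ℝ) * x)
  have ht := tParam_pos hn hq
  rw [div_le_iff₀ h2n] at hx
  have h0 := Int.fract_nonneg ((q : ℝ) * x)
  rw [Int.fract] at hx h1 h0
  rw [hL_apply hψ hn hq x ⌊(q : ℝ) * x⌋ (by linarith) h1, hLoc,
    hSm_of_ge hψ ht (tParam_lt hn hq)]
  · field_simp
    ring
  · have : (2 : ℝ) ^ (n + 1) * q * (x - ⌊(q : ℝ) * x⌋ / q) =
      (q * x - ⌊(q : ℝ) * x⌋) * 2 ^ (n + 1) := by field_simp
    rw [this]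
    linarith

/-- An order automorphism fixing the multiples of `1 / q` moves points by at most `1 / q`. -/
lemma abs_sub_le_of_fix {f : ℝ ≃o ℝ} (hq : 0 < q) (hf : ∀ m : ℤ, f (m / q) = m / q) (x : ℝ) :
    |f x - x| ≤ 1 / q := by
  have hq0 : (0 : ℝ) < q := by exact_mod_cast hq
  have a1 : (⌊(q : ℝ) * x⌋ : ℝ) / q ≤ x := by
    rw [div_le_iff₀ hq0, mul_comm]; exact Int.floor_le _
  have a2 : x ≤ ((⌊(q : ℝ) * x⌋ + 1 : ℤ) : ℝ) / q := by
    rw [le_div_iff₀ hq0, mul_comm]; push_cast; exact (Int.lt_floor_add_one _).le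
  have b1 := f.monotone a1
  have b2 := f.monotone a2
  rw [hf] at b1 b2
  have e : ((⌊(q : ℝ) * x⌋ + 1 : ℤ) : ℝ) / q = (⌊(q : ℝ) * x⌋ : ℝ) / q + 1 / q := by
    push_cast; ring
  rw [e] at a2 b2
  rw [abs_le]
  constructor <;> linarith

lemma hL_inv_div (hψ : IsStep ψ) (hn : 0 < n) (hq : 10 < q) (m : ℤ) :
    ((hL ψ n q)⁻¹).1 (m / q) = m / q := by
  apply (hL ψ n q).1.injective
  rw [hL_div hψ hn hq]
  exact RelIso.apply_inv_self _ _

lemma abs_hL_sub_le (hψ : IsStep ψ) (hn : 0 < n) (hq : 10 < q) (x : ℝ) :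
    |(hL ψ n q).1 x - x| ≤ 1 / q :=
  abs_sub_le_of_fix (by omega) (hL_div hψ hn hq) x

lemma abs_hL_inv_sub_le (hψ : IsStep ψ) (hn : 0 < n) (hq : 10 < q) (x : ℝ) :
    |((hL ψ n q)⁻¹).1 x - x| ≤ 1 / q :=
  abs_sub_le_of_fix (by omega) (hL_inv_div hψ hn hq) x

end HBar

/-! ### Polynomial growth of the conjugation maps -/

section Growth

/-- The admissible denominators, together with two rotation angles. -/
abbrev ParIdx : Type := {q : ℕ // 10 < q} × ℝ × ℝ

/-- The scale of a parameter is its denominator. -/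
def parScale (j : ParIdx) : ℝ := (j.1.1 : ℝ)

lemma one_le_parScale (j : ParIdx) : 1 ≤ parScale j := by
  have h : (10 : ℝ) < (j.1.1 : ℝ) := by exact_mod_cast j.1.2
  exact le_trans (by norm_num) h.le

variable {ψ : ℝ → ℝ} {n : ℕ}

/-- For fixed `n`, both `t⁻¹ = q^(2n-1)` and the dilation factor `2^(n+1) q` are polynomial in `q`,
so each order of differentiation costs a power of `q`. -/
lemma polyGrowth_hL (hψ : IsStep ψ) (hn : 0 < n) (k : ℕ) :
    PolyGrowth parScale univ k (fun j : ParIdx => deriv (hL ψ n j.1).1) := by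
  have h0 : PolyGrowth parScale univ k
      (fun (j : ParIdx) x => deriv (hSm ψ (tParam n j.1)) ((2 : ℝ) ^ (n + 1) * j.1 * x)) := by
    have hc : ∀ j : ParIdx, ∀ x, deriv (fun x : ℝ => (2 : ℝ) ^ (n + 1) * (j.1 : ℕ) * x) x =
        (2 : ℝ) ^ (n + 1) * (j.1 : ℕ) := fun j x => by
      simp
    refine (polyGrowth_deriv_hSm hψ one_le_parScale (fun j : ParIdx => tParam n j.1)
      (fun j => tParam_pos hn j.1.2) (fun j => tParam_lt hn j.1.2)
      ⟨2 * n - 1, fun j => ?_⟩).comp one_le_parScale (fun j => by fun_prop)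
      (fun _ => mapsTo_univ _ _) fun l _ => (polyGrowth_const _ ?_).congr fun j => funext (hc j)
    · rw [tParam_eq hn, inv_inv]; rfl
    · refine ⟨(2 : ℝ) ^ (n + 1), by positivity, 1, fun j => ?_⟩
      rw [abs_of_nonneg (by positivity), pow_one]; rfl
  refine polyGrowth_of_iteratedDeriv (fun j => contDiff_deriv (hL ψ n j.1).2.2.1) fun i hi => ?_
  obtain ⟨C, hC, N, h⟩ := h0.iteratedDeriv hi
  refine ⟨C, hC, N, fun j x _ => ?_⟩
  rw [hL_coe hψ hn j.1.2, iteratedDeriv_hBarLift hψ hn j.1.2,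
    funext fun x => deriv_hLoc (n := n) hψ j.1.2 x]
  exact h j _ (mem_univ _)

lemma deriv_hL_pos (hψ : IsStep ψ) (hn : 0 < n) {q : ℕ} (hq : 10 < q) (x : ℝ) :
    0 < deriv (hL ψ n q).1 x := by
  rw [hL_coe hψ hn hq]
  exact (tParam_pos hn hq).trans_le (le_deriv_hBarLift hψ hn hq x)

lemma polyGrowth_hL_inv (hψ : IsStep ψ) (hn : 0 < n) (k : ℕ) :
    PolyGrowth parScale univ k (fun j : ParIdx => deriv ((hL ψ n j.1)⁻¹).1) := by
  refine PolyGrowth.deriv_symm one_le_parScale (fun j => (hL ψ n j.1).2.2.1)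
    (polyGrowth_hL hψ hn) (fun j x => deriv_hL_pos hψ hn j.1.2 x)
    -- The slope is at least `t`, so its reciprocal is at most `q^(2n-1)`.
    ⟨1, zero_le_one, 2 * n - 1, fun j x _ => ?_⟩ (fun j => (hL ψ n j.1).2.2.2)
    (fun j x => RelIso.apply_inv_self _ x) k
  rw [hL_coe hψ hn j.1.2, one_mul]
  calc _ ≤ (tParam n j.1)⁻¹ :=
        inv_anti₀ (tParam_pos hn j.1.2) (le_deriv_hBarLift hψ hn j.1.2 x)
    _ = parScale j ^ (2 * n - 1) := by rw [tParam_eq hn, inv_inv]; rfl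

lemma bounded_of_periodic {f : ℝ → ℝ} (hf : Continuous f) (hp : ∀ x, f (x + 1) = f x) :
    ∃ C : ℝ, 0 ≤ C ∧ ∀ x, |f x| ≤ C := by
  obtain ⟨C, hC⟩ := isCompact_Icc.exists_bound_of_continuousOn
    (s := Icc (0 : ℝ) 1) hf.continuousOn
  refine ⟨C, (norm_nonneg _).trans (hC 0 (by simp)), fun x => ?_⟩
  have hper : Function.Periodic f 1 := hp
  have := hper.sub_int_mul_eq ⌊x⌋ (x := x)
  rw [← this, mul_one]
  exact hC _ ⟨Int.fract_nonneg x, (Int.fract_lt_one x).le⟩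

lemma iteratedDeriv_add_one {f : ℝ → ℝ} (hp : ∀ x, f (x + 1) = f x) (i : ℕ) (x : ℝ) :
    iteratedDeriv i f (x + 1) = iteratedDeriv i f x := by
  have := congrFun (iteratedDeriv_comp_add_const i f 1) x
  rw [← this]
  congr 1
  exact funext hp

lemma SLift.deriv_add_one (f : SLift) (x : ℝ) : deriv f.1 (x + 1) = deriv f.1 x := by
  have h : (fun x => f.1 (x + 1)) = fun x => f.1 x + 1 := funext f.2.1
  have h1 := deriv_comp_add_const (f := f.1) (1 : ℝ) x
  rw [h, deriv_add_const] at h1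
  exact h1.symm

lemma SLift.polyGrowth (f : SLift) {ι : Type*} (s : ι → ℝ) (X : Set ℝ) (k : ℕ) :
    PolyGrowth s X k (fun _ => deriv f.1) := by
  refine polyGrowth_of_iteratedDeriv (fun _ => contDiff_deriv f.2.2.1) fun i _ => ?_
  obtain ⟨C, hC, h⟩ := bounded_of_periodic
    ((contDiff_deriv f.2.2.1).continuous_iteratedDeriv i (by exact_mod_cast le_top))
    (iteratedDeriv_add_one (SLift.deriv_add_one f) i)
  exact ⟨C, hC, 0, fun j x _ => by simpa using h x⟩

lemma polyGrowth_mul_sLift {k : ℕ} (F G : ParIdx → SLift)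
    (hF : PolyGrowth parScale univ k (fun j => deriv (F j).1))
    (hG : PolyGrowth parScale univ k (fun j => deriv (G j).1)) :
    PolyGrowth parScale univ k (fun j => deriv (F j * G j).1) :=
  PolyGrowth.deriv_comp (F := fun j => (F j).1) (G := fun j => (G j).1) one_le_parScale
    (fun j => (F j).2.2.1) hF (fun j => (G j).2.2.1) hG

/-- The conjugate of a translation by a lift. -/
def conjL (F : SLift) (β : ℝ) : SLift := F * trL β * F⁻¹

lemma conjL_apply (F : SLift) (β x : ℝ) : (conjL F β).1 x = F.1 ((F⁻¹).1 x + β) := rfl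

lemma conjL_inv (F : SLift) (β : ℝ) : (conjL F β)⁻¹ = conjL F (-β) := by
  rw [conjL, conjL, mul_inv_rev, mul_inv_rev, inv_inv, trL_inv, mul_assoc]

/-- Two lifts are `ε`-close together with their derivatives of order at most `k`. -/
def CkClose (k : ℕ) (ε : ℝ) (f g : SLift) : Prop :=
  ∀ i ≤ k, ∀ x, |iteratedDeriv i f.1 x - iteratedDeriv i g.1 x| ≤ ε

lemma CkClose.symm {k : ℕ} {ε : ℝ} {f g : SLift} (h : CkClose k ε f g) : CkClose k ε g f :=
  fun i hi x => by rw [abs_sub_comm]; exact h i hi x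

lemma CkClose.trans {k : ℕ} {ε δ : ℝ} {f g h : SLift} (h1 : CkClose k ε f g)
    (h2 : CkClose k δ g h) : CkClose k (ε + δ) f h := fun i hi x =>
  (abs_sub_le _ _ _).trans (add_le_add (h1 i hi x) (h2 i hi x))

lemma CkClose.mono {k l : ℕ} {ε δ : ℝ} {f g : SLift} (h : CkClose k ε f g) (hl : l ≤ k)
    (hε : ε ≤ δ) : CkClose l δ f g := fun i hi x => (h i (hi.trans hl) x).trans hε

/-- The difference of the two conjugates is `β - γ` times a difference quotient of `F` composed with
`F⁻¹`. The angles belong to the index, so the constants do not depend on them. -/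
lemma conj_translation_growth (F : ParIdx → SLift)
    (h1 : ∀ k, PolyGrowth parScale univ k (fun j => deriv (F j).1))
    (h2 : ∀ k, PolyGrowth parScale univ k (fun j => deriv ((F j)⁻¹).1)) (i : ℕ) :
    ∃ C : ℝ, 0 ≤ C ∧ ∃ N : ℕ, ∀ j x,
      |iteratedDeriv i (conjL (F j) j.2.1).1 x - iteratedDeriv i (conjL (F j) j.2.2).1 x|
        ≤ C * parScale j ^ N * |j.2.1 - j.2.2| := by
  have h3 := ((PolyGrowth.translation_quotient (β := fun j : ParIdx => j.2.1)
    (γ := fun j : ParIdx => j.2.2) (fun j => (F j).2.2.1) (h1 i)).comp one_le_parScale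
    (fun j => (F j).2.2.2) (fun _ => mapsTo_univ _ _) fun l _ => h2 l)
  obtain ⟨C, hC, N, h⟩ := h3.iteratedDeriv le_rfl
  refine ⟨C, hC, N, fun j x => ?_⟩
  have hs : ∀ β, ContDiffAt ℝ i (conjL (F j) β).1 x := fun β =>
    ((conjL (F j) β).2.2.1.of_le (by exact_mod_cast le_top)).contDiffAt
  rw [← iteratedDeriv_sub (hs _) (hs _)]
  have e : (⇑(conjL (F j) j.2.1).1 - ⇑(conjL (F j) j.2.2).1 : ℝ → ℝ) = fun x =>
      (j.2.1 - j.2.2) * ((j.2.1 - j.2.2)⁻¹ *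
        ((F j).1 (((F j)⁻¹).1 x + j.2.1) - (F j).1 (((F j)⁻¹).1 x + j.2.2))) := by
    funext y
    rw [Pi.sub_apply, conjL_apply, conjL_apply]
    rcases eq_or_ne j.2.1 j.2.2 with h0 | h0
    · rw [h0]; simp
    · have := sub_ne_zero.2 h0
      field_simp
  rw [e, iteratedDeriv_const_mul_field, abs_mul, mul_comm]
  exact mul_le_mul_of_nonneg_right (h j x (mem_univ x)) (abs_nonneg _)

end Growth

/-! ### Choosing the next rational number -/

/-- The filter of rational numbers `p / q` that approximate `α` better than any power of `q`. -/
def liouvilleFilter (α : ℝ) : Filter (ℕ × ℤ) :=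
  ⨅ N : ℕ, 𝓟 {r | N ≤ r.1 ∧ |α - r.2 / r.1| < 1 / (r.1 : ℝ) ^ N}

section Next

variable {α : ℝ}

lemma liouvilleFilter_hasBasis (α : ℝ) : (liouvilleFilter α).HasBasis (fun _ : ℕ => True)
    fun N => {r | N ≤ r.1 ∧ |α - r.2 / r.1| < 1 / (r.1 : ℝ) ^ N} := by
  refine hasBasis_iInf_principal (Antitone.directed_ge (antitone_nat_of_succ_le fun N r hr => ?_))
  refine ⟨by have := hr.1; omega, hr.2.trans_le ?_⟩
  have h1 : (1 : ℝ) ≤ r.1 := by exact_mod_cast le_trans (by omega) hr.1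
  apply one_div_le_one_div_of_le (by positivity)
  exact pow_le_pow_right₀ h1 (by omega)

lemma liouvilleFilter_neBot (hα : Liouville α) : (liouvilleFilter α).NeBot := by
  rw [(liouvilleFilter_hasBasis α).neBot_iff]
  intro N _
  obtain ⟨q, hq, p, -, h⟩ := ((eventually_ge_atTop N).and_frequently
    (hα.frequently_exists_num N)).exists
  exact ⟨(q, p), hq, h⟩

lemma tendsto_fst_liouvilleFilter (α : ℝ) : Tendsto Prod.fst (liouvilleFilter α) atTop :=
  tendsto_atTop.2 fun N => (liouvilleFilter_hasBasis α).mem_iff.2 ⟨N, trivial, fun _ h => h.1⟩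

lemma eventually_ge_liouvilleFilter (α : ℝ) (C : ℝ) : ∀ᶠ r in liouvilleFilter α, C ≤ (r.1 : ℝ) :=
  (tendsto_natCast_atTop_atTop.comp (tendsto_fst_liouvilleFilter α)).eventually_ge_atTop C

lemma eventually_approx_liouvilleFilter (α : ℝ) (C : ℝ) (hC : 0 ≤ C) (N : ℕ) {ε : ℝ}
    (hε : 0 < ε) : ∀ᶠ r in liouvilleFilter α, C * (r.1 : ℝ) ^ N * |α - r.2 / r.1| ≤ ε := by
  -- One exponent more than needed: the spare factor `1 / r.1` absorbs `C / ε`.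
  have h1 : ∀ᶠ r in liouvilleFilter α, |α - r.2 / r.1| < 1 / (r.1 : ℝ) ^ (N + 1) :=
    (liouvilleFilter_hasBasis α).mem_iff.2 ⟨N + 1, trivial, fun _ h => h.2⟩
  filter_upwards [h1, eventually_ge_liouvilleFilter α (C / ε), eventually_ge_liouvilleFilter α 1]
    with r hr1 hr2 hr3
  have h0 : (0 : ℝ) < r.1 := by linarith
  calc C * (r.1 : ℝ) ^ N * |α - r.2 / r.1|
      ≤ C * (r.1 : ℝ) ^ N * (1 / (r.1 : ℝ) ^ (N + 1)) := by gcongr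
    _ = C / r.1 := by rw [pow_succ]; field_simp
    _ ≤ ε := by
      rw [div_le_iff₀ h0]
      rw [div_le_iff₀ hε] at hr2
      linarith

variable {ψ : ℝ → ℝ} {n : ℕ}

/-- Only the distance of the angles is prescribed, so the estimate serves both `α, p/q` and `-α,
-p/q`, that is, the conjugated rotations and their inverses. -/
lemma eventually_ckClose (F : ParIdx → SLift)
    (h1 : ∀ k, PolyGrowth parScale univ k (fun j => deriv (F j).1))
    (h2 : ∀ k, PolyGrowth parScale univ k (fun j => deriv ((F j)⁻¹).1)) (k : ℕ) {ε : ℝ}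
    (hε : 0 < ε) : ∀ᶠ r in liouvilleFilter α, ∀ (hr : 10 < r.1) (β γ : ℝ), |β - γ| = |α - r.2 / r.1| →
      CkClose k ε (conjL (F (⟨r.1, hr⟩, β, γ)) β) (conjL (F (⟨r.1, hr⟩, β, γ)) γ) := by
  have h3 : ∀ i ∈ Finset.range (k + 1), ∀ᶠ r in liouvilleFilter α, ∀ (hr : 10 < r.1) (β γ : ℝ),
      |β - γ| = |α - r.2 / r.1| → ∀ x,
      |iteratedDeriv i (conjL (F (⟨r.1, hr⟩, β, γ)) β).1 x
        - iteratedDeriv i (conjL (F (⟨r.1, hr⟩, β, γ)) γ).1 x| ≤ ε := by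
    intro i _
    obtain ⟨C, hC, N, h⟩ := conj_translation_growth F h1 h2 i
    filter_upwards [eventually_approx_liouvilleFilter α C hC N hε] with r hr1 hr β γ hβ x
    refine (h (⟨r.1, hr⟩, β, γ) x).trans ?_
    change C * (r.1 : ℝ) ^ N * |β - γ| ≤ ε
    rw [hβ]
    exact hr1
  filter_upwards [(Filter.eventually_all_finset _).2 h3] with r hr hr' β γ hβ i hi x
  exact hr i (Finset.mem_range.2 (by omega)) hr' β γ hβ x

lemma SLift.exists_lipschitz (f : SLift) :
    ∃ C : ℝ, 0 ≤ C ∧ ∀ x y, |f.1 x - f.1 y| ≤ C * |x - y| := by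
  obtain ⟨C, hC, h⟩ := bounded_of_periodic (contDiff_deriv f.2.2.1).continuous (SLift.deriv_add_one f)
  exact ⟨C, hC, fun x y => convex_univ.norm_image_sub_le_of_norm_deriv_le (𝕜 := ℝ)
    (fun z _ => differentiable_of_smooth f.2.2.1 z) (fun z _ => h z) (mem_univ _) (mem_univ _)⟩

lemma eventually_lipschitz (f : SLift) (c : ℝ) (hc : 0 < c) :
    ∀ᶠ r in liouvilleFilter α, ∀ x y, |f.1 x - f.1 y| ≤ c * r.1 * |x - y| := by
  obtain ⟨C, hC, h⟩ := SLift.exists_lipschitz f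
  filter_upwards [eventually_ge_liouvilleFilter α (C / c)] with r hr x y
  refine (h x y).trans ?_
  rw [div_le_iff₀ hc] at hr
  gcongr
  linarith

/-- Equidistribution: a smooth lift distorts small periodic sets only slightly. -/
lemma eventually_sum_le (f : SLift) {δ : ℝ} (hδ : 0 < δ) (hδ1 : δ ≤ 1) :
    ∀ᶠ r in liouvilleFilter α, ∑ j ∈ Finset.range r.1,
      (f.1 ((j : ℝ) / r.1 + δ / r.1) - f.1 ((j : ℝ) / r.1)) ≤ 2 * δ := by
  have hd := contDiff_deriv f.2.2.1
  have hdd := contDiff_deriv hd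
  have hper : ∀ x, deriv (deriv f.1) (x + 1) = deriv (deriv f.1) x := fun x => by
    simpa [iteratedDeriv_one] using iteratedDeriv_add_one (SLift.deriv_add_one f) 1 x
  obtain ⟨M, hM, hb⟩ := bounded_of_periodic hdd.continuous hper
  have hlip : ∀ x y, |deriv f.1 x - deriv f.1 y| ≤ M * |x - y| := fun x y =>
    convex_univ.norm_image_sub_le_of_norm_deriv_le (𝕜 := ℝ)
      (fun z _ => differentiable_of_smooth hd z) (fun z _ => hb z) (mem_univ _) (mem_univ _)
  filter_upwards [eventually_ge_liouvilleFilter α M, eventually_ge_liouvilleFilter α 1]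
    with r hr hr1
  have h0 : (0 : ℝ) < r.1 := by linarith
  -- Inside a cell of length `1 / r.1` the derivative varies by at most `M / r.1 ≤ 1`. By the mean
  -- value theorem the first part, of length `δ / r.1`, takes at most the fraction `δ` of the
  -- increment over the cell, plus `δ / r.1`. Summation gives `δ + δ`.
  have hterm : ∀ j ∈ Finset.range r.1, f.1 ((j : ℝ) / r.1 + δ / r.1) - f.1 ((j : ℝ) / r.1) ≤
      δ * (f.1 (((j + 1 : ℕ) : ℝ) / r.1) - f.1 ((j : ℝ) / r.1)) + δ / r.1 := by
    intro j _
    have e : ((j + 1 : ℕ) : ℝ) / r.1 = j / r.1 + 1 / r.1 := by push_cast; ring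
    rw [e]
    set a : ℝ := j / r.1
    have mv : ∀ b, 0 < b → ∃ c ∈ Ioo a (a + b), f.1 (a + b) - f.1 a = deriv f.1 c * b := by
      intro b hb
      obtain ⟨c, hc, h⟩ := exists_deriv_eq_slope f.1 (a := a) (b := a + b) (by linarith)
        f.2.2.1.continuous.continuousOn (differentiable_of_smooth f.2.2.1).differentiableOn
      refine ⟨c, hc, ?_⟩
      rw [h, add_sub_cancel_left]
      field_simp
    have hle : δ / r.1 ≤ 1 / r.1 := by gcongr
    obtain ⟨c, hc, h1⟩ := mv (δ / r.1) (by positivity)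
    obtain ⟨d, hd, h2⟩ := mv (1 / r.1) (by positivity)
    rw [h1, h2]
    have h3 : |c - d| ≤ 1 / r.1 := abs_le.2 ⟨by linarith [hc.1, hd.2], by linarith [hc.2, hd.1]⟩
    have h4 : deriv f.1 c ≤ deriv f.1 d + 1 := by
      have := (hlip c d).trans (mul_le_mul_of_nonneg_left h3 hM)
      have h5 : M * (1 / r.1) ≤ 1 := by
        rw [mul_one_div, div_le_one h0]; exact hr
      linarith [le_abs_self (deriv f.1 c - deriv f.1 d)]
    calc deriv f.1 c * (δ / r.1) ≤ (deriv f.1 d + 1) * (δ / r.1) := by gcongr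
      _ = _ := by ring
  refine (Finset.sum_le_sum hterm).trans ?_
  rw [Finset.sum_add_distrib, ← Finset.mul_sum,
    Finset.sum_range_sub (fun j : ℕ => f.1 ((j : ℝ) / r.1)), Finset.sum_const, Finset.card_range,
    nsmul_eq_mul, div_self h0.ne']
  have h1 : f.1 1 - f.1 ((0 : ℕ) / r.1) = 1 := by
    have := f.2.1 0
    rw [zero_add] at this
    simp [this]
  rw [h1, mul_div_cancel₀ _ h0.ne']
  linarith

open Classical in
/-- The conjugations available after one more step. -/
def nextSet (ψ : ℝ → ℝ) (n q : ℕ) (𝒢 : Finset SLift) : Finset SLift :=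
  𝒢 ∪ 𝒢.image (fun G => G * hL ψ n q) ∪ 𝒢.image (fun G => G * (hL ψ n q)⁻¹)

/-- The requirements on the rational number `p / q` of step `n`. -/
structure GoodStep (ψ : ℝ → ℝ) (α : ℝ) (n : ℕ) (𝒢 : Finset SLift) (M q : ℕ) (p : ℤ) : Prop where
  gt_ten : 10 < q
  ge : M ≤ q
  approx : |α - p / q| ≤ 1 / 2 ^ n
  lip : ∀ G ∈ 𝒢, ∀ x y, |G.1 x - G.1 y| ≤ 1 / 2 ^ n * q * |x - y|
  lip_inv : ∀ G ∈ 𝒢, ∀ x y, |(G⁻¹).1 x - (G⁻¹).1 y| ≤ 1 / 2 ^ n * q * |x - y|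
  sum_le : ∀ G ∈ 𝒢, ∑ j ∈ Finset.range q,
    (G.1 ((j : ℝ) / q + 1 / 2 ^ (n + 1) / q) - G.1 ((j : ℝ) / q)) ≤ 2 * (1 / 2 ^ (n + 1))
  close : ∀ G ∈ nextSet ψ n q 𝒢, CkClose n (1 / 2 ^ n) (conjL G α) (conjL G (p / q))
  close_neg : ∀ G ∈ nextSet ψ n q 𝒢, CkClose n (1 / 2 ^ n) (conjL G (-α)) (conjL G (-(p / q)))

/-- Each requirement holds eventually along `liouvilleFilter α`. As `𝒢` is finite, they all hold
simultaneously, so the choice of `p / q` does not depend on the code. -/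
lemma exists_goodStep (hα : Liouville α) (hψ : IsStep ψ) (hn : 0 < n) (𝒢 : Finset SLift)
    (M : ℕ) : ∃ q p, GoodStep ψ α n 𝒢 M q p := by
  have hε : (0 : ℝ) < 1 / 2 ^ n := by positivity
  have hδ : (0 : ℝ) < 1 / 2 ^ (n + 1) := by positivity
  have hδ1 : (1 : ℝ) / 2 ^ (n + 1) ≤ 1 := by
    rw [div_le_one (by positivity)]; exact one_le_pow₀ (by norm_num)
  have key : ∀ G ∈ 𝒢, ∀ᶠ r in liouvilleFilter α,
      (∀ x y, |G.1 x - G.1 y| ≤ 1 / 2 ^ n * r.1 * |x - y|) ∧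
      (∀ x y, |(G⁻¹).1 x - (G⁻¹).1 y| ≤ 1 / 2 ^ n * r.1 * |x - y|) ∧
      (∑ j ∈ Finset.range r.1,
        (G.1 ((j : ℝ) / r.1 + 1 / 2 ^ (n + 1) / r.1) - G.1 ((j : ℝ) / r.1))
          ≤ 2 * (1 / 2 ^ (n + 1))) ∧
      (∀ (_ : 10 < r.1) (β γ : ℝ), |β - γ| = |α - r.2 / r.1| →
        CkClose n (1 / 2 ^ n) (conjL G β) (conjL G γ)) ∧
      (∀ (_ : 10 < r.1) (β γ : ℝ), |β - γ| = |α - r.2 / r.1| →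
        CkClose n (1 / 2 ^ n) (conjL (G * hL ψ n r.1) β) (conjL (G * hL ψ n r.1) γ)) ∧
      (∀ (_ : 10 < r.1) (β γ : ℝ), |β - γ| = |α - r.2 / r.1| →
        CkClose n (1 / 2 ^ n) (conjL (G * (hL ψ n r.1)⁻¹) β)
          (conjL (G * (hL ψ n r.1)⁻¹) γ)) := by
    intro G _
    refine (eventually_lipschitz G _ hε).and ((eventually_lipschitz G⁻¹ _ hε).and
      ((eventually_sum_le G hδ hδ1).and ((eventually_ckClose (fun _ => G)
        (fun k => SLift.polyGrowth G _ _ k)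
        (fun k => SLift.polyGrowth G⁻¹ _ _ k) n hε).and
      ((eventually_ckClose (fun j => G * hL ψ n j.1) (fun k => ?_) (fun k => ?_) n hε).and
      (eventually_ckClose (fun j => G * (hL ψ n j.1)⁻¹) (fun k => ?_) (fun k => ?_) n hε)))))
    · exact polyGrowth_mul_sLift (fun _ => G) _ (SLift.polyGrowth G _ _ k) (polyGrowth_hL hψ hn k)
    · simp only [mul_inv_rev]
      exact polyGrowth_mul_sLift _ (fun _ => G⁻¹) (polyGrowth_hL_inv hψ hn k)
        (SLift.polyGrowth G⁻¹ _ _ k)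
    · exact polyGrowth_mul_sLift (fun _ => G) _ (SLift.polyGrowth G _ _ k)
        (polyGrowth_hL_inv hψ hn k)
    · simp only [mul_inv_rev, inv_inv]
      exact polyGrowth_mul_sLift _ (fun _ => G⁻¹) (polyGrowth_hL hψ hn k)
        (SLift.polyGrowth G⁻¹ _ _ k)
  have := liouvilleFilter_neBot hα
  obtain ⟨⟨q, p⟩, h1, h2, h3, h4⟩ := (((tendsto_fst_liouvilleFilter α).eventually_ge_atTop 11).and
    (((tendsto_fst_liouvilleFilter α).eventually_ge_atTop M).and
    ((eventually_approx_liouvilleFilter α 1 zero_le_one 0 hε).and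
      ((Filter.eventually_all_finset 𝒢).2 key)))).exists
  have hq : 10 < q := h1
  have hneg : |(-α) - (-((p : ℝ) / q))| = |α - p / q| := by
    rw [← abs_neg]; congr 1; ring
  have hcl : ∀ G ∈ nextSet ψ n q 𝒢, ∀ β γ : ℝ, |β - γ| = |α - p / q| →
      CkClose n (1 / 2 ^ n) (conjL G β) (conjL G γ) := by
    intro G hG β γ hβ
    simp only [nextSet, Finset.mem_union, Finset.mem_image] at hG
    rcases hG with (hG | ⟨G, hG, rfl⟩) | ⟨G, hG, rfl⟩
    · exact (h4 G hG).2.2.2.1 hq β γ hβ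
    · exact (h4 G hG).2.2.2.2.1 hq β γ hβ
    · exact (h4 G hG).2.2.2.2.2 hq β γ hβ
  exact ⟨q, p, hq, h2, by simpa using h3, fun G hG => (h4 G hG).1, fun G hG => (h4 G hG).2.1,
    fun G hG => (h4 G hG).2.2.1, fun G hG => hcl G hG _ _ rfl, fun G hG => hcl G hG _ _ hneg⟩

end Next

/-! ### The sequence of rational numbers -/

/-- A sequence of rational numbers for which the construction converges, together with finite sets
containing all the conjugations. -/
structure Scheme (ψ : ℝ → ℝ) (α : ℝ) where
  step : IsStep ψ
  q : ℕ → ℕ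
  p : ℕ → ℤ
  conjs : ℕ → Finset SLift
  conjs_zero : conjs 0 = {1}
  conjs_succ : ∀ m, conjs (m + 1) = nextSet ψ (m + 1) (q (m + 1)) (conjs m)
  good : ∀ m, GoodStep ψ α (m + 1) (conjs m) (2 ^ (m + 20) * q m ^ (2 * m)) (q (m + 1)) (p (m + 1))

lemma exists_scheme {α : ℝ} (hα : Liouville α) {ψ : ℝ → ℝ} (hψ : IsStep ψ) :
    Nonempty (Scheme ψ α) := by
  choose Q P hQP using fun (m : ℕ) (𝒢 : Finset SLift) (M : ℕ) =>
    exists_goodStep hα hψ (Nat.succ_pos m) 𝒢 M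
  -- The dummy denominator `0` at index `0` enters only as `0 ^ 0 = 1`, so the first true
  -- denominator is at least `2 ^ 20`. The factor `2 ^ (m + 20)` makes `1 / q` summable and leaves
  -- room for the numerical constants of the expansion estimate.
  let st : ℕ → ℕ × ℤ × Finset SLift := fun m => Nat.rec (0, 0, {1}) (fun m s =>
    (Q m s.2.2 (2 ^ (m + 20) * s.1 ^ (2 * m)), P m s.2.2 (2 ^ (m + 20) * s.1 ^ (2 * m)),
      nextSet ψ (m + 1) (Q m s.2.2 (2 ^ (m + 20) * s.1 ^ (2 * m))) s.2.2)) m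
  exact ⟨⟨hψ, fun m => (st m).1, fun m => (st m).2.1, fun m => (st m).2.2, rfl, fun m => rfl,
    fun m => hQP m _ _⟩⟩

/-- A product of maps chosen among `h n` and its inverse. -/
def LSeq (h : ℕ+ → SLift) (a : ℕ+ → Bool) : ℕ → SLift
  | 0 => 1
  | n + 1 => LSeq h a n * if a n.succPNat then (h n.succPNat)⁻¹ else h n.succPNat

lemma toDiff_LSeq (h : ℕ+ → SLift) (a : ℕ+ → Bool) (n : ℕ) :
    toDiff (LSeq h a n) = HSeq (fun n => toDiff (h n)) a n := by
  induction n with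
  | zero => exact map_one _
  | succ n ih =>
    rw [LSeq, HSeq, map_mul, ih, hSeq]
    split_ifs
    · rw [map_inv]
    · rfl

lemma toDiff_conjL (h : ℕ+ → SLift) (a : ℕ+ → Bool) (n : ℕ) (β : ℝ) :
    toDiff (conjL (LSeq h a n) β) = conjRot (fun n => toDiff (h n)) a n β := by
  rw [conjL, conjRot, map_mul, map_mul, map_inv, toDiff_LSeq, toDiff_trL]

/-! ### Limits of lifts -/

lemma exists_limit_of_geometric {f : ℕ → ℝ → ℝ}
    (hf : ∀ m x, |f (m + 1) x - f m x| ≤ 1 / 2 ^ (m + 1)) :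
    ∃ F : ℝ → ℝ, ∀ m x, |F x - f m x| ≤ 1 / 2 ^ m := by
  have h1 : ∀ x m, dist (f m x) (f (m + 1) x) ≤ 1 / 2 / 2 ^ m := fun x m => by
    rw [dist_comm, Real.dist_eq]
    refine (hf m x).trans (le_of_eq ?_)
    rw [pow_succ]; field_simp
  have h2 : ∀ x, ∃ l, Tendsto (fun m => f m x) atTop (𝓝 l) := fun x =>
    cauchySeq_tendsto_of_complete (cauchySeq_of_le_geometric_two (h1 x))
  choose F hF using h2
  refine ⟨F, fun m x => ?_⟩
  rw [abs_sub_comm]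
  exact dist_le_of_le_geometric_two_of_tendsto (h1 x) (hF x) m

lemma tendsto_of_geometric {f : ℕ → ℝ} {l : ℝ} (hf : ∀ m, |l - f m| ≤ 1 / 2 ^ m) :
    Tendsto f atTop (𝓝 l) := by
  rw [tendsto_iff_dist_tendsto_zero]
  refine squeeze_zero (fun _ => dist_nonneg) (fun m => ?_)
    (tendsto_pow_atTop_nhds_zero_of_lt_one (r := (1 / 2 : ℝ)) (by norm_num) (by norm_num))
  rw [dist_comm, Real.dist_eq, one_div_pow]
  exact hf m

lemma tendstoUniformly_of_geometric {f : ℕ → ℝ → ℝ} {F : ℝ → ℝ}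
    (hf : ∀ m x, |F x - f m x| ≤ 1 / 2 ^ m) : TendstoUniformly f F atTop := by
  rw [Metric.tendstoUniformly_iff]
  intro ε hε
  have h := (tendsto_pow_atTop_nhds_zero_of_lt_one (r := (1 / 2 : ℝ)) (by norm_num)
    (by norm_num)).eventually (gt_mem_nhds hε)
  filter_upwards [h] with m hm x
  rw [Real.dist_eq]
  rw [one_div_pow] at hm
  exact (hf m x).trans_lt hm

/-- A uniform limit of homeomorphisms need not be injective, so the inverses must converge uniformly
as well. Then `F (G x)` is the limit of `F (f_m⁻¹ x)`, which is `x`, and the roles of `F` and `G`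
can be exchanged. -/
lemma exists_limit_lift (f : ℕ → CLift)
    (h1 : ∀ m x, |(f (m + 1)).1 x - (f m).1 x| ≤ 1 / 2 ^ (m + 1))
    (h2 : ∀ m x, |((f (m + 1))⁻¹).1 x - ((f m)⁻¹).1 x| ≤ 1 / 2 ^ (m + 1)) :
    ∃ H : CLift, (∀ m x, |H.1 x - (f m).1 x| ≤ 1 / 2 ^ m) ∧
      ∀ m x, |(H⁻¹).1 x - ((f m)⁻¹).1 x| ≤ 1 / 2 ^ m := by
  obtain ⟨F, hF⟩ := exists_limit_of_geometric (f := fun m => (f m).1) h1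
  obtain ⟨G, hG⟩ := exists_limit_of_geometric (f := fun m => ((f m)⁻¹).1) h2
  have key : ∀ (f : ℕ → CLift) (F G : ℝ → ℝ), (∀ m x, |F x - (f m).1 x| ≤ 1 / 2 ^ m) →
      (∀ m x, |G x - ((f m)⁻¹).1 x| ≤ 1 / 2 ^ m) → Monotone F ∧ ∀ x, F (G x) = x := by
    intro f F G hF hG
    have hcF : Continuous F := (tendstoUniformly_of_geometric hF).continuous
      (Frequently.of_forall fun m => (f m).1.continuous)
    refine ⟨fun x y hxy => le_of_tendsto_of_tendsto' (tendsto_of_geometric fun m => hF m x)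
      (tendsto_of_geometric fun m => hF m y) fun m => (f m).1.monotone hxy, fun x => ?_⟩
    have t1 : Tendsto (fun m => F (((f m)⁻¹).1 x)) atTop (𝓝 (F (G x))) :=
      (hcF.tendsto _).comp (tendsto_of_geometric fun m => hG m x)
    have t2 : Tendsto (fun m => F (((f m)⁻¹).1 x)) atTop (𝓝 x) := by
      rw [tendsto_iff_dist_tendsto_zero]
      refine squeeze_zero (fun _ => dist_nonneg) (fun m => ?_)
        (tendsto_pow_atTop_nhds_zero_of_lt_one (r := (1 / 2 : ℝ)) (by norm_num) (by norm_num))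
      have := hF m (((f m)⁻¹).1 x)
      rw [show (f m).1 (((f m)⁻¹).1 x) = x from RelIso.apply_inv_self _ _] at this
      rw [Real.dist_eq, one_div_pow]
      exact this
    exact tendsto_nhds_unique t1 t2
  obtain ⟨mF, hFG⟩ := key f F G hF hG
  obtain ⟨mG, hGF⟩ := key (fun m => (f m)⁻¹) G F hG (by simpa using hF)
  let e : ℝ ≃ ℝ := ⟨F, G, hGF, hFG⟩
  have h3 : ∀ x, F (x + 1) = F x + 1 := fun x =>
    tendsto_nhds_unique (tendsto_of_geometric fun m => hF m (x + 1))
      (((tendsto_of_geometric fun m => hF m x).add_const 1).congr fun m => ((f m).2 x).symm)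
  exact ⟨⟨e.toOrderIso mF mG, h3⟩, hF, hG⟩

/-- Derivatives of order `i` are controlled only from index `i - 1` on, which suffices for uniform
convergence. The limits `D i` are then successive derivatives of one another. -/
lemma smooth_limit {f : ℕ → ℝ → ℝ} {F : ℝ → ℝ} (hf : ∀ m, ContDiff ℝ ∞ (f m))
    (hc : ∀ m, ∀ i ≤ m + 1, ∀ x,
      |iteratedDeriv i (f (m + 1)) x - iteratedDeriv i (f m) x| ≤ 1 / 2 ^ m)
    (hF : ∀ x, Tendsto (fun m => f m x) atTop (𝓝 (F x))) :
    ContDiff ℝ ∞ F ∧ ∀ m, ∀ i ≤ m + 1, ∀ x,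
      |iteratedDeriv i (f m) x - iteratedDeriv i F x| ≤ 2 / 2 ^ m := by
  have h1 : ∀ m, ∀ i ≤ m + 1, ∀ x k, dist (iteratedDeriv i (f (m + k)) x)
      (iteratedDeriv i (f (m + (k + 1))) x) ≤ 2 / 2 ^ m / 2 / 2 ^ k := by
    intro m i hi x k
    rw [dist_comm, Real.dist_eq]
    refine (hc (m + k) i (by omega) x).trans (le_of_eq ?_)
    rw [pow_add]; field_simp
  have h2 : ∀ i x, ∃ l, Tendsto (fun m => iteratedDeriv i (f m) x) atTop (𝓝 l) := by
    intro i x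
    obtain ⟨l, hl⟩ := cauchySeq_tendsto_of_complete
      (cauchySeq_of_le_geometric_two (h1 i i (by omega) x))
    refine ⟨l, (tendsto_add_atTop_iff_nat i).1 (hl.congr fun k => ?_)⟩
    rw [add_comm]
  choose D hD using h2
  have h3 : ∀ m, ∀ i ≤ m + 1, ∀ x, |iteratedDeriv i (f m) x - D i x| ≤ 2 / 2 ^ m := by
    intro m i hi x
    refine dist_le_of_le_geometric_two_of_tendsto₀ (h1 m i hi x) ?_
    exact ((tendsto_add_atTop_iff_nat m).2 (hD i x)).congr fun k => by rw [add_comm]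
  have h4 : ∀ i, TendstoUniformly (fun m => iteratedDeriv i (f m)) (D i) atTop := by
    intro i
    rw [Metric.tendstoUniformly_iff]
    intro ε hε
    have ht : Tendsto (fun m : ℕ => (2 : ℝ) * (1 / 2) ^ m) atTop (𝓝 (2 * 0)) :=
      (tendsto_pow_atTop_nhds_zero_of_lt_one (by norm_num) (by norm_num)).const_mul 2
    rw [mul_zero] at ht
    filter_upwards [ht.eventually (gt_mem_nhds hε), eventually_ge_atTop i] with m hm hi x
    rw [dist_comm, Real.dist_eq]
    refine (h3 m i (by omega) x).trans_lt ?_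
    rw [one_div_pow, mul_one_div] at hm
    exact hm
  have h5 : ∀ i x, HasDerivAt (D i) (D (i + 1) x) x := fun i x =>
    hasDerivAt_of_tendstoUniformly (h4 (i + 1)) (Eventually.of_forall fun m y => by
      rw [iteratedDeriv_succ]
      exact ((hf m).differentiable_iteratedDeriv i
        (by exact_mod_cast WithTop.coe_lt_top _) y).hasDerivAt) (hD i) x
  have h0 : F = D 0 := funext fun x =>
    tendsto_nhds_unique (hF x) ((hD 0 x).congr fun m => by rw [iteratedDeriv_zero])
  have h6 : ∀ i, iteratedDeriv i F = D i := by
    intro i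
    induction i with
    | zero => rw [iteratedDeriv_zero, h0]
    | succ i ih => rw [iteratedDeriv_succ, ih]; exact funext fun x => (h5 i x).deriv
  refine ⟨contDiff_of_differentiable_iteratedDeriv fun i _ => ?_, fun m i hi x => ?_⟩
  · rw [h6]; exact fun x => (h5 i x).differentiableAt
  · rw [h6]; exact h3 m i hi x

/-! ### The limits of the construction -/

namespace Scheme

variable {ψ : ℝ → ℝ} {α : ℝ} (S : Scheme ψ α)

/-- The lift of the `n`-th conjugation map. -/
def h (n : ℕ+) : SLift := hL ψ n (S.q n)

/-- The lift of `HSeq`. -/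
def L (a : ℕ+ → Bool) (m : ℕ) : SLift := LSeq S.h a m

/-- The lift of the map composed at step `m`. -/
def g (a : ℕ+ → Bool) (m : ℕ) : SLift :=
  if a m.succPNat then (hL ψ (m + 1) (S.q (m + 1)))⁻¹ else hL ψ (m + 1) (S.q (m + 1))

variable (a b : ℕ+ → Bool) (m : ℕ)

lemma L_zero : S.L a 0 = 1 := rfl

lemma L_succ : S.L a (m + 1) = S.L a m * S.g a m := rfl

lemma g_eq : S.g a m = hL ψ (m + 1) (S.q (m + 1)) ∨ S.g a m = (hL ψ (m + 1) (S.q (m + 1)))⁻¹ := by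
  unfold g
  split_ifs
  · exact Or.inr rfl
  · exact Or.inl rfl

lemma ten_lt : 10 < S.q (m + 1) := (S.good m).gt_ten

lemma q_pos : (0 : ℝ) < S.q (m + 1) := by
  exact_mod_cast (by have := S.ten_lt m; omega : 0 < S.q (m + 1))

lemma ten_lt' (n : ℕ+) : 10 < S.q n := by
  obtain ⟨m, rfl⟩ : ∃ m : ℕ, n = m.succPNat := ⟨n.natPred, (PNat.succPNat_natPred n).symm⟩
  exact S.ten_lt m

lemma q_ge_mul : 2 ^ (m + 20) * S.q m ^ (2 * m) ≤ S.q (m + 1) := (S.good m).ge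

lemma q_ge_pow : 2 ^ (m + 20) ≤ S.q (m + 1) := by
  refine le_trans (Nat.le_mul_of_pos_right _ ?_) (S.q_ge_mul m)
  rcases m with - | m
  · simp
  · exact pow_pos (by have := S.ten_lt m; omega) _

lemma two_mul_q_le : 2 * S.q (m + 1) ≤ S.q (m + 2) := by
  have h1 := S.q_ge_mul (m + 1)
  have h2 : S.q (m + 1) ≤ S.q (m + 1) ^ (2 * (m + 1)) :=
    Nat.le_self_pow (by omega) _
  have h3 : 2 ≤ 2 ^ (m + 1 + 20) := Nat.le_self_pow (by omega) _
  exact (Nat.mul_le_mul h3 h2).trans h1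

lemma subset_nextSet (n q : ℕ) (𝒢 : Finset SLift) : 𝒢 ⊆ nextSet ψ n q 𝒢 := fun G hG => by
  simp only [nextSet, Finset.mem_union]
  exact Or.inl (Or.inl hG)

lemma L_mem : S.L a m ∈ S.conjs m := by
  induction m with
  | zero => rw [S.conjs_zero, L_zero]; exact Finset.mem_singleton_self _
  | succ m ih =>
    rw [S.conjs_succ, L_succ]
    simp only [nextSet, Finset.mem_union, Finset.mem_image]
    rcases S.g_eq a m with h | h <;> rw [h]
    · exact Or.inl (Or.inr ⟨_, ih, rfl⟩)
    · exact Or.inr ⟨_, ih, rfl⟩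

/-- Old conjugations are never discarded, so the measure estimates of all later steps apply to them;
absolute continuity needs this for `L a m` and for the identity. -/
lemma conjs_mono : Monotone S.conjs := monotone_nat_of_le_succ fun m => by
  rw [S.conjs_succ]; exact subset_nextSet _ _ _

lemma abs_g_sub_le (x : ℝ) : |(S.g a m).1 x - x| ≤ 1 / S.q (m + 1) := by
  rcases S.g_eq a m with h | h <;> rw [h]
  · exact abs_hL_sub_le S.step (Nat.succ_pos m) (S.ten_lt m) x
  · exact abs_hL_inv_sub_le S.step (Nat.succ_pos m) (S.ten_lt m) x

lemma abs_g_inv_sub_le (x : ℝ) : |((S.g a m)⁻¹).1 x - x| ≤ 1 / S.q (m + 1) := by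
  rcases S.g_eq a m with h | h <;> rw [h]
  · exact abs_hL_inv_sub_le S.step (Nat.succ_pos m) (S.ten_lt m) x
  · rw [inv_inv]; exact abs_hL_sub_le S.step (Nat.succ_pos m) (S.ten_lt m) x

lemma g_mul_trL (k : ℤ) : S.g a m * trL (k / S.q (m + 1)) = trL (k / S.q (m + 1)) * S.g a m := by
  have h := hL_mul_trL S.step (Nat.succ_pos m) (S.ten_lt m) k
  rcases S.g_eq a m with h' | h' <;> rw [h']
  · exact h
  · exact ((Commute.eq (show Commute (hL ψ (m + 1) (S.q (m + 1))) _ from h).inv_left))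

lemma conjL_L_succ (k : ℤ) :
    conjL (S.L a (m + 1)) (k / S.q (m + 1)) = conjL (S.L a m) (k / S.q (m + 1)) := by
  have h := S.g_mul_trL a m k
  rw [conjL, conjL, L_succ, mul_inv_rev, mul_assoc (S.L a m) (S.g a m), h]
  simp only [mul_assoc, mul_inv_cancel_left]

/-- The factor `g` moves points by at most `1 / q`, and `L a m` has Lipschitz constant at most `q /
2 ^ (m + 1)`. For the inverses no Lipschitz bound is needed, since there the new factor acts last.
-/
lemma abs_L_succ_sub_le (x : ℝ) : |(S.L a (m + 1)).1 x - (S.L a m).1 x| ≤ 1 / 2 ^ (m + 1) := by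
  have h := (S.good m).lip _ (S.L_mem a m) ((S.g a m).1 x) x
  have h0 := S.q_pos m
  calc |(S.L a (m + 1)).1 x - (S.L a m).1 x| ≤
      1 / 2 ^ (m + 1) * S.q (m + 1) * |(S.g a m).1 x - x| := h
    _ ≤ 1 / 2 ^ (m + 1) * S.q (m + 1) * (1 / S.q (m + 1)) := by
      gcongr; exact S.abs_g_sub_le a m x
    _ = _ := by field_simp

lemma one_div_q_le : (1 : ℝ) / S.q (m + 1) ≤ 1 / 2 ^ (m + 20) :=
  one_div_le_one_div_of_le (by positivity) (by exact_mod_cast S.q_ge_pow m)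

lemma abs_L_inv_succ_sub_le (x : ℝ) :
    |((S.L a (m + 1))⁻¹).1 x - ((S.L a m)⁻¹).1 x| ≤ 1 / 2 ^ (m + 1) := by
  rw [L_succ, mul_inv_rev]
  refine (S.abs_g_inv_sub_le a m _).trans ((S.one_div_q_le m).trans ?_)
  exact one_div_le_one_div_of_le (by positivity) (pow_le_pow_right₀ (by norm_num) (by omega))

lemma exists_H : ∃ H : CLift, (∀ m x, |H.1 x - (S.L a m).1 x| ≤ 1 / 2 ^ m) ∧
    ∀ m x, |(H⁻¹).1 x - ((S.L a m)⁻¹).1 x| ≤ 1 / 2 ^ m :=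
  exists_limit_lift (fun m => SLift.toC (S.L a m)) (S.abs_L_succ_sub_le a)
    (S.abs_L_inv_succ_sub_le a)

/-- The lift of the limit conjugacy. -/
def H : CLift := (S.exists_H a).choose

lemma abs_H_sub_le (x : ℝ) : |(S.H a).1 x - (S.L a m).1 x| ≤ 1 / 2 ^ m :=
  (S.exists_H a).choose_spec.1 m x

lemma abs_H_inv_sub_le (x : ℝ) : |((S.H a)⁻¹).1 x - ((S.L a m)⁻¹).1 x| ≤ 1 / 2 ^ m :=
  (S.exists_H a).choose_spec.2 m x

lemma tendsto_L (x : ℝ) : Tendsto (fun m => (S.L a m).1 x) atTop (𝓝 ((S.H a).1 x)) :=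
  tendsto_of_geometric fun m => S.abs_H_sub_le a m x

lemma tendsto_conjL (β x : ℝ) : Tendsto (fun m => (conjL (S.L a m) β).1 x) atTop
    (𝓝 ((S.H a * SLift.toC (trL β) * (S.H a)⁻¹).1 x)) := by
  have h1 : TendstoUniformly (fun m => (S.L a m).1) (S.H a).1 atTop :=
    tendstoUniformly_of_geometric (S.abs_H_sub_le a)
  have h2 : Tendsto (fun m => ((S.L a m)⁻¹).1 x) atTop (𝓝 (((S.H a)⁻¹).1 x)) :=
    tendsto_of_geometric fun m => S.abs_H_inv_sub_le a m x
  exact h1.tendsto_comp (S.H a).1.continuous.continuousAt (h2.add_const β)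

/-- With `r = p (m+1) / q (m+1)`, replace `α` by `r` at level `m + 1`, use that the conjugates of
`r` at levels `m + 1` and `m` coincide, and return from `r` to `α` at level `m`. -/
lemma ckClose_conjL_succ : CkClose (m + 1) (1 / 2 ^ m) (conjL (S.L a (m + 1)) α)
      (conjL (S.L a m) α) ∧
    CkClose (m + 1) (1 / 2 ^ m) (conjL (S.L a (m + 1)) (-α)) (conjL (S.L a m) (-α)) := by
  have m1 : S.L a (m + 1) ∈ nextSet ψ (m + 1) (S.q (m + 1)) (S.conjs m) := by
    rw [← S.conjs_succ]; exact S.L_mem a (m + 1)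
  have m2 : S.L a m ∈ nextSet ψ (m + 1) (S.q (m + 1)) (S.conjs m) :=
    subset_nextSet _ _ _ (S.L_mem a m)
  have e : (1 : ℝ) / 2 ^ (m + 1) + 1 / 2 ^ (m + 1) = 1 / 2 ^ m := by rw [pow_succ]; field_simp; norm_num
  have g := S.good m
  constructor
  · have h1 := g.close _ m1
    rw [S.conjL_L_succ] at h1
    exact (h1.trans (g.close _ m2).symm).mono le_rfl e.le
  · have h1 := g.close_neg _ m1
    rw [← neg_div, ← Int.cast_neg, S.conjL_L_succ] at h1
    have h2 := g.close_neg _ m2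
    rw [← neg_div, ← Int.cast_neg] at h2
    exact (h1.trans h2.symm).mono le_rfl e.le

lemma smooth_conj {β : ℝ} (hβ : ∀ m, CkClose (m + 1) (1 / 2 ^ m) (conjL (S.L a (m + 1)) β)
    (conjL (S.L a m) β)) :
    ContDiff ℝ ∞ (S.H a * SLift.toC (trL β) * (S.H a)⁻¹).1 ∧ ∀ m, ∀ i ≤ m + 1, ∀ x,
      |iteratedDeriv i (conjL (S.L a m) β).1 x
        - iteratedDeriv i (S.H a * SLift.toC (trL β) * (S.H a)⁻¹).1 x| ≤ 2 / 2 ^ m :=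
  smooth_limit (f := fun m => (conjL (S.L a m) β).1) (fun m => (conjL (S.L a m) β).2.2.1) hβ
    (S.tendsto_conjL a β)

lemma conj_inv : (S.H a * SLift.toC (trL α) * (S.H a)⁻¹)⁻¹ =
    S.H a * SLift.toC (trL (-α)) * (S.H a)⁻¹ := by
  rw [← trL_inv, map_inv]; group

/-- The lift of the limit diffeomorphism. -/
def T : SLift := ⟨(S.H a * SLift.toC (trL α) * (S.H a)⁻¹).1,
  (S.H a * SLift.toC (trL α) * (S.H a)⁻¹).2,
  (S.smooth_conj a fun m => (S.ckClose_conjL_succ a m).1).1, by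
    have := (S.smooth_conj a fun m => (S.ckClose_conjL_succ a m).2).1
    rw [← conj_inv] at this
    exact this⟩

lemma toC_T : SLift.toC (S.T a) = S.H a * SLift.toC (trL α) * (S.H a)⁻¹ := rfl

lemma ckClose_T : CkClose (m + 1) (2 / 2 ^ m) (conjL (S.L a m) α) (S.T a) :=
  (S.smooth_conj a fun m => (S.ckClose_conjL_succ a m).1).2 m

lemma ckClose_T_inv : CkClose (m + 1) (2 / 2 ^ m) (conjL (S.L a m) α)⁻¹ (S.T a)⁻¹ := by
  have := (S.smooth_conj a fun m => (S.ckClose_conjL_succ a m).2).2 m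
  rw [← conj_inv] at this
  rw [conjL_inv]
  exact this

lemma ckClose_rational : CkClose (m + 1) (1 / 2 ^ (m + 1))
      (conjL (S.L a m) (S.p (m + 1) / S.q (m + 1))) (conjL (S.L a m) α) ∧
    CkClose (m + 1) (1 / 2 ^ (m + 1))
      (conjL (S.L a m) (S.p (m + 1) / S.q (m + 1)))⁻¹ (conjL (S.L a m) α)⁻¹ := by
  have m2 : S.L a m ∈ nextSet ψ (m + 1) (S.q (m + 1)) (S.conjs m) :=
    subset_nextSet _ _ _ (S.L_mem a m)
  refine ⟨((S.good m).close _ m2).symm, ?_⟩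
  rw [conjL_inv, conjL_inv]
  exact ((S.good m).close_neg _ m2).symm

lemma tendsto_rational :
    Tendsto (fun m => (S.p (m + 1) : ℝ) / S.q (m + 1)) atTop (𝓝 α) := by
  refine tendsto_of_geometric fun m => (S.good m).approx.trans ?_
  exact one_div_le_one_div_of_le (by positivity) (pow_le_pow_right₀ (by norm_num) (by omega))

lemma g_zero : (S.g a m).1 0 = 0 := by
  rcases S.g_eq a m with h | h <;> rw [h]
  · simpa using hL_div S.step (Nat.succ_pos m) (S.ten_lt m) 0
  · simpa using hL_inv_div S.step (Nat.succ_pos m) (S.ten_lt m) 0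

lemma L_apply_zero : (S.L a m).1 0 = 0 := by
  induction m with
  | zero => rfl
  | succ m ih =>
    change (S.L a m).1 ((S.g a m).1 0) = 0
    rw [S.g_zero, ih]

lemma H_zero : (S.H a).1 0 = 0 :=
  tendsto_nhds_unique (S.tendsto_L a 0) (by simp only [L_apply_zero]; exact tendsto_const_nhds)

/-! ### The tails of the limit conjugacy -/

/-- The part of the limit conjugacy that comes after step `m`. -/
def tail : CLift := (SLift.toC (S.L a m))⁻¹ * S.H a

lemma H_eq_mul_tail : S.H a = SLift.toC (S.L a m) * S.tail a m := by
  rw [tail, mul_inv_cancel_left]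

/-- Peeling off the first factor gives `1 / q (m+1) + 2 / q (m+2)`, and denominators at least double
at each step. -/
lemma abs_partial_sub_le (j : ℕ) (x : ℝ) :
    |((S.L a m)⁻¹ * S.L a (m + j)).1 x - x| ≤ 2 / S.q (m + 1) := by
  induction j generalizing m with
  | zero =>
    rw [add_zero, inv_mul_cancel]
    change |x - x| ≤ _
    rw [sub_self, abs_zero]
    positivity
  | succ j ih =>
    have e : (S.L a m)⁻¹ * S.L a (m + (j + 1)) =
        S.g a m * ((S.L a (m + 1))⁻¹ * S.L a (m + 1 + j)) := by
      rw [L_succ, mul_inv_rev, show m + (j + 1) = m + 1 + j by ring]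
      group
    rw [e]
    have h1 := ih (m + 1)
    have h2 := S.abs_g_sub_le a m (((S.L a (m + 1))⁻¹ * S.L a (m + 1 + j)).1 x)
    have h3 : (2 : ℝ) / S.q (m + 2) ≤ 1 / S.q (m + 1) := by
      have h4 : (2 : ℝ) * S.q (m + 1) ≤ S.q (m + 2) := by exact_mod_cast S.two_mul_q_le m
      rw [div_le_div_iff₀ (S.q_pos (m + 1)) (S.q_pos m)]
      linarith
    refine (abs_sub_le _ _ _).trans ((add_le_add h2 (h1.trans h3)).trans (le_of_eq ?_))
    ring

lemma abs_tail_sub_le (x : ℝ) : |(S.tail a m).1 x - x| ≤ 2 / S.q (m + 1) := by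
  have h1 : Tendsto (fun j => |((S.L a m)⁻¹ * S.L a (m + j)).1 x - x|) atTop
      (𝓝 |(S.tail a m).1 x - x|) := by
    have h2 : Tendsto (fun j => (S.L a (m + j)).1 x) atTop (𝓝 ((S.H a).1 x)) :=
      ((tendsto_add_atTop_iff_nat m).2 (S.tendsto_L a x)).congr fun j => by rw [add_comm]
    exact ((((S.L a m)⁻¹).1.continuous.tendsto _).comp h2 |>.sub_const x).abs
  exact le_of_tendsto' h1 fun j => S.abs_partial_sub_le a m j x

lemma abs_tail_inv_sub_le (x : ℝ) : |((S.tail a m)⁻¹).1 x - x| ≤ 2 / S.q (m + 1) := by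
  have := S.abs_tail_sub_le a m (((S.tail a m)⁻¹).1 x)
  rw [show (S.tail a m).1 (((S.tail a m)⁻¹).1 x) = x from RelIso.apply_inv_self _ _,
    abs_sub_comm] at this
  exact this

lemma g_mul_tail : S.tail a m = SLift.toC (S.g a m) * S.tail a (m + 1) := by
  rw [tail, tail, L_succ, map_mul]; group

end Scheme

/-! ### The metrics in terms of lifts -/

lemma dist_coe_le (x y : ℝ) : dist (x : S1) (y : S1) ≤ |x - y| := by
  rw [dist_eq_norm, ← AddCircle.coe_sub]
  exact QuotientAddGroup.norm_mk_le_norm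

/-- The difference of two lifts is continuous and integer valued, hence constant. -/
lemma IsLift.eq_add_int {F G : CircleDeg1Lift} {f : S1 → S1} (hF : IsLift F f)
    (hG : IsLift G f) : ∃ k : ℤ, ∀ x, F x = G x + k := by
  have h : ∀ x : ℝ, ∃ k : ℤ, (k : ℝ) = F x - G x := fun x => by
    have h1 : ((F x - G x : ℝ) : S1) = 0 := by
      rw [AddCircle.coe_sub, hF.2, hG.2, sub_self]
    obtain ⟨k, hk⟩ := (AddCircle.coe_eq_zero_iff (1 : ℝ)).1 h1
    exact ⟨k, by simpa using hk⟩
  choose k hk using h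
  have hc : Continuous k := by
    rw [Int.isClosedEmbedding_coe_real.isInducing.continuous_iff]
    exact (hF.1.sub hG.1).congr fun x => (hk x).symm
  refine ⟨k 0, fun x => ?_⟩
  have h0 : k x = k 0 := PreconnectedSpace.constant inferInstance hc
  have := hk x
  rw [h0] at this
  linarith

lemma iteratedDeriv_someLift (f : SLift) (i : ℕ) :
    iteratedDeriv (i + 1) (someLift (toDiff f)) = iteratedDeriv (i + 1) f.1 := by
  have h1 : IsLift (someLift (toDiff f)) (toDiff f).1 :=
    (Classical.choose_spec (toDiff f).2.1).1
  obtain ⟨k, hk⟩ := h1.eq_add_int (isLift_deg1 (SLift.toC f))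
  have : (⇑(someLift (toDiff f)) : ℝ → ℝ) = fun x => f.1 x + k := funext hk
  rw [this]
  funext x
  have h2 : (fun x => f.1 x + (k : ℝ)) = fun x => (k : ℝ) + f.1 x :=
    funext fun x => add_comm _ _
  rw [h2, iteratedDeriv_const_add (by omega)]

lemma supDist_le {f g : CLift} {ε : ℝ} (h : ∀ x, |f.1 x - g.1 x| ≤ ε) :
    supDist (toHomeo f) (toHomeo g) ≤ ε :=
  ciSup_le (s1_ind fun x => by
    rw [toHomeo_coe, toHomeo_coe]
    exact (dist_coe_le _ _).trans (h x))

lemma derivDist_le {k : ℕ} {ε : ℝ} {f g : SLift} (h : CkClose k ε f g) {i : ℕ} (hi : i ≤ k) :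
    derivDist i (toDiff f) (toDiff g) ≤ ε := by
  cases i with
  | zero => exact supDist_le fun x => by simpa using h 0 hi x
  | succ i =>
    refine ciSup_le fun x => ?_
    rw [iteratedDeriv_someLift, iteratedDeriv_someLift]
    exact h _ hi x

lemma dk_le {k : ℕ} {ε : ℝ} {f g : SLift} (h : CkClose k ε f g) (h' : CkClose k ε f⁻¹ g⁻¹) :
    dk k (toDiff f) (toDiff g) ≤ ε := by
  refine max_le (ciSup_le fun i => derivDist_le h (by omega)) (ciSup_le fun i => ?_)
  rw [← map_inv, ← map_inv]
  exact derivDist_le h' (by omega)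

lemma derivDist_nonneg (i : ℕ) (f g : DiffPlus) : 0 ≤ derivDist i f g := by
  cases i with
  | zero => exact Real.iSup_nonneg fun _ => dist_nonneg
  | succ i => exact Real.iSup_nonneg fun _ => abs_nonneg _

lemma dk_nonneg (k : ℕ) (f g : DiffPlus) : 0 ≤ dk k f g :=
  le_max_of_le_left (Real.iSup_nonneg fun i => derivDist_nonneg i f g)

lemma tendsto_const_div_two_pow (c : ℝ) : Tendsto (fun m : ℕ => c / 2 ^ m) atTop (𝓝 0) := by
  have := (tendsto_pow_atTop_nhds_zero_of_lt_one (r := (1 / 2 : ℝ)) (by norm_num)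
    (by norm_num)).const_mul c
  simpa [div_eq_mul_inv] using this

lemma convergesDiff_of_ckClose {f : ℕ → SLift} {g : SLift} (c : ℝ)
    (h : ∀ m, CkClose (m + 1) (c / 2 ^ m) (f m) g)
    (h' : ∀ m, CkClose (m + 1) (c / 2 ^ m) (f m)⁻¹ g⁻¹) :
    ConvergesDiff (fun m => toDiff (f m)) (toDiff g) := by
  intro k
  refine squeeze_zero' (Eventually.of_forall fun m => dk_nonneg _ _ _) ?_
    (tendsto_const_div_two_pow c)
  filter_upwards [eventually_ge_atTop k] with m hm
  exact dk_le ((h m).mono (by omega) le_rfl) ((h' m).mono (by omega) le_rfl)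

/-! ### Convergence, continuity in the code, rotation number, smooth conjugacy -/

namespace Scheme

variable {ψ : ℝ → ℝ} {α : ℝ} (S : Scheme ψ α) (a b : ℕ+ → Bool)

lemma tendsto_d0 : Tendsto (fun m => d0 (toDiff (S.L a m)).1 (toHomeo (S.H a))) atTop (𝓝 0) := by
  refine squeeze_zero (fun m => ?_) (fun m => ?_) (tendsto_const_div_two_pow 1)
  · exact le_max_of_le_left (Real.iSup_nonneg fun _ => dist_nonneg)
  · refine max_le (supDist_le fun x => ?_) (supDist_le (f := (SLift.toC (S.L a m))⁻¹)
      (g := (S.H a)⁻¹) fun x => ?_)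
    · rw [abs_sub_comm]; exact S.abs_H_sub_le a m x
    · rw [abs_sub_comm]; exact S.abs_H_inv_sub_le a m x

lemma convergesDiff_conjL : ConvergesDiff (fun m => toDiff (conjL (S.L a m) α))
    (toDiff (S.T a)) :=
  convergesDiff_of_ckClose 2 (fun m => S.ckClose_T a m) (fun m => S.ckClose_T_inv a m)

lemma convergesDiff_rational : ConvergesDiff
    (fun m => toDiff (conjL (S.L a m) (S.p (m + 1) / S.q (m + 1)))) (toDiff (S.T a)) := by
  have e : ∀ m : ℕ, (1 : ℝ) / 2 ^ (m + 1) + 2 / 2 ^ m ≤ 3 / 2 ^ m := fun m => by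
    have : (1 : ℝ) / 2 ^ (m + 1) ≤ 1 / 2 ^ m :=
      one_div_le_one_div_of_le (by positivity) (pow_le_pow_right₀ (by norm_num) (by omega))
    calc _ ≤ (1 : ℝ) / 2 ^ m + 2 / 2 ^ m := by gcongr
      _ = _ := by ring
  exact convergesDiff_of_ckClose 3
    (fun m => ((S.ckClose_rational a m).1.trans (S.ckClose_T a m)).mono le_rfl (e m))
    (fun m => ((S.ckClose_rational a m).2.trans (S.ckClose_T_inv a m)).mono le_rfl (e m))

lemma L_congr {m : ℕ} (hab : ∀ i < m, a i.succPNat = b i.succPNat) : S.L a m = S.L b m := by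
  induction m with
  | zero => rfl
  | succ m ih =>
    rw [L_succ, L_succ, ih fun i hi => hab i (by omega), g, g, hab m (by omega)]

/-- A neighbourhood of `a` fixes the first `m` digits. Codes agreeing there share `L a m`, and both
limits are `2 / 2 ^ m`-close to its conjugate of the rotation. -/
lemma tendsto_dk (k : ℕ) :
    Tendsto (fun b => dk k (toDiff (S.T b)) (toDiff (S.T a))) (𝓝 a) (𝓝 0) := by
  rw [Metric.tendsto_nhds]
  intro ε hε
  obtain ⟨m, hm, hkm⟩ := (((tendsto_const_div_two_pow 4).eventually (gt_mem_nhds hε)).and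
    (eventually_ge_atTop k)).exists
  have h1 : ∀ i ∈ Finset.range m, ∀ᶠ b in 𝓝 a, b i.succPNat = a i.succPNat := fun i _ =>
    (continuous_apply (i.succPNat)).continuousAt.eventually
      (show ∀ᶠ y in 𝓝 (a i.succPNat), y = a i.succPNat by simp)
  filter_upwards [(Filter.eventually_all_finset _).2 h1] with b hb
  have hL : S.L b m = S.L a m := S.L_congr b a fun i hi => hb i (Finset.mem_range.2 hi)
  have e : (2 : ℝ) / 2 ^ m + 2 / 2 ^ m = 4 / 2 ^ m := by ring
  have c1 := S.ckClose_T b m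
  have c2 := S.ckClose_T_inv b m
  rw [hL] at c1 c2
  have c3 := (c1.symm.trans (S.ckClose_T a m)).mono (l := k) (by omega) e.le
  have c4 := (c2.symm.trans (S.ckClose_T_inv a m)).mono (l := k) (by omega) e.le
  rw [Real.dist_eq, sub_zero, abs_of_nonneg (dk_nonneg _ _ _)]
  exact (dk_le c3 c4).trans_lt hm

lemma tendsto_dInf :
    Tendsto (fun b => dInf (toDiff (S.T b)) (toDiff (S.T a))) (𝓝 a) (𝓝 0) := by
  have h0 : (0 : ℝ) = ∑' _ : ℕ, (0 : ℝ) := tsum_zero.symm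
  unfold dInf
  rw [h0]
  -- Each term of `d_∞` is at most `2^{-(k+1)}`, whatever the value of `d_{k+1}`.
  refine tendsto_tsum_of_dominated_convergence (bound := fun k => 1 / 2 / 2 ^ k)
    (summable_geometric_two' 1) (fun k => ?_) (Eventually.of_forall fun b k => ?_)
  · have h1 := S.tendsto_dk a (k + 1)
    have h2 := h1.div ((h1.const_add 1).const_mul ((2 : ℝ) ^ (k + 1)))
      (by rw [add_zero, mul_one]; positivity)
    rwa [zero_div] at h2
  · have h1 := dk_nonneg (k + 1) (toDiff (S.T b)) (toDiff (S.T a))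
    rw [Real.norm_eq_abs, abs_of_nonneg (by positivity), div_div, ← pow_succ',
      div_le_div_iff₀ (by positivity) (by positivity)]
    have : (0 : ℝ) < 2 ^ (k + 1) := by positivity
    nlinarith

lemma hasRotationNumber : HasRotationNumber (toDiff (S.T a)).1 (α : S1) := by
  refine ⟨deg1 (SLift.toC (S.T a)), isLift_deg1 _, ?_⟩
  let u : CircleDeg1Liftˣ := ⟨deg1 (S.H a), deg1 (S.H a)⁻¹,
    CircleDeg1Lift.ext fun x => RelIso.apply_inv_self _ x,
    CircleDeg1Lift.ext fun x => RelIso.inv_apply_self _ x⟩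
  have h : deg1 (SLift.toC (S.T a)) =
      u * (CircleDeg1Lift.translate (Multiplicative.ofAdd α)) * (u⁻¹ : CircleDeg1Liftˣ) :=
    CircleDeg1Lift.ext fun x => by
      change (S.H a).1 (((S.H a)⁻¹).1 x + α) = (S.H a).1 (α + ((S.H a)⁻¹).1 x)
      rw [add_comm]
  rw [h, CircleDeg1Lift.translationNumber_conj_eq, CircleDeg1Lift.translationNumber_translate]

lemma partial_congr {N : ℕ} (hab : ∀ i ≥ N, a i.succPNat = b i.succPNat) (j : ℕ) :
    S.L a (N + j) = S.L a N * (S.L b N)⁻¹ * S.L b (N + j) := by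
  induction j with
  | zero => simp
  | succ j ih =>
    rw [← add_assoc, L_succ, L_succ, ih, g, g, hab (N + j) (by omega), mul_assoc]

/-- From step `N` on both codes compose the same factors, so the two limits differ by a smooth map
on the left, which is then the smooth conjugacy. -/
lemma H_congr {N : ℕ} (hab : ∀ i ≥ N, a i.succPNat = b i.succPNat) :
    S.H a = SLift.toC (S.L a N * (S.L b N)⁻¹) * S.H b := by
  apply Subtype.ext
  apply RelIso.ext
  intro x
  have h1 : ∀ c : ℕ+ → Bool, Tendsto (fun j => (S.L c (N + j)).1 x) atTop (𝓝 ((S.H c).1 x)) :=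
    fun c => ((tendsto_add_atTop_iff_nat N).2 (S.tendsto_L c x)).congr fun j => by rw [add_comm]
  refine tendsto_nhds_unique (h1 a) ?_
  have h2 := ((S.L a N * (S.L b N)⁻¹).1.continuous.tendsto _).comp (h1 b)
  refine h2.congr fun j => ?_
  rw [S.partial_congr a b hab j]
  rfl

lemma smoothConj (hab : ∃ N, ∀ n ≥ N, a n = b n) :
    SmoothConj (toDiff (S.T a)) (toDiff (S.T b)) := by
  obtain ⟨N, hN⟩ := hab
  have hab : ∀ i ≥ (N : ℕ), a i.succPNat = b i.succPNat := fun i hi =>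
    hN _ (by rw [ge_iff_le, ← PNat.coe_le_coe, Nat.succPNat_coe]; omega)
  have h := S.H_congr a b hab
  refine ⟨toDiff (S.L a N * (S.L b N)⁻¹), ?_⟩
  rw [← map_inv, ← map_mul, ← map_mul]
  congr 1
  have h2 : SLift.toC (S.T a) = SLift.toC (S.L a N * (S.L b N)⁻¹ * S.T b *
      (S.L a N * (S.L b N)⁻¹)⁻¹) := by
    rw [map_mul, map_mul _ _ (S.T b), map_inv, toC_T, toC_T, h]
    group
  exact Subtype.ext (congrArg (fun f : CLift => f.1) h2)

end Scheme

/-! ### The centralizer of an irrational rotation -/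

/-- The displacement `f x - x` is continuous and invariant under a rotation with dense orbits, hence
constant. -/
lemma exists_eq_add_of_commute {α : ℝ} (hα : Irrational α) (f : S1 ≃ₜ S1)
    (hf : ∀ x, f (x + (α : S1)) = f x + (α : S1)) : ∃ β : ℝ, ∀ x, f x = x + (β : S1) := by
  have hc : Continuous fun x => f x - x := f.continuous.sub continuous_id
  have hper : Function.Periodic (fun x => f x - x) (α : S1) := fun x => by
    change f (x + (α : S1)) - (x + (α : S1)) = f x - x
    rw [hf]; abel
  have hd : DenseRange ((· • (α : S1)) : ℤ → S1) :=
    AddCircle.denseRange_zsmul_coe_iff.2 (by simpa using hα)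
  obtain ⟨β, hβ⟩ := QuotientAddGroup.mk_surjective (f 0)
  have h : (fun x => f x - x) = fun _ => (β : S1) := by
    refine Continuous.ext_on hd hc continuous_const ?_
    rintro _ ⟨n, rfl⟩
    have := hper.zsmul n 0
    simp only [zero_add, sub_zero] at this
    exact this.trans hβ.symm
  refine ⟨β, fun x => ?_⟩
  rw [← congrFun h x]
  abel

/-! ### Expansion at a small scale -/

section Expansion

variable {ψ : ℝ → ℝ} {t M β : ℝ}

/-- `h` is, in rescaled coordinates, a conjugation map of the construction with period `M`. -/
structure IsModel (ψ : ℝ → ℝ) (t M : ℝ) (h : ℝ ≃o ℝ) : Prop where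
  step : IsStep ψ
  pos : 0 < t
  small : t < 1 / 10000
  four_le : 4 ≤ M
  eq : ∀ z, -2 < z → z < M → h z = hSm ψ t z
  add_mul : ∀ z (k : ℤ), h (z + k * M) = h z + k * M

variable {h : ℝ ≃o ℝ}

lemma IsModel.lt (H : IsModel ψ t M h) : t < 1 / 10 := H.small.trans (by norm_num)

lemma IsModel.of_le (H : IsModel ψ t M h) {z : ℝ} (h1 : -2 < z) (h2 : z ≤ t) : h z = z := by
  have := H.small; have := H.four_le
  rw [H.eq z h1 (by linarith), hSm_of_le H.step H.pos H.lt h2]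

lemma IsModel.of_ge (H : IsModel ψ t M h) {z : ℝ} (h1 : 1 - t ≤ z) (h2 : z < M) : h z = z := by
  have := H.small
  rw [H.eq z (by linarith) h2, hSm_of_ge H.step H.pos H.lt h1]

lemma IsModel.sq_lt (H : IsModel ψ t M h) : 0 < t ^ 2 ∧ t ^ 2 < t / 10000 := by
  have := H.small; have := H.pos
  constructor <;> nlinarith

lemma IsModel.left (H : IsModel ψ t M h) {z : ℝ} (h1 : 2 * t ≤ z)
    (h2 : z ≤ (1 - t + 8 * t ^ 2) / 2) : h z = t * (z - 1 / 4) + 3 * t := by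
  have := H.small; have := H.four_le; have := H.sq_lt; have := H.pos
  rw [H.eq z (by linarith) (by linarith), hSm_left H.step H.pos H.lt h1 h2]

lemma IsModel.right (H : IsModel ψ t M h) {z : ℝ} (h1 : (1 + t - 8 * t ^ 2) / 2 ≤ z)
    (h2 : z ≤ 1 - 2 * t) : h z = t * (z - 3 / 4) + 1 - 3 * t := by
  have := H.small; have := H.four_le; have := H.sq_lt; have := H.pos
  rw [H.eq z (by linarith) (by linarith), hSm_right H.step H.pos H.lt h1 h2]

lemma IsModel.middle (H : IsModel ψ t M h) {z : ℝ} (h1 : (1 - t + 10 * t ^ 2) / 2 ≤ z)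
    (h2 : z ≤ (1 + t - 10 * t ^ 2) / 2) : h z = t⁻¹ * (z - 1 / 2) + 1 / 2 := by
  have := H.small; have := H.four_le; have := H.sq_lt; have := H.pos
  rw [H.eq z (by linarith) (by linarith), hSm_middle H.step H.pos H.lt h1 h2]

lemma inv_mul_mem_Icc {d : ℝ} (ht : 0 < t) (h1 : t / 10 ≤ d) (h2 : d ≤ t) :
    1 / 10 ≤ t⁻¹ * d ∧ t⁻¹ * d ≤ 1 := by
  rw [inv_mul_eq_div]
  exact ⟨by rw [le_div_iff₀ ht]; linarith, by rw [div_le_one ht]; exact h2⟩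

/-- Near a point, a perturbed translation looks like a translation. -/
lemma abs_perturbation_le {τ : ℝ ≃o ℝ} {ε w c : ℝ} (hτ : ∀ z, |τ z - z - β| ≤ ε) (hw : τ w = c)
    (s : ℝ) : |τ (w + s) - c - s| ≤ 2 * ε := by
  have h1 := abs_le.1 (hτ w)
  have h2 := abs_le.1 (hτ (w + s))
  rw [hw] at h1
  rw [abs_le]
  constructor <;> linarith

/-- The outer `h` stretches by `t⁻¹` around `1/2`, so an interval of length `t / 5` near `w`, which
`τ` carries close to `1/2`, ends with length about `1/5`. It remains to place it so that its
preimage under the inner `h` is short. -/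
lemma IsModel.exists_expand_aux (H : IsModel ψ t M h) {τ : ℝ ≃o ℝ}
    (hτ : ∀ z, |τ z - z - β| ≤ t / 1000) {w : ℝ} (hw : τ w = 1 / 2) (hw1 : -1 ≤ w)
    (hw2 : w < M - 1) :
    ∃ x y, x < y ∧ y - x ≤ 4 * t ∧ 1 / 10 ≤ h (τ (h y)) - h (τ (h x)) ∧
      h (τ (h y)) - h (τ (h x)) ≤ 1 := by
  obtain ⟨sq0, sq1⟩ := H.sq_lt
  have ht := H.pos
  have hs := H.small
  have hM := H.four_le
  -- The inverse of `h` stretches strongly only near `3 t` and `1 - 3 t`, on windows of half-width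
  -- about `t / 4` (the images of the flat branches). The shift `-(9/20) t` puts the interval to the
  -- left of the window and `t / 4` to its right, and for both the outer map still acts on its steep
  -- affine piece.
  obtain ⟨s, s1, s2, hs'⟩ : ∃ s, -(9 / 20 * t) ≤ s ∧ s ≤ 1 / 4 * t ∧
      h.symm (w + (s + t / 5)) - h.symm (w + s) ≤ 4 * t := by
    have lef : ∀ {x y : ℝ}, y ≤ h x → h.symm y ≤ x := fun hxy => (h.symm_apply_le).2 hxy
    have leg : ∀ {x y : ℝ}, h x ≤ y → x ≤ h.symm y := fun hxy => (h.le_symm_apply).2 hxy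
    have eL := H.left (z := 2 * t) le_rfl (by linarith)
    have eL' := H.left (z := (1 - t + 8 * t ^ 2) / 2) (by linarith) le_rfl
    have eR := H.right (z := 1 - 2 * t) (by linarith) le_rfl
    have eR' := H.right (z := (1 + t - 8 * t ^ 2) / 2) le_rfl (by linarith)
    rcases le_total w (3 * t) with c1 | c1
    · refine ⟨-(9 / 20 * t), le_rfl, by linarith, ?_⟩
      have hx := leg (x := min (w + -(9 / 20 * t)) 0) (y := w + -(9 / 20 * t)) (by
        rw [H.of_le (lt_min (by linarith) (by norm_num))
          ((min_le_right _ _).trans ht.le)]; exact min_le_left _ _)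
      rcases le_total w 0 with c0 | c0
      · have e0 := H.of_le (z := w + (-(9 / 20 * t) + t / 5)) (by linarith) (by linarith)
        have := lef e0.ge
        rw [min_eq_left (by linarith)] at hx
        linarith
      · have := lef (x := 2 * t) (y := w + (-(9 / 20 * t) + t / 5)) (by rw [eL]; nlinarith)
        have h3 : -t ≤ min (w + -(9 / 20 * t)) 0 := le_min (by linarith) (by linarith)
        linarith
    · rcases le_total w (1 / 2) with c2 | c2
      · refine ⟨1 / 4 * t, by linarith, le_rfl, ?_⟩
        have a1 := leg (x := (1 - t + 8 * t ^ 2) / 2) (y := w + 1 / 4 * t) (by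
          rw [eL']; nlinarith)
        have a2 := lef (x := (1 + t - 8 * t ^ 2) / 2) (y := w + (1 / 4 * t + t / 5)) (by
          rw [eR']; nlinarith)
        linarith
      · rcases le_total w (1 - 3 * t) with c3 | c3
        · refine ⟨-(9 / 20 * t), le_rfl, by linarith, ?_⟩
          have a1 := leg (x := (1 - t + 8 * t ^ 2) / 2) (y := w + -(9 / 20 * t)) (by
            rw [eL']; nlinarith)
          have a2 := lef (x := (1 + t - 8 * t ^ 2) / 2) (y := w + (-(9 / 20 * t) + t / 5)) (by
            rw [eR']; nlinarith)
          linarith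
        · refine ⟨1 / 4 * t, by linarith, le_rfl, ?_⟩
          have hx := lef (x := max (w + (1 / 4 * t + t / 5)) 1) (y := w + (1 / 4 * t + t / 5)) (by
            rw [H.of_ge (le_trans (by linarith) (le_max_right _ _))
              (max_lt (by linarith) (by linarith))]; exact le_max_left _ _)
          rcases le_total w 1 with c4 | c4
          · have := leg (x := 1 - 2 * t) (y := w + 1 / 4 * t) (by rw [eR]; nlinarith)
            have h3 : max (w + (1 / 4 * t + t / 5)) 1 ≤ 1 + t := max_le (by linarith) (by linarith)
            linarith
          · have := leg (H.of_ge (z := w + 1 / 4 * t) (by linarith) (by linarith)).le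
            rw [max_eq_left (by linarith)] at hx
            linarith
  refine ⟨h.symm (w + s), h.symm (w + (s + t / 5)), h.symm.strictMono (by linarith), hs', ?_⟩
  rw [h.apply_symm_apply, h.apply_symm_apply]
  have b1 := abs_le.1 (abs_perturbation_le hτ hw s)
  have b2 := abs_le.1 (abs_perturbation_le hτ hw (s + t / 5))
  rw [H.middle (z := τ (w + s)) (by linarith) (by linarith),
    H.middle (z := τ (w + (s + t / 5))) (by linarith) (by linarith)]
  have e : t⁻¹ * (τ (w + (s + t / 5)) - 1 / 2) + 1 / 2 - (t⁻¹ * (τ (w + s) - 1 / 2) + 1 / 2) =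
      t⁻¹ * (τ (w + (s + t / 5)) - τ (w + s)) := by ring
  rw [e]
  exact inv_mul_mem_Icc ht (by linarith) (by linarith)

/-- The outer `h⁻¹` stretches by `t⁻¹` near two targets, `3 t` and `1 - 3 t`. The inner `h⁻¹` is
undone by choosing endpoints `h (v ± t / 10)`, which are close unless `v` lies near `1/2`, where `h`
is steep. -/
lemma IsModel.exists_expand_symm_aux (H : IsModel ψ t M h) {τ : ℝ ≃o ℝ}
    (hτ : ∀ z, |τ z - z - β| ≤ t / 1000) {w : ℝ} (hw : τ w = 3 * t) (hw1 : -1 ≤ w)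
    (hw2 : w < M - 1) :
    ∃ x y, x < y ∧ y - x ≤ 4 * t ∧ 1 / 10 ≤ h.symm (τ (h.symm y)) - h.symm (τ (h.symm x)) ∧
      h.symm (τ (h.symm y)) - h.symm (τ (h.symm x)) ≤ 1 := by
  obtain ⟨sq0, sq1⟩ := H.sq_lt
  have ht := H.pos
  have hs := H.small
  have hM := H.four_le
  have hti : t⁻¹ * t = 1 := inv_mul_cancel₀ ht.ne'
  have hip := inv_pos.2 ht
  have key : ∀ v c d : ℝ, τ v = c → (∀ z, |z - c| ≤ t / 5 → h.symm z = t⁻¹ * (z - c) + d) →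
      h (v + t / 10) - h (v + -(t / 10)) ≤ 4 * t →
      ∃ x y, x < y ∧ y - x ≤ 4 * t ∧
        1 / 10 ≤ h.symm (τ (h.symm y)) - h.symm (τ (h.symm x)) ∧
        h.symm (τ (h.symm y)) - h.symm (τ (h.symm x)) ≤ 1 := by
    intro v c d hv hc hle
    refine ⟨h (v + -(t / 10)), h (v + t / 10), h.strictMono (by linarith), hle, ?_⟩
    rw [h.symm_apply_apply, h.symm_apply_apply]
    have b1 := abs_le.1 (abs_perturbation_le hτ hv (-(t / 10)))
    have b2 := abs_le.1 (abs_perturbation_le hτ hv (t / 10))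
    rw [hc _ (abs_le.2 ⟨by linarith, by linarith⟩), hc _ (abs_le.2 ⟨by linarith, by linarith⟩)]
    have e : t⁻¹ * (τ (v + t / 10) - c) + d - (t⁻¹ * (τ (v + -(t / 10)) - c) + d) =
        t⁻¹ * (τ (v + t / 10) - τ (v + -(t / 10))) := by ring
    rw [e]
    exact inv_mul_mem_Icc ht (by linarith) (by linarith)
  have small : ∀ e : ℝ, |e| ≤ t / 5 → |t⁻¹ * e| ≤ 1 / 5 := fun e he => by
    rw [abs_mul, abs_of_pos hip, inv_mul_le_iff₀ ht]; linarith
  have kL : ∀ z, |z - 3 * t| ≤ t / 5 → h.symm z = t⁻¹ * (z - 3 * t) + 1 / 4 := by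
    intro z hz
    have := abs_le.1 (small _ hz)
    rw [h.symm_apply_eq, H.left (by linarith) (by linarith), add_sub_cancel_right, ← mul_assoc,
      mul_comm t, hti]
    ring
  have kR : ∀ z, |z - (1 - 3 * t)| ≤ t / 5 →
      h.symm z = t⁻¹ * (z - (1 - 3 * t)) + 3 / 4 := by
    intro z hz
    have := abs_le.1 (small _ hz)
    rw [h.symm_apply_eq, H.right (by linarith) (by linarith), add_sub_cancel_right, ← mul_assoc,
      mul_comm t, hti]
    ring
  have eL := H.left (z := (1 - t + 8 * t ^ 2) / 2) (by linarith) le_rfl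
  have eR := H.right (z := (1 + t - 8 * t ^ 2) / 2) le_rfl (by linarith)
  have mono := h.monotone
  rcases le_total w (1 / 4) with c1 | c1
  · refine key w _ _ hw kL ?_
    rcases le_total (w + t / 10) t with c2 | c2
    · rw [H.of_le (by linarith) c2, H.of_le (by linarith) (by linarith)]
      linarith
    · have a1 := mono (show w + t / 10 ≤ (1 - t + 8 * t ^ 2) / 2 by linarith)
      have a2 := mono (show 0 ≤ w + -(t / 10) by linarith)
      rw [H.of_le (by norm_num) ht.le] at a2
      nlinarith
  · rcases le_total (3 / 4) w with c2 | c2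
    · refine key w _ _ hw kL ?_
      rcases le_total (1 - t) (w + -(t / 10)) with c3 | c3
      · rw [H.of_ge c3 (by linarith), H.of_ge (by linarith) (by linarith)]
        linarith
      · have a1 := mono (show (1 + t - 8 * t ^ 2) / 2 ≤ w + -(t / 10) by linarith)
        have a2 := mono (show w + t / 10 ≤ 1 by linarith)
        rw [H.of_ge (z := 1) (by linarith) (by linarith)] at a2
        nlinarith
    -- If `w` is too close to `1/2`, the other target is used. Its preimage lies almost one unit
    -- further right, beyond `1` and before the next period since `4 ≤ M`, and there `h` is the
    -- identity.
    · have hv : τ (τ.symm (1 - 3 * t)) = 1 - 3 * t := τ.apply_symm_apply _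
      have b1 := abs_le.1 (hτ w)
      have b2 := abs_le.1 (hτ (τ.symm (1 - 3 * t)))
      rw [hw] at b1
      rw [hv] at b2
      refine key _ _ _ hv kR ?_
      rw [H.of_ge (by linarith) (by linarith), H.of_ge (by linarith) (by linarith)]
      linarith

/-- Moving a point into a fundamental domain. -/
lemma exists_shift {τ : ℝ ≃o ℝ} {ε : ℝ} (hM : 0 < M) (hτ : ∀ z, |τ z - z - β| ≤ ε) (c : ℝ) :
    ∃ (k : ℤ) (τ' : ℝ ≃o ℝ) (β' w : ℝ), (∀ z, τ' z = τ (z + k * M)) ∧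
      (∀ z, |τ' z - z - β'| ≤ ε) ∧ τ' w = c ∧ -1 ≤ w ∧ w < M - 1 := by
  set k : ℤ := ⌊(τ.symm c + 1) / M⌋
  have h1 : (k : ℝ) * M ≤ τ.symm c + 1 := (le_div_iff₀ hM).1 (Int.floor_le _)
  have h2 : τ.symm c + 1 < (k + 1) * M := (div_lt_iff₀ hM).1 (Int.lt_floor_add_one _)
  refine ⟨k, (OrderIso.addRight (k * M)).trans τ, β + k * M, τ.symm c - k * M, fun z => rfl,
    fun z => ?_, ?_, by linarith, by linarith⟩
  · have := hτ (z + k * M)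
    change |τ (z + k * M) - z - (β + k * M)| ≤ ε
    convert this using 2
    ring
  · change τ (τ.symm c - k * M + k * M) = c
    rw [sub_add_cancel, τ.apply_symm_apply]

lemma IsModel.symm_add_mul (H : IsModel ψ t M h) (z : ℝ) (k : ℤ) :
    h.symm (z + k * M) = h.symm z + k * M := by
  rw [h.symm_apply_eq, H.add_mul, h.apply_symm_apply]

/-- Two very close points that are moved far apart by `f ∘ τ ∘ f`, where `f` is a model map or the
inverse of a model map and `τ` is almost a translation. -/
lemma IsModel.exists_expand (H : IsModel ψ t M h) {τ : ℝ ≃o ℝ}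
    (hτ : ∀ z, |τ z - z - β| ≤ t / 1000) {f : ℝ ≃o ℝ} (hf : f = h ∨ f = h.symm) :
    ∃ x y, x < y ∧ y - x ≤ 4 * t ∧ 1 / 10 ≤ f (τ (f y)) - f (τ (f x)) ∧
      f (τ (f y)) - f (τ (f x)) ≤ 1 := by
  have hM : 0 < M := by have := H.four_le; linarith
  have fin : ∀ (k : ℤ) (τ' : ℝ ≃o ℝ), (∀ z, τ' z = τ (z + k * M)) →
      (∀ z, f (z + k * M) = f z + k * M) →
      (∃ x y, x < y ∧ y - x ≤ 4 * t ∧ 1 / 10 ≤ f (τ' (f y)) - f (τ' (f x)) ∧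
        f (τ' (f y)) - f (τ' (f x)) ≤ 1) →
      ∃ x y, x < y ∧ y - x ≤ 4 * t ∧ 1 / 10 ≤ f (τ (f y)) - f (τ (f x)) ∧
        f (τ (f y)) - f (τ (f x)) ≤ 1 := by
    rintro k τ' h1 h2 ⟨x, y, hxy, h3, h4⟩
    refine ⟨x + k * M, y + k * M, by linarith, by linarith, ?_⟩
    rw [h2, h2, ← h1, ← h1]
    exact h4
  rcases hf with rfl | rfl
  · obtain ⟨k, τ', β', w, e1, e2, e3, e4, e5⟩ := exists_shift hM hτ (1 / 2)
    exact fin k τ' e1 (fun z => H.add_mul z k) (H.exists_expand_aux e2 e3 e4 e5)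
  · obtain ⟨k, τ', β', w, e1, e2, e3, e4, e5⟩ := exists_shift hM hτ (3 * t)
    exact fin k τ' e1 (fun z => H.symm_add_mul z k) (H.exists_expand_symm_aux e2 e3 e4 e5)

end Expansion

/-! ### Rescaling -/

/-- Conjugation by `x ↦ c * x`. -/
def rescale (c : ℝ) (hc : 0 < c) : (ℝ ≃o ℝ) →* (ℝ ≃o ℝ) :=
  (MulAut.conj (OrderIso.mulLeft₀ c hc : ℝ ≃o ℝ)).toMonoidHom

lemma rescale_apply {c : ℝ} (hc : 0 < c) (f : ℝ ≃o ℝ) (z : ℝ) :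
    rescale c hc f z = c * f (c⁻¹ * z) := by
  have h : (OrderIso.mulLeft₀ c hc : ℝ ≃o ℝ)⁻¹ z = c⁻¹ * z := by
    apply (OrderIso.mulLeft₀ c hc : ℝ ≃o ℝ).injective
    rw [RelIso.apply_inv_self, OrderIso.mulLeft₀_apply, mul_inv_cancel_left₀ hc.ne']
  change c * f ((OrderIso.mulLeft₀ c hc : ℝ ≃o ℝ)⁻¹ z) = _
  rw [h]

lemma rescale_perturbation {c : ℝ} (hc : 0 < c) {τ : ℝ ≃o ℝ} {β ε : ℝ}
    (h : ∀ x, |τ x - x - β| ≤ ε) (z : ℝ) : |rescale c hc τ z - z - c * β| ≤ c * ε := by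
  have e : rescale c hc τ z - z - c * β = c * (τ (c⁻¹ * z) - c⁻¹ * z - β) := by
    rw [rescale_apply]; field_simp
  rw [e, abs_mul, abs_of_pos hc]
  exact mul_le_mul_of_nonneg_left (h _) hc.le

/-- In the coordinate `z = 2^(n+1) q x` the profile fills `[0, 1]` and the period `1 / q` becomes
`2^(n+1)`, so the map is the identity on most of each period. -/
lemma isModel_rescale {ψ : ℝ → ℝ} (hψ : IsStep ψ) {n q : ℕ} (hn : 0 < n) (hq : 10000 < q)
    (hc : (0 : ℝ) < 2 ^ (n + 1) * q) :
    IsModel ψ (tParam n q) (2 ^ (n + 1)) (rescale _ hc (hL ψ n q).1) := by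
  have hq' : 10 < q := by omega
  have hq0 : (0 : ℝ) < q := by exact_mod_cast (by omega : 0 < q)
  have h2n : (0 : ℝ) < 2 ^ (n + 1) := by positivity
  have h4 : (4 : ℝ) ≤ 2 ^ (n + 1) := by
    calc (4 : ℝ) = 2 ^ 2 := by norm_num
      _ ≤ 2 ^ (n + 1) := pow_le_pow_right₀ (by norm_num) (by omega)
  refine ⟨hψ, tParam_pos hn hq', ?_, h4, fun z h1 h2 => ?_, fun z k => ?_⟩
  · have h : (10000 : ℝ) < q := by exact_mod_cast hq
    rw [tParam_eq hn, one_div]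
    apply inv_strictAnti₀ (by norm_num)
    calc (10000 : ℝ) < q := h
      _ ≤ (q : ℝ) ^ (2 * n - 1) := le_self_pow₀ (by linarith) (by omega)
  · have e : (q : ℝ) * (((2 : ℝ) ^ (n + 1) * q)⁻¹ * z) - (0 : ℤ) = z / 2 ^ (n + 1) := by
      push_cast; field_simp; ring
    rw [rescale_apply, hL_apply hψ hn hq' _ 0 (by rw [e, lt_div_iff₀ h2n]; linarith)
      (by rw [e, div_lt_one h2n]; exact h2), hLoc]
    simp only [Int.cast_zero, zero_div, zero_add, sub_zero]
    rw [mul_inv_cancel_left₀ hc.ne', mul_inv_cancel_left₀ hc.ne']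
  · have e : ((2 : ℝ) ^ (n + 1) * q)⁻¹ * (z + k * 2 ^ (n + 1)) =
        ((2 : ℝ) ^ (n + 1) * q)⁻¹ * z + k / q := by field_simp
    rw [rescale_apply, rescale_apply, e, hL_add_div hψ hn hq']
    field_simp

/-! ### Expansion of conjugacies between the limits, and dependence on the code -/

namespace Scheme

variable {ψ : ℝ → ℝ} {α : ℝ} (S : Scheme ψ α) (a b : ℕ+ → Bool) (m : ℕ)

lemma large : 10000 < S.q (m + 1) := by
  have h1 := S.q_ge_pow m
  have h2 : 2 ^ 20 ≤ 2 ^ (m + 20) := Nat.pow_le_pow_right (by norm_num) (by omega)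
  omega

lemma scale_pos : (0 : ℝ) < 2 ^ (m + 1 + 1) * S.q (m + 1) := by
  have := S.q_pos m
  positivity

/-- The conjugation map of step `m + 1` in rescaled coordinates. -/
def model : ℝ ≃o ℝ := rescale _ (S.scale_pos m) (hL ψ (m + 1) (S.q (m + 1))).1

lemma isModel : IsModel ψ (tParam (m + 1) (S.q (m + 1))) (2 ^ (m + 1 + 1)) (S.model m) :=
  isModel_rescale S.step (Nat.succ_pos m) (S.large m) _

/-- This makes the later factors invisible at the finest scale of step `m + 1`: the growth of `q
(m+2)` beats both the rescaling factor and `t⁻¹ = q (m+1) ^ (2m+1)`. -/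
lemma scale_mul_le : (2 : ℝ) ^ (m + 1 + 1) * S.q (m + 1) * (4 / S.q (m + 2)) ≤
    tParam (m + 1) (S.q (m + 1)) / 1000 := by
  have h0 := S.q_pos m
  have h1 := S.q_pos (m + 1)
  have h2 : (2 : ℝ) ^ (m + 1 + 20) * S.q (m + 1) ^ (2 * (m + 1)) ≤ S.q (m + 2) := by
    exact_mod_cast S.q_ge_mul (m + 1)
  rw [tParam_eq (Nat.succ_pos m), show 2 * (m + 1) - 1 = 2 * m + 1 by omega, mul_div_assoc',
    div_le_div_iff₀ h1 (by norm_num)]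
  have h3 : ((S.q (m + 1) : ℝ) ^ (2 * m + 1))⁻¹ *
      ((2 : ℝ) ^ (m + 1 + 20) * S.q (m + 1) ^ (2 * (m + 1))) =
      2 ^ (m + 1 + 20) * S.q (m + 1) := by
    rw [show 2 * (m + 1) = 2 * m + 1 + 1 by ring, pow_succ _ (2 * m + 1)]
    field_simp
  have h4 := mul_le_mul_of_nonneg_left h2
    (by positivity : 0 ≤ ((S.q (m + 1) : ℝ) ^ (2 * m + 1))⁻¹)
  rw [h3] at h4
  refine le_trans ?_ h4
  have e1 : (2 : ℝ) ^ (m + 1 + 1) = 4 * 2 ^ m := by rw [pow_add, pow_add]; ring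
  have e2 : (2 : ℝ) ^ (m + 1 + 20) = 2097152 * 2 ^ m := by rw [pow_add, pow_add]; ring
  rw [e1, e2]
  have h5 : (0 : ℝ) < 2 ^ m * S.q (m + 1) := by positivity
  nlinarith

lemma abs_tail_conj_le (β x : ℝ) :
    |(S.tail a (m + 1) * SLift.toC (trL β) * (S.tail b (m + 1))⁻¹).1 x - x - β| ≤
      4 / S.q (m + 2) := by
  have h1 := abs_le.1 (S.abs_tail_inv_sub_le b (m + 1) x)
  have h2 := abs_le.1 (S.abs_tail_sub_le a (m + 1) (((S.tail b (m + 1))⁻¹).1 x + β))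
  have e : (4 : ℝ) / S.q (m + 2) = 2 / S.q (m + 2) + 2 / S.q (m + 2) := by ring
  change |(S.tail a (m + 1)).1 (((S.tail b (m + 1))⁻¹).1 x + β) - x - β| ≤ _
  rw [e, abs_le]
  constructor <;> linarith

lemma g_inv_of_ne (hab : a m.succPNat ≠ b m.succPNat) : (S.g b m)⁻¹ = S.g a m := by
  unfold g
  cases ha : a m.succPNat <;> cases hb : b m.succPNat <;> simp_all

lemma rescale_g : rescale _ (S.scale_pos m) (S.g a m).1 = S.model m ∨
    rescale _ (S.scale_pos m) (S.g a m).1 = (S.model m).symm := by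
  rcases S.g_eq a m with h | h <;> rw [h]
  · exact Or.inl rfl
  · exact Or.inr (map_inv (rescale _ (S.scale_pos m)) _)

/-- A conjugacy between two limits expands at the scale of each step where the codes differ. -/
lemma exists_expand (hab : a m.succPNat ≠ b m.succPNat) (β : ℝ) :
    ∃ X Y : ℝ, X < Y ∧ Y - X ≤ tParam (m + 1) (S.q (m + 1)) ∧
      1 / (20 * (S.q (m + 1) : ℝ) ^ 2) ≤
        (S.H a * SLift.toC (trL β) * (S.H b)⁻¹).1 Y - (S.H a * SLift.toC (trL β) * (S.H b)⁻¹).1 X ∧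
      (S.H a * SLift.toC (trL β) * (S.H b)⁻¹).1 Y - (S.H a * SLift.toC (trL β) * (S.H b)⁻¹).1 X
        ≤ 1 / 2 := by
  set c : ℝ := 2 ^ (m + 1 + 1) * S.q (m + 1) with hcdef
  have hc : 0 < c := S.scale_pos m
  have hq := S.q_pos m
  set τ : CLift := S.tail a (m + 1) * SLift.toC (trL β) * (S.tail b (m + 1))⁻¹ with hτdef
  have hτ : ∀ z, |rescale c hc τ.1 z - z - c * β| ≤ tParam (m + 1) (S.q (m + 1)) / 1000 :=
    fun z => (rescale_perturbation hc (S.abs_tail_conj_le a b m β) z).trans (S.scale_mul_le m)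
  obtain ⟨x, y, hxy, h3, h4, h5⟩ := (S.isModel m).exists_expand hτ (S.rescale_g a m)
  -- Since the digits differ, the inverse of the `b`-factor is the `a`-factor, so the same map
  -- stands on both sides of `τ`.
  have hK : S.H a * SLift.toC (trL β) * (S.H b)⁻¹ = SLift.toC (S.L a m) * (SLift.toC (S.g a m) * τ *
      SLift.toC (S.g a m)) * (SLift.toC (S.L b m))⁻¹ := by
    rw [S.H_eq_mul_tail a m, S.H_eq_mul_tail b m, S.g_mul_tail a m, S.g_mul_tail b m, hτdef,
      ← S.g_inv_of_ne a b m hab, map_inv]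
    group
  set F : ℝ → ℝ := fun z => (S.g a m).1 (τ.1 ((S.g a m).1 (c⁻¹ * z))) with hF
  have hKF : ∀ z, (S.H a * SLift.toC (trL β) * (S.H b)⁻¹).1 ((S.L b m).1 (c⁻¹ * z)) =
      (S.L a m).1 (F z) := by
    intro z
    rw [hK]
    change (S.L a m).1 ((S.g a m).1 (τ.1 ((S.g a m).1 (((S.L b m)⁻¹).1 ((S.L b m).1 (c⁻¹ * z)))))) = _
    rw [show ((S.L b m)⁻¹).1 ((S.L b m).1 (c⁻¹ * z)) = c⁻¹ * z from RelIso.inv_apply_self _ _]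
  have hres : ∀ z, rescale c hc (S.g a m).1 (rescale c hc τ.1 (rescale c hc (S.g a m).1 z)) =
      c * F z := by
    intro z
    rw [rescale_apply, rescale_apply, rescale_apply, inv_mul_cancel_left₀ hc.ne',
      inv_mul_cancel_left₀ hc.ne']
  rw [hres, hres] at h4 h5
  have hxy' : c⁻¹ * x < c⁻¹ * y := mul_lt_mul_of_pos_left hxy (inv_pos.2 hc)
  have hFxy : F x < F y := by
    have : 0 < c * (F y - F x) := by linarith
    linarith [(pos_iff_pos_of_mul_pos this).1 hc]
  -- The Lipschitz constant of step `m + 1` in units of the rescaling factor `c`. It turns `4 t`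
  -- into at most `t` for the source, and `1` into at most `1/2` for the image.
  have hLc : 1 / 2 ^ (m + 1) * (S.q (m + 1) : ℝ) = c / (8 * 2 ^ (2 * m)) := by
    rw [hcdef, pow_add, pow_add, pow_mul']; field_simp; ring
  have hone : (1 : ℝ) ≤ 2 ^ (2 * m) := one_le_pow₀ (by norm_num)
  refine ⟨(S.L b m).1 (c⁻¹ * x), (S.L b m).1 (c⁻¹ * y), (S.L b m).1.strictMono hxy', ?_, ?_, ?_⟩
  · have h6 := (le_abs_self _).trans
      ((S.good m).lip _ (S.L_mem b m) (c⁻¹ * y) (c⁻¹ * x))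
    rw [← mul_sub, abs_of_pos (by rw [mul_sub]; linarith)] at h6
    refine h6.trans ?_
    rw [hLc]
    calc c / (8 * 2 ^ (2 * m)) * (c⁻¹ * (y - x)) = (y - x) / (8 * 2 ^ (2 * m)) := by field_simp
      _ ≤ (y - x) / 8 := by
        apply div_le_div_of_nonneg_left (by linarith) (by norm_num) (by linarith)
      _ ≤ _ := by linarith [(S.isModel m).pos]
  · rw [hKF, hKF]
    have h6 := (le_abs_self _).trans
      ((S.good m).lip_inv _ (S.L_mem a m) ((S.L a m).1 (F y)) ((S.L a m).1 (F x)))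
    have h7 := (S.L a m).1.strictMono hFxy
    rw [show ((S.L a m)⁻¹).1 ((S.L a m).1 (F y)) = F y from RelIso.inv_apply_self _ _,
      show ((S.L a m)⁻¹).1 ((S.L a m).1 (F x)) = F x from RelIso.inv_apply_self _ _,
      abs_of_pos (by linarith)] at h6
    have h8 := mul_le_mul_of_nonneg_left h6 hc.le
    have e : c * (1 / 2 ^ (m + 1) * (S.q (m + 1) : ℝ) *
        ((S.L a m).1 (F y) - (S.L a m).1 (F x))) = 2 * (S.q (m + 1) : ℝ) ^ 2 *
        ((S.L a m).1 (F y) - (S.L a m).1 (F x)) := by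
      rw [hcdef, pow_succ _ (m + 1)]; field_simp
    rw [e] at h8
    rw [div_le_iff₀ (by positivity)]
    linarith
  · rw [hKF, hKF]
    have h6 := (le_abs_self _).trans ((S.good m).lip _ (S.L_mem a m) (F y) (F x))
    rw [abs_of_pos (by linarith)] at h6
    refine h6.trans ?_
    rw [hLc]
    calc c / (8 * 2 ^ (2 * m)) * (F y - F x) = (c * F y - c * F x) / (8 * 2 ^ (2 * m)) := by ring
      _ ≤ 1 / (8 * 2 ^ (2 * m)) := by gcongr
      _ ≤ 1 / 2 := by
        apply one_div_le_one_div_of_le (by norm_num) (by linarith)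

/-- The square of a conjugation map is not a perturbation of the identity by tails. -/
lemma sq_ne_tail_mul (c d : ℕ+ → Bool) :
    SLift.toC (hL ψ (m + 1) (S.q (m + 1))) * SLift.toC (hL ψ (m + 1) (S.q (m + 1))) ≠
      S.tail c (m + 1) * (S.tail d (m + 1))⁻¹ := by
  intro h
  have h1 : ∀ x, |((hL ψ (m + 1) (S.q (m + 1))).1 * (hL ψ (m + 1) (S.q (m + 1))).1) x - x - 0| ≤
      4 / S.q (m + 2) := by
    intro x
    have := S.abs_tail_conj_le c d m 0 x
    have e : SLift.toC (trL 0) = 1 := Subtype.ext (RelIso.ext fun x => add_zero x)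
    rw [e, mul_one, ← h] at this
    exact this
  set t := tParam (m + 1) (S.q (m + 1)) with ht
  have h2 := (rescale_perturbation (S.scale_pos m) h1 (2 * t)).trans (S.scale_mul_le m)
  have M := S.isModel m
  rw [← ht] at M h2
  obtain ⟨sq0, sq1⟩ := M.sq_lt
  have p := M.pos
  have sm := M.small
  have hmm : rescale _ (S.scale_pos m) ((hL ψ (m + 1) (S.q (m + 1))).1 *
      (hL ψ (m + 1) (S.q (m + 1))).1) = S.model m * S.model m := map_mul _ _ _
  rw [hmm] at h2
  change |S.model m (S.model m (2 * t)) - 2 * t - _| ≤ _ at h2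
  -- Both applications use the left flat branch: `2 t` goes to `11 t / 4` up to `O(t²)`, a
  -- displacement far above the allowed `t / 1000`.
  rw [M.left (z := 2 * t) le_rfl (by linarith), M.left (by nlinarith) (by nlinarith)] at h2
  have h3 := (abs_le.1 h2).2
  nlinarith [pow_pos p 3]

/-- At the first differing digit the earlier factors cancel, leaving the square of a conjugation map
equal to a quotient of tails. -/
lemma eq_of_H_eq (h : S.H a = S.H b) : a = b := by
  by_contra hne
  have hex : ∃ m : ℕ, a m.succPNat ≠ b m.succPNat := by
    by_contra hall
    push Not at hall
    refine hne (funext fun n => ?_)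
    rw [← PNat.succPNat_natPred n]
    exact hall _
  classical
  set m := Nat.find hex
  have hm : a m.succPNat ≠ b m.succPNat := Nat.find_spec hex
  have hL : S.L a m = S.L b m := S.L_congr a b fun i hi => not_not.1 (Nat.find_min hex hi)
  have ht : S.tail a m = S.tail b m := by rw [tail, tail, hL, h]
  rw [S.g_mul_tail a m, S.g_mul_tail b m] at ht
  rcases S.g_eq a m with h1 | h1
  · apply S.sq_ne_tail_mul m b a
    rw [← S.g_inv_of_ne b a m hm.symm, map_inv] at ht
    rw [← h1, eq_mul_inv_iff_mul_eq, mul_assoc, ht, mul_inv_cancel_left]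
  · have h2 := S.g_inv_of_ne b a m hm.symm
    rw [h1, inv_inv] at h2
    apply S.sq_ne_tail_mul m a b
    rw [← S.g_inv_of_ne a b m hm, map_inv] at ht
    rw [h2, eq_mul_inv_iff_mul_eq, mul_assoc, ← ht, mul_inv_cancel_left]

end Scheme

lemma toHomeo_trL (β : ℝ) (x : S1) : toHomeo (SLift.toC (trL β)) x = x + (β : S1) := by
  induction x using s1_ind with
  | h x => rw [toHomeo_coe, SLift.toC_coe, trL_apply, AddCircle.coe_add]

namespace Scheme

variable {ψ : ℝ → ℝ} {α : ℝ} (S : Scheme ψ α) (a b : ℕ+ → Bool) (m : ℕ)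

/-! ### Conjugacies between the limits -/

/-- `H_a⁻¹ g H_b` commutes with `R_α` and is therefore a rotation. -/
lemma eq_toHomeo_of_conj (hα : Irrational α) (g : S1 ≃ₜ S1)
    (hg : toHomeo (SLift.toC (S.T a)) = g * toHomeo (SLift.toC (S.T b)) * g⁻¹) :
    ∃ β : ℝ, g = toHomeo (S.H a * SLift.toC (trL β) * (S.H b)⁻¹) := by
  set A := toHomeo (S.H a)
  set B := toHomeo (S.H b)
  set R := toHomeo (SLift.toC (trL α))
  have h1 : A⁻¹ * g * B * R = R * (A⁻¹ * g * B) := by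
    rw [toC_T, toC_T, map_mul, map_mul, map_mul, map_mul, map_inv, map_inv] at hg
    change A * R * A⁻¹ = g * (B * R * B⁻¹) * g⁻¹ at hg
    have h2 : A * R = g * (B * R * B⁻¹) * g⁻¹ * A := by rw [← hg]; group
    have h3 : R = A⁻¹ * (g * (B * R * B⁻¹) * g⁻¹ * A) := by rw [← h2]; group
    conv_rhs => rw [h3]
    group
  obtain ⟨β, hβ⟩ := exists_eq_add_of_commute hα (A⁻¹ * g * B) fun x => by
    have := congrArg (fun f : S1 ≃ₜ S1 => f x) h1
    change (A⁻¹ * g * B) (R x) = R ((A⁻¹ * g * B) x) at this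
    rwa [toHomeo_trL, toHomeo_trL] at this
  have h4 : A⁻¹ * g * B = toHomeo (SLift.toC (trL β)) :=
    Homeomorph.ext fun x => by rw [hβ, toHomeo_trL]
  refine ⟨β, ?_⟩
  rw [map_mul, map_mul, map_inv, ← h4]
  change g = A * (A⁻¹ * g * B) * B⁻¹
  group

/-- The identity conjugates `T_b` to `T_a`, so it is `H_a R_β H_b⁻¹`. As both conjugacies fix `0`,
`β` is an integer and `H_a = H_b`. -/
lemma toDiff_T_injective (hα : Irrational α) : Function.Injective fun a => toDiff (S.T a) := by
  intro a b hab
  obtain ⟨β, hβ⟩ := S.eq_toHomeo_of_conj a b hα 1 (by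
    have := congrArg (fun f : DiffPlus => f.1) hab
    simpa using this)
  have e : ∀ x, (((S.H a).1 (((S.H b)⁻¹).1 x + β) : ℝ) : S1) = (x : S1) := fun x => by
    have := congrArg (fun f : S1 ≃ₜ S1 => f (x : S1)) hβ
    change (x : S1) = _ at this
    rw [this]
    exact (toHomeo_coe (S.H a * SLift.toC (trL β) * (S.H b)⁻¹) x).symm
  set β' := (S.H a).1 β
  have h0 : ((β' : ℝ) : S1) = 0 := by
    have h1 : ((S.H b)⁻¹).1 0 = 0 := by
      apply (S.H b).1.injective
      rw [S.H_zero]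
      exact RelIso.apply_inv_self _ _
    have := e 0
    rw [h1, zero_add] at this
    exact this
  obtain ⟨k, hk⟩ := (AddCircle.coe_eq_zero_iff (1 : ℝ)).1 h0
  have hβk : β = k := by
    apply (S.H a).1.injective
    have := CLift.map_add_int (S.H a).2 0 k
    rw [zero_add, S.H_zero, zero_add] at this
    rw [this]
    change β' = k
    rw [← hk]; simp
  refine S.eq_of_H_eq a b (Subtype.ext (RelIso.ext fun y => ?_))
  have h2 : IsLift (deg1 (S.H a)) (toHomeo (S.H a)) := isLift_deg1 _
  have h3 : IsLift (deg1 (S.H b)) (toHomeo (S.H a)) := ⟨(S.H b).1.continuous, fun x => by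
    have := e ((S.H b).1 x)
    rw [show ((S.H b)⁻¹).1 ((S.H b).1 x) = x from RelIso.inv_apply_self _ _, hβk,
      CLift.map_add_int (S.H a).2, AddCircle.coe_add] at this
    rw [toHomeo_coe, deg1_apply, ← this]
    have hk0 : ((k : ℝ) : S1) = 0 := (AddCircle.coe_eq_zero_iff (1 : ℝ)).2 ⟨k, by simp⟩
    rw [hk0, add_zero]⟩
  obtain ⟨j, hj⟩ := h2.eq_add_int h3
  have hj0 := hj 0
  rw [deg1_apply, deg1_apply, S.H_zero, S.H_zero, zero_add] at hj0
  have := hj y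
  rw [← hj0, add_zero] at this
  exact this

lemma not_holderConj (hα : Irrational α) (hab : {n | a n ≠ b n}.Infinite) :
    ¬ HolderConj (toDiff (S.T a)) (toDiff (S.T b)) := by
  rintro ⟨g, -, ⟨C, r, hr, -, hC⟩, hg⟩
  obtain ⟨β, hβ⟩ := S.eq_toHomeo_of_conj a b hα g hg
  -- `3 / r ≤ m` gives `t ^ r ≤ q⁻³`, which with the expansion `1 / (20 q²)` yields `q ≤ 20 C`; but
  -- `20 C ≤ m < q`.
  obtain ⟨M, hM⟩ := exists_nat_ge (max (3 / (r : ℝ)) (20 * C))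
  obtain ⟨n, hn, hnM⟩ := hab.exists_gt M.succPNat
  obtain ⟨m, rfl⟩ : ∃ m : ℕ, n = m.succPNat := ⟨n.natPred, (PNat.succPNat_natPred n).symm⟩
  have hmM : M < m := by simpa using hnM
  have hmM' : (M : ℝ) ≤ m := by exact_mod_cast hmM.le
  obtain ⟨X, Y, h1, h2, h3, h4⟩ := S.exists_expand a b m hn β
  set K := S.H a * SLift.toC (trL β) * (S.H b)⁻¹
  have hq := S.q_pos m
  have hr' : (0 : ℝ) < r := hr
  have hd := hC.dist_le (Y : S1) (X : S1)
  rw [hβ, toHomeo_coe, toHomeo_coe] at hd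
  have hKpos : K.1 X < K.1 Y := K.1.strictMono h1
  -- The bound `1/2` on the image length makes circle distance equal to distance on the line.
  have hd1 : dist ((K.1 Y : ℝ) : S1) ((K.1 X : ℝ) : S1) = K.1 Y - K.1 X := by
    rw [dist_eq_norm, ← AddCircle.coe_sub, (AddCircle.norm_coe_eq_abs_iff 1 one_ne_zero).2,
      abs_of_pos (by linarith)]
    rw [abs_of_pos (by linarith), abs_one]
    exact h4
  have hd2 : dist (Y : S1) (X : S1) ≤ tParam (m + 1) (S.q (m + 1)) :=
    (dist_coe_le Y X).trans (by rw [abs_of_pos (by linarith)]; exact h2)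
  rw [hd1] at hd
  have h5 : dist (Y : S1) (X : S1) ^ (r : ℝ) ≤ ((S.q (m + 1) : ℝ) ^ 3)⁻¹ := by
    calc dist (Y : S1) (X : S1) ^ (r : ℝ) ≤ tParam (m + 1) (S.q (m + 1)) ^ (r : ℝ) :=
          Real.rpow_le_rpow dist_nonneg hd2 hr'.le
      _ = ((S.q (m + 1) : ℝ) ^ (((2 * (m + 1) - 1 : ℕ) : ℝ) * r))⁻¹ := by
          rw [tParam_eq (Nat.succ_pos m), Real.inv_rpow (by positivity), ← Real.rpow_natCast,
            ← Real.rpow_mul hq.le]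
      _ ≤ ((S.q (m + 1) : ℝ) ^ (3 : ℝ))⁻¹ := by
          apply inv_anti₀ (by positivity)
          apply Real.rpow_le_rpow_of_exponent_le
          · have := S.ten_lt m
            exact_mod_cast (by omega : 1 ≤ S.q (m + 1))
          · have h6 := ((le_max_left _ _).trans hM).trans hmM'
            rw [div_le_iff₀ hr'] at h6
            refine h6.trans (mul_le_mul_of_nonneg_right ?_ hr'.le)
            exact_mod_cast (by omega : m ≤ 2 * (m + 1) - 1)
      _ = _ := by norm_cast
  have h7 : 1 / (20 * (S.q (m + 1) : ℝ) ^ 2) ≤ C * ((S.q (m + 1) : ℝ) ^ 3)⁻¹ :=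
    h3.trans (hd.trans (mul_le_mul_of_nonneg_left h5 C.2))
  have h8 : (S.q (m + 1) : ℝ) ≤ 20 * C := by
    rw [← div_eq_mul_inv, div_le_div_iff₀ (by positivity) (by positivity)] at h7
    have h9 : (S.q (m + 1) : ℝ) ^ 2 * S.q (m + 1) ≤ (S.q (m + 1) : ℝ) ^ 2 * (20 * C) := by
      linarith
    exact le_of_mul_le_mul_left h9 (by positivity)
  have h10 : (m : ℝ) < S.q (m + 1) := by
    have h11 : m < 2 ^ (m + 20) := lt_of_lt_of_le Nat.lt_two_pow_self
      (Nat.pow_le_pow_right (by norm_num) (by omega))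
    exact_mod_cast h11.trans_le (S.q_ge_pow m)
  have := ((le_max_right _ _).trans hM).trans hmM'
  linarith

/-! ### Absolute continuity -/

/-- The union of the supports of the conjugation maps from step `m` on. -/
def supp : Set ℝ := ⋃ k, {x | Int.fract ((S.q (m + k + 1) : ℝ) * x) < 1 / 2 ^ (m + k + 2)}

lemma g_of_fract {x : ℝ} (hx : 1 / 2 ^ (m + 2) ≤ Int.fract ((S.q (m + 1) : ℝ) * x)) :
    (S.g a m).1 x = x := by
  have h := hL_of_fract S.step (Nat.succ_pos m) (S.ten_lt m) hx
  rcases S.g_eq a m with h1 | h1 <;> rw [h1]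
  · exact h
  · apply (hL ψ (m + 1) (S.q (m + 1))).1.injective
    rw [h]
    exact RelIso.apply_inv_self _ _

/-- New factors are composed on the right, so they act on `x` itself, which all of them fix. -/
lemma H_eq_L {x : ℝ} (hx : x ∉ S.supp m) : (S.H a).1 x = (S.L a m).1 x := by
  have h1 : ∀ j, (S.L a (m + j)).1 x = (S.L a m).1 x := by
    intro j
    induction j with
    | zero => rfl
    | succ j ih =>
      change (S.L a (m + j)).1 ((S.g a (m + j)).1 x) = _
      rw [S.g_of_fract, ih]
      simp only [supp, mem_iUnion, mem_ofPred_eq, not_exists, not_lt] at hx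
      exact hx j
  have h2 : Tendsto (fun j => (S.L a (m + j)).1 x) atTop (𝓝 ((S.H a).1 x)) :=
    ((tendsto_add_atTop_iff_nat m).2 (S.tendsto_L a x)).congr fun j => by rw [add_comm]
  exact tendsto_nhds_unique h2 (tendsto_const_nhds.congr fun j => (h1 j).symm)

lemma volume_image_fract_le {G : SLift} {q : ℕ} (hq : 0 < q) {δ ε : ℝ} (hδ : 0 < δ)
    (h : ∑ j ∈ Finset.range q, (G.1 ((j : ℝ) / q + δ / q) - G.1 ((j : ℝ) / q)) ≤ ε) :
    volume (G.1 '' (Ico 0 1 ∩ {x | Int.fract ((q : ℝ) * x) < δ})) ≤ ENNReal.ofReal ε := by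
  have hq0 : (0 : ℝ) < q := by exact_mod_cast hq
  have hsub : G.1 '' (Ico 0 1 ∩ {x | Int.fract ((q : ℝ) * x) < δ}) ⊆
      ⋃ j ∈ Finset.range q, Icc (G.1 ((j : ℝ) / q)) (G.1 ((j : ℝ) / q + δ / q)) := by
    rintro _ ⟨x, ⟨hx, hxδ⟩, rfl⟩
    have hn : 0 ≤ (q : ℝ) * x := mul_nonneg hq0.le hx.1
    rw [mem_ofPred_eq, Int.fract, ← natCast_floor_eq_intCast_floor hn] at hxδ
    have hfl := Nat.floor_le hn
    simp only [mem_iUnion, Finset.mem_range]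
    refine ⟨⌊(q : ℝ) * x⌋₊, (Nat.floor_lt hn).2 (by nlinarith [hx.2]),
      G.1.monotone ?_, G.1.monotone ?_⟩
    · rw [div_le_iff₀ hq0]; linarith
    · rw [← add_div, le_div_iff₀ hq0]; linarith
  refine (measure_mono hsub).trans ((measure_biUnion_finset_le _ _).trans ?_)
  simp only [Real.volume_Icc]
  rw [← ENNReal.ofReal_sum_of_nonneg]
  · exact ENNReal.ofReal_le_ofReal h
  · intro j _
    exact sub_nonneg.2 (G.1.monotone (by have := div_pos hδ hq0; linarith))

/-- The support added at step `m + k + 1` contributes at most `2^{-(m+k+1)}`; these bounds sum to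
`2^{-m}`. -/
lemma volume_image_supp_le {G : SLift} (hG : G ∈ S.conjs m) :
    volume (G.1 '' (Ico 0 1 ∩ S.supp m)) ≤ ENNReal.ofReal (1 / 2 ^ m) := by
  rw [supp, inter_iUnion, image_iUnion]
  refine (measure_iUnion_le _).trans ?_
  have h1 : ∀ k, volume (G.1 '' (Ico 0 1 ∩
      {x | Int.fract ((S.q (m + k + 1) : ℝ) * x) < 1 / 2 ^ (m + k + 2)})) ≤
      ENNReal.ofReal (1 / 2 ^ m / 2 / 2 ^ k) := fun k => by
    refine volume_image_fract_le (by have := S.ten_lt (m + k); omega) (by positivity)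
      (((S.good (m + k)).sum_le G (S.conjs_mono (Nat.le_add_right m k) hG)).trans (le_of_eq ?_))
    rw [pow_add, pow_add, pow_add]
    field_simp
  refine (ENNReal.tsum_le_tsum h1).trans ?_
  rw [← ENNReal.ofReal_tsum_of_nonneg (fun k => by positivity) (summable_geometric_two' _),
    tsum_geometric_two']

lemma image_Ico {f : ℝ ≃o ℝ} (hf : f ∈ CLift) (h0 : f 0 = 0) : f '' Ico 0 1 = Ico 0 1 := by
  have h1 : f 1 = 1 := by have := hf 0; rwa [zero_add, h0, zero_add] at this
  rw [OrderIso.image_Ico, h0, h1]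

/-- Both maps are bijections of `[0, 1)` that agree off the support, so they map the support onto
the same set. Thus the measure bound for the smooth `L a m` passes to `H a`. -/
lemma image_supp : (S.H a).1 '' (Ico 0 1 ∩ S.supp m) = (S.L a m).1 '' (Ico 0 1 ∩ S.supp m) := by
  have h1 := image_Ico (S.H a).2 (S.H_zero a)
  have h2 := image_Ico (S.L a m).2.1 (S.L_apply_zero a m)
  have h3 : (S.H a).1 '' (Ico 0 1 \ S.supp m) = (S.L a m).1 '' (Ico 0 1 \ S.supp m) :=
    image_congr fun x hx => S.H_eq_L a m hx.2
  have e : Ico (0 : ℝ) 1 ∩ S.supp m = Ico 0 1 \ (Ico 0 1 \ S.supp m) := by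
    rw [sdiff_sdiff_right_self]
  rw [e, image_sdiff (S.H a).1.injective, image_sdiff (S.L a m).1.injective, h1, h2, h3]

lemma volume_image_sLift_eq_zero (f : SLift) {A : Set ℝ} (hA : volume A = 0) :
    volume (f.1 '' A) = 0 :=
  addHaar_image_eq_zero_of_differentiableOn_of_addHaar_eq_zero volume
    (differentiable_of_smooth f.2.2.1).differentiableOn hA

lemma eq_zero_of_forall_le {c : ENNReal} (h : ∀ m : ℕ, c ≤ ENNReal.ofReal (1 / 2 ^ m)) :
    c = 0 := by
  have ht := ENNReal.tendsto_ofReal (tendsto_const_div_two_pow 1)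
  rw [ENNReal.ofReal_zero] at ht
  exact le_antisymm (ge_of_tendsto' ht h) zero_le

lemma volume_image_H {A : Set ℝ} (hA : A ⊆ Ico 0 1) (h0 : volume A = 0) :
    volume ((S.H a).1 '' A) = 0 := by
  refine eq_zero_of_forall_le fun m => ?_
  have hsub : (S.H a).1 '' A ⊆ (S.L a m).1 '' A ∪ (S.L a m).1 '' (Ico 0 1 ∩ S.supp m) := by
    rintro _ ⟨x, hx, rfl⟩
    by_cases hs : x ∈ S.supp m
    · rw [← S.image_supp]
      exact Or.inr ⟨x, ⟨hA hx, hs⟩, rfl⟩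
    · rw [S.H_eq_L a m hs]
      exact Or.inl ⟨x, hx, rfl⟩
  refine (measure_mono hsub).trans ((measure_union_le _ _).trans ?_)
  rw [volume_image_sLift_eq_zero _ h0, zero_add]
  exact S.volume_image_supp_le m (S.L_mem a m)

lemma volume_preimage_H {A : Set ℝ} (h0 : volume A = 0) :
    volume ((S.H a).1 ⁻¹' A ∩ Ico 0 1) = 0 := by
  refine eq_zero_of_forall_le fun m => ?_
  have hsub : (S.H a).1 ⁻¹' A ∩ Ico 0 1 ⊆
      ((S.L a m)⁻¹).1 '' A ∪ (1 : SLift).1 '' (Ico 0 1 ∩ S.supp m) := by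
    rintro x ⟨hxA, hx⟩
    by_cases hs : x ∈ S.supp m
    · exact Or.inr ⟨x, ⟨hx, hs⟩, rfl⟩
    · rw [mem_preimage, S.H_eq_L a m hs] at hxA
      exact Or.inl ⟨_, hxA, RelIso.inv_apply_self _ _⟩
  refine (measure_mono hsub).trans ((measure_union_le _ _).trans ?_)
  rw [volume_image_sLift_eq_zero _ h0, zero_add]
  -- The identity is among the admissible conjugations, so the same estimate bounds the support
  -- itself.
  refine S.volume_image_supp_le m (S.conjs_mono (Nat.zero_le m) ?_)
  rw [S.conjs_zero]
  exact Finset.mem_singleton_self _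

lemma volume_circle_eq_zero_iff (N : Set S1) :
    volume N = 0 ↔ volume (((↑) : ℝ → S1) ⁻¹' N ∩ Ico 0 1) = 0 := by
  have e : volume (((↑) : ℝ → S1) ⁻¹' N ∩ Ico 0 1) = volume (((↑) : ℝ → S1) ⁻¹' N ∩ Ioc 0 1) :=
    measure_congr (ae_eq_set_inter (ae_eq_refl _) Ico_ae_eq_Ioc)
  rw [e]
  constructor
  · intro h
    have := (UnitAddCircle.measurePreserving_mk 0).quasiMeasurePreserving.preimage_null h
    rw [zero_add, Measure.restrict_apply' measurableSet_Ioc] at this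
    exact this
  · intro h
    have h1 := (AddCircle.measurePreserving_equivIoc (1 : ℝ) (a := 0)).quasiMeasurePreserving
    have h2 := h1.preimage_null (s := Subtype.val ⁻¹' (((↑) : ℝ → S1) ⁻¹' N)) (by
      rw [comap_subtype_coe_apply measurableSet_Ioc, Subtype.image_preimage_coe, zero_add,
        inter_comm]
      exact h)
    refine measure_mono_null (fun z hz => ?_) h2
    change (((AddCircle.equivIoc 1 0 z : Ioc (0 : ℝ) (0 + 1)) : ℝ) : S1) ∈ N
    rw [AddCircle.coe_equivIoc]
    exact hz

end Scheme

/-! ### Unique ergodicity of irrational rotations -/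

/-- For continuous `f`, the function `β ↦ ∫ f (x + β) dν` is continuous and invariant under adding
`α`, hence constant. So `ν` is invariant under all translations and is the normalized Haar measure.
-/
lemma eq_volume_of_map_add {α : ℝ} (hα : Irrational α) (ν : Measure S1) [IsProbabilityMeasure ν]
    (hν : ν.map (fun x => x + (α : S1)) = ν) : ν = volume := by
  have hmeas : ∀ β : S1, Measurable fun x : S1 => x + β := fun β => measurable_id.add_const β
  have hinv : ∀ β : S1, ν.map (fun x => x + β) = ν := by
    intro β
    have := Measure.isProbabilityMeasure_map (μ := ν) (hmeas β).aemeasurable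
    refine ext_of_forall_integral_eq_of_IsFiniteMeasure fun f => ?_
    set φ : S1 → ℝ := fun β => ∫ x, f (x + β) ∂ν
    have hφc : Continuous φ := by
      refine continuous_of_dominated (bound := fun _ => ‖f‖) (fun β => ?_) (fun β => ?_)
        (integrable_const _) ?_
      · exact (f.continuous.measurable.comp (hmeas β)).aestronglyMeasurable
      · exact Eventually.of_forall fun x => f.norm_coe_le_norm _
      · exact Eventually.of_forall fun x => f.continuous.comp (continuous_const.add continuous_id)
    have hφp : Function.Periodic φ (α : S1) := fun β => by
      change ∫ x, f (x + (β + (α : S1))) ∂ν = ∫ x, f (x + β) ∂ν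
      conv_rhs => rw [← hν]
      rw [integral_map (f := fun x => f (x + β)) (hmeas _).aemeasurable
        (f.continuous.measurable.comp (hmeas β)).aestronglyMeasurable]
      refine integral_congr_ae (Eventually.of_forall fun x => ?_)
      change f _ = f _
      congr 1
      abel
    have hd : DenseRange ((· • (α : S1)) : ℤ → S1) :=
      AddCircle.denseRange_zsmul_coe_iff.2 (by simpa using hα)
    have h : φ = fun _ => φ 0 := by
      refine Continuous.ext_on hd hφc continuous_const ?_
      rintro _ ⟨n, rfl⟩
      have := hφp.zsmul n 0
      rwa [zero_add] at this
    have h1 := congrFun h β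
    change ∫ x, f (x + β) ∂ν = ∫ x, f (x + 0) ∂ν at h1
    simp only [add_zero] at h1
    rw [integral_map (hmeas _).aemeasurable f.continuous.measurable.aestronglyMeasurable]
    exact h1
  have hleft : ν.IsAddLeftInvariant := ⟨fun β => by
    have : (fun x => β + x) = fun x : S1 => x + β := funext fun x => add_comm _ _
    rw [this]
    exact hinv β⟩
  have hhaar : ν.IsAddHaarMeasure :=
    Measure.isAddHaarMeasure_of_isCompact_nonempty_interior ν univ isCompact_univ
      (by rw [interior_univ]; exact univ_nonempty) (by simp) (by simp)
  have : IsProbabilityMeasure (volume : Measure S1) := ⟨UnitAddCircle.measure_univ⟩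
  exact Measure.isAddHaarMeasure_eq_of_isProbabilityMeasure ν volume

/-! ### Absolute continuity on the circle -/

namespace Scheme

variable {ψ : ℝ → ℝ} {α : ℝ} (S : Scheme ψ α) (a : ℕ+ → Bool)

lemma H_inv_mem_Ico {y : ℝ} (hy : y ∈ Ico (0 : ℝ) 1) : ((S.H a)⁻¹).1 y ∈ Ico (0 : ℝ) 1 := by
  rw [← image_Ico (S.H a).2 (S.H_zero a)] at hy
  obtain ⟨x, hx, rfl⟩ := hy
  rwa [show ((S.H a)⁻¹).1 ((S.H a).1 x) = x from RelIso.inv_apply_self _ _]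

lemma volume_image_toHomeo {N : Set S1} (hN : volume N = 0) :
    volume (toHomeo (S.H a) '' N) = 0 := by
  rw [volume_circle_eq_zero_iff] at hN ⊢
  refine measure_mono_null ?_ (S.volume_image_H a inter_subset_right hN)
  rintro y ⟨⟨z, hz, hzy⟩, hy⟩
  refine ⟨((S.H a)⁻¹).1 y, ⟨?_, S.H_inv_mem_Ico a hy⟩, RelIso.apply_inv_self _ _⟩
  have h : z = ((((S.H a)⁻¹).1 y : ℝ) : S1) := by
    apply (toHomeo (S.H a)).injective
    rw [hzy, toHomeo_coe, show (S.H a).1 (((S.H a)⁻¹).1 y) = y from RelIso.apply_inv_self _ _]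
  rw [mem_preimage, ← h]
  exact hz

lemma volume_preimage_toHomeo {N : Set S1} (hN : volume N = 0) :
    volume (toHomeo (S.H a) ⁻¹' N) = 0 := by
  rw [volume_circle_eq_zero_iff] at hN ⊢
  refine measure_mono_null ?_ (S.volume_preimage_H a hN)
  rintro x ⟨hxN, hx⟩
  have h : (S.H a).1 x ∈ Ico (0 : ℝ) 1 := by
    rw [← image_Ico (S.H a).2 (S.H_zero a)]
    exact ⟨x, hx, rfl⟩
  rw [mem_preimage, mem_preimage, toHomeo_coe] at hxN
  exact ⟨⟨hxN, h⟩, hx⟩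

/-- The invariant measure is the image of Lebesgue measure under `H a`. Uniqueness is pulled back to
the rotation, and equivalence says that `H a` preserves null sets in both directions. -/
lemma absContConj (hα : Irrational α) : AbsContConj (toHomeo (S.H a)) (toDiff (S.T a)) := by
  set A := toHomeo (S.H a)
  have hR : (rot α).1 = toHomeo (SLift.toC (trL α)) := by rw [← toDiff_trL, toDiff_coe]
  have hT : ∀ x, (toDiff (S.T a)).1 (A x) = A (x + (α : S1)) := fun x => by
    rw [toDiff_coe, toC_T, map_mul, map_mul, map_inv]
    change A (toHomeo (SLift.toC (trL α)) (A⁻¹ (A x))) = _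
    rw [toHomeo_trL, show A⁻¹ (A x) = x from A.symm_apply_apply x]
  have mA := A.continuous.measurable
  have mA' := A.symm.continuous.measurable
  have mT := (toDiff (S.T a)).1.continuous.measurable
  have mR : Measurable fun x : S1 => x + (α : S1) := measurable_id.add_const _
  have hp : IsProbabilityMeasure (volume : Measure S1) := ⟨UnitAddCircle.measure_univ⟩
  refine ⟨⟨volume.map A, ⟨Measure.isProbabilityMeasure_map mA.aemeasurable, ?_⟩, ?_, ?_, ?_⟩,
    fun N hN => S.volume_image_toHomeo a hN⟩
  · have e : (toDiff (S.T a)).1 ∘ A = A ∘ fun x => x + (α : S1) := funext hT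
    rw [Measure.map_map mT mA, e, ← Measure.map_map mA mR, map_add_right_eq_self]
  · intro ν hν hνT
    have e : (fun x => x + (α : S1)) ∘ A.symm = A.symm ∘ (toDiff (S.T a)).1 := funext fun y => by
      have := hT (A.symm y)
      rw [A.apply_symm_apply] at this
      rw [Function.comp_apply, Function.comp_apply, this, A.symm_apply_apply]
    have hν' : IsProbabilityMeasure (ν.map A.symm) :=
      Measure.isProbabilityMeasure_map mA'.aemeasurable
    have h1 : ν.map A.symm = volume := by
      refine eq_volume_of_map_add hα _ ?_
      rw [Measure.map_map mR mA', e, ← Measure.map_map mA' mT, hνT]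
    rw [← h1, Measure.map_map mA mA', A.self_comp_symm, Measure.map_id]
  · refine Measure.AbsolutelyContinuous.mk fun N hN h0 => ?_
    rw [Measure.map_apply mA hN]
    exact S.volume_preimage_toHomeo a h0
  · refine Measure.AbsolutelyContinuous.mk fun N hN h0 => ?_
    rw [Measure.map_apply mA hN] at h0
    have := S.volume_image_toHomeo a h0
    rwa [image_preimage_eq _ A.surjective] at this

end Scheme

end CircleConj

end

theorem mainTheorem8 (α : ℝ) (hα : Liouville α) (ψ : ℝ → ℝ) (hψ : CircleConj.IsStep ψ) :
    ∃ (p : ℕ+ → ℤ) (q : ℕ+ → ℕ) (h : ℕ+ → CircleConj.DiffPlus)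
      (H : (ℕ+ → Bool) → CircleConj.HomeoPlus) (Ψ : (ℕ+ → Bool) → CircleConj.DiffPlus),
      -- the rational numbers `p n / q n` and the maps `h n`
      (∀ n, 0 < q n ∧ CircleConj.tParam n (q n) < 1 / 10) ∧
      (∀ n : ℕ+, q n ^ (2 * (n : ℕ)) ≤ q (n + 1)) ∧
      Tendsto (fun n => (p n : ℝ) / q n) atTop (𝓝 α) ∧
      (∀ (n : ℕ+) (x : ℝ),
        ((CircleConj.hBarLift ψ n (q n) x : ℝ) : CircleConj.S1) = (h n).1 (x : CircleConj.S1)) ∧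
      -- existence of the limits
      (∀ a, Tendsto (fun n => CircleConj.d0 (CircleConj.HSeq h a n).1 (H a).1) atTop (𝓝 0)) ∧
      (∀ a, (H a).1 0 = 0) ∧
      (∀ a, CircleConj.ConvergesDiff
        (fun n => CircleConj.conjRot h a n ((p n.succPNat : ℝ) / q n.succPNat)) (Ψ a)) ∧
      (∀ a, CircleConj.ConvergesDiff (fun n => CircleConj.conjRot h a n α) (Ψ a)) ∧
      (∀ a, (Ψ a).1 = (H a).1 * (CircleConj.rot α).1 * (H a).1⁻¹) ∧
      -- the limit conjugacy is absolutely continuous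
      (∀ a, CircleConj.AbsContConj (H a).1 (Ψ a)) ∧
      -- the limit diffeomorphisms have the properties of the main proposition
      (∀ a, CircleConj.HasRotationNumber (Ψ a).1 (α : CircleConj.S1)) ∧
      (∀ a, Tendsto (fun b => CircleConj.dInf (Ψ b) (Ψ a)) (𝓝 a) (𝓝 0)) ∧
      Function.Injective Ψ ∧
      (∀ a b : ℕ+ → Bool, (∃ N, ∀ n ≥ N, a n = b n) → CircleConj.SmoothConj (Ψ a) (Ψ b)) ∧
      (∀ a b : ℕ+ → Bool, {n | a n ≠ b n}.Infinite → ¬ CircleConj.HolderConj (Ψ a) (Ψ b)) := by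
  open CircleConj in
  obtain ⟨S⟩ := exists_scheme hα hψ
  have hirr := hα.irrational
  refine ⟨fun n => S.p n, fun n => S.q n, fun n => toDiff (S.h n),
    fun a => ⟨toHomeo (S.H a), toHomeo_mem _⟩, fun a => toDiff (S.T a), fun n => ?_, fun n => ?_,
    ?_, fun n x => ?_, fun a => ?_, fun a => ?_, fun a => ?_, fun a => ?_, fun a => ?_,
    fun a => S.absContConj a hirr, fun a => S.hasRotationNumber a, fun a => S.tendsto_dInf a,
    S.toDiff_T_injective hirr, fun a b => S.smoothConj a b, fun a b => S.not_holderConj a b hirr⟩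
  · exact ⟨lt_trans (by norm_num) (S.ten_lt' n), tParam_lt n.pos (S.ten_lt' n)⟩
  · exact (Nat.le_mul_of_pos_left _ (by positivity)).trans (S.q_ge_mul n)
  · have h1 : Tendsto (fun n : ℕ+ => (n : ℕ)) atTop atTop :=
      tendsto_atTop.2 fun b => (eventually_ge_atTop b.succPNat).mono fun n hn => by
        have : (b.succPNat : ℕ) ≤ n := hn
        rw [Nat.succPNat_coe] at this
        omega
    exact ((tendsto_add_atTop_iff_nat (f := fun m => (S.p m : ℝ) / S.q m) 1).1 S.tendsto_rational).comp h1
  · rw [toDiff_coe, toHomeo_coe, SLift.toC_coe, Scheme.h, hL_coe hψ n.pos (S.ten_lt' n)]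
  · refine (S.tendsto_d0 a).congr fun m => ?_
    rw [Scheme.L, toDiff_LSeq]
  · have := toHomeo_coe (S.H a) 0
    rw [S.H_zero] at this
    exact this
  · have := S.convergesDiff_rational a
    simp only [Scheme.L, toDiff_conjL] at this
    exact this
  · have := S.convergesDiff_conjL a
    simp only [Scheme.L, toDiff_conjL] at this
    exact this
  · have hR : (rot α).1 = toHomeo (SLift.toC (trL α)) := by rw [← toDiff_trL, toDiff_coe]
    rw [toDiff_coe, S.toC_T, map_mul, map_mul, map_inv, hR]
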